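/- **Theorem 4.1.** Let $\mu>0$ and $2\mu+3\lambda\ge 0$. For $\mathbb U=(n,v,E)$ with $n$ scalar, $v=(v^i)_{i\le 3}$ and $E=(E^{ij})_{i,j\le 3}$ real-valued on $\mathbb R^3$, consider the linearized compressible viscoelastic system $$n_t+\operatorname{div}v=0,\qquad \partial_t v^i-\mu\Delta v^i-(\lambda+\mu)\partial_i\operatorname{div}v+\partial_i n-\sum_k\partial_kE^{ik}=0,\qquad \partial_tE^{ij}-\partial_jv^i=0$$ on $[0,\infty)\times\mathbb R^3$, with $\mathbb U(0)=\mathbb F$. Write $\mathbb P(n,v,E)=(0,v,0)$ and $(\mathbb I-\mathbb P)(n,v,E)=(n,0,E)$. Let $\|\mathbb F\|_q$ be the $L^q$ norm, $\|\mathbb F\|_{k,2}$ the norm of the Sobolev space $H^k=W^{k}_2$, and $\|\mathbb F\|_{\mathbb W_2^{k,j}}=\|(\mathbb I-\mathbb P)\mathbb F\|_{k,2}+\|\mathbb P\mathbb F\|_{j,2}$ (each taken as a sum over components, and equal to $+\infty$ off the corresponding space); let $(a)^+=\max(a,0)$. A triple $\mathbb F=(n_0,v_0,E_0)$ is called *admissible*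 if, in the sense of distributions, $$\partial_kn_0+\sum_j\partial_jE_0^{jk}=0,\qquad \partial_lE_0^{jk}=\partial_kE_0^{jl}\qquad(j,k,l=1,2,3).$$ For every $\mathbb F\in L^2$ the system has exactly one weak (distributional) solution $\mathbb U\in C([0,\infty);L^2)$ with $\mathbb U(0)=\mathbb F$, and $\mathbb E(t)\mathbb F=\mathbb U(t)$ defines bounded linear operators $\mathbb E(t)$ on $L^2$, $t\ge0$. There is a decomposition $$\mathbb E(t)\mathbb F=\mathbb E_0(t)\mathbb F+\mathbb E_\infty(t)\mathbb F\qquad(t\ge 0,\ \mathbb F\in L^2),$$ where $\mathbb E_\infty(t)$ is a bounded linear operator on $L^2$ and $\mathbb E_0(t)$ is a bounded linear operator from $L^q$ to $L^2$ for each $q\in[1,2]$ (consistently on the intersections of these spaces), with the following properties. For admissible $\mathbb F$ in $L^q$, respectively in $L^2$, the functions $t\mapsto\mathbb E_0(t)\mathbb F$ and $t\mapsto\mathbb E_\infty(t)\mathbb F$ are $C^\infty$ on $(0,\infty)$ with values in $L^2$, and (with $\partial_x^\ell$ standing for all weak spatial derivatives of order $\ell$): (1) For all integers $\ell,m\ge0$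 and all $1\le q\le 2$ there is a constant $C=C(m,\ell,q)$ such that for all admissible $\mathbb F\in L^q$ $$\|\partial_t^m\partial_x^\ell\mathbb E_0(t)\mathbb F\|_2\le C\,t^{-\frac32(\frac1q-\frac12)-\frac{m+\ell}2}\|\mathbb F\|_q\quad(t\ge1),\qquad \|\partial_t^m\partial_x^\ell\mathbb E_0(t)\mathbb F\|_2\le C\,\|\mathbb F\|_q\quad(0<t\le2).$$ There is moreover a constant $c>0$ such that for all integers $\ell,m,n\ge0$ there are constants $C=C(m,\ell,n)$ and $C'=C'(m,\ell)$ such that for all admissible $\mathbb F\in L^2$ and all $t>0$: (2) $$\|\partial_t^m\partial_x^\ell(\mathbb I-\mathbb P)\mathbb E_\infty(t)\mathbb F\|_2\le Ce^{-ct}\Big[t^{-\frac n2}\|\mathbb F\|_{(2m+\ell-n-1)^+,2}+\|\mathbb F\|_{\mathbb W_2^{\ell,(\ell-1)^+}}\Big],$$ $$\|\partial_t^m\partial_x^\ell\mathbb P\mathbb E_\infty(t)\mathbb F\|_2\le Ce^{-ct}\Big[t^{-\frac n2}\|\mathbb F\|_{\mathbb W_2^{(2m+\ell-n-1)^+,(2m+\ell-n)^+}}+\|\mathbb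 F\|_{\mathbb W_2^{(\ell-1)^+,(\ell-2)^+}}\Big];$$ (3) $$\|\partial_t^m\partial_x^\ell(\mathbb I-\mathbb P)\mathbb E_\infty(t)\mathbb F\|_\infty\le C\,t^{-(\frac n2+\frac34)}e^{-ct}\|\mathbb F\|_{(2m+\ell-n-1)^+,2}+C'e^{-ct}\Big[\|\mathbb F\|_{\mathbb W_2^{\ell,\ell+1}}+\|(\mathbb I-\mathbb P)\mathbb F\|_{\ell+2,2}\Big],$$ $$\|\partial_t^m\partial_x^\ell\mathbb P\mathbb E_\infty(t)\mathbb F\|_\infty\le Ce^{-ct}\Big[t^{-(\frac n2+\frac34)}\|\mathbb F\|_{\mathbb W_2^{(2m+\ell-n-1)^+,(2m+\ell-n)^+}}+\|\mathbb F\|_{\mathbb W_2^{\ell+1,\ell}}\Big].$$ -/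

import Mathlib

open MeasureTheory Set
open scoped ENNReal ContDiff

noncomputable section

namespace Viscoelastic

/-- Three-dimensional Euclidean space. -/
abbrev R3 : Type := EuclideanSpace ℝ (Fin 3)

/-- Scalar functions on `ℝ³` of class `L^p`. -/
abbrev ScalarLp (p : ℝ≥0∞) : Type := Lp ℝ p (volume : Measure R3)

/-- Triples `U = (n, v, E)` (density, velocity, deformation) with entries in `L^p(ℝ³)`;
`n = U.1`, `v i = U.2.1 i`, `E^{ij} = U.2.2 i j`. -/
abbrev Triple (p : ℝ≥0∞) : Type :=
  ScalarLp p × (Fin 3 → ScalarLp p) × (Fin 3 → Fin 3 → ScalarLp p)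

/-- The projection `P (n, v, E) = (0, v, 0)`. -/
def projP {p : ℝ≥0∞} (U : Triple p) : Triple p := (0, U.2.1, 0)

/-- The complementary projection `(I - P) (n, v, E) = (n, 0, E)`. -/
def projIP {p : ℝ≥0∞} (U : Triple p) : Triple p := (U.1, 0, U.2.2)

/-- The classical partial derivative `∂_i φ`. -/
def pderiv (i : Fin 3) (φ : R3 → ℝ) : R3 → ℝ :=
  fun x => fderiv ℝ φ x (EuclideanSpace.single i 1)

/-- The classical derivative `∂^α φ = ∂_0^{α 0} ∂_1^{α 1} ∂_2^{α 2} φ` for a multi-index `α`. -/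
def multiDeriv (α : Fin 3 → ℕ) (φ : R3 → ℝ) : R3 → ℝ :=
  (pderiv 0)^[α 0] ((pderiv 1)^[α 1] ((pderiv 2)^[α 2] φ))

/-- Test functions: `C_0^∞(ℝ³)`. -/
def IsTest (φ : R3 → ℝ) : Prop := ContDiff ℝ ∞ φ ∧ HasCompactSupport φ

/-- The pairing `∫ f φ dx`. -/
def pair (f φ : R3 → ℝ) : ℝ := ∫ x, f x * φ x

/-- `g` is the weak derivative `∂^α f`. -/
def HasWeakDeriv (α : Fin 3 → ℕ) (f g : R3 → ℝ) : Prop :=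
  LocallyIntegrable f ∧ LocallyIntegrable g ∧
    ∀ φ, IsTest φ → pair f (multiDeriv α φ) = (-1) ^ (∑ i, α i) * pair g φ

/-- `‖∂^α f‖_{L^p}`, equal to `∞` if `f` has no weak derivative `∂^α f` (weak derivatives are
unique almost everywhere, so that the infimum is over at most one class). -/
def derivNorm (α : Fin 3 → ℕ) (p : ℝ≥0∞) (f : R3 → ℝ) : ℝ≥0∞ :=
  ⨅ (g : R3 → ℝ) (_ : HasWeakDeriv α f g), eLpNorm g p volume

/-- `∑_{|α| = l} ‖∂^α f‖_{L^p}`. -/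
def orderNorm (l : ℕ) (p : ℝ≥0∞) (f : R3 → ℝ) : ℝ≥0∞ :=
  ∑ α ∈ Finset.piAntidiag (Finset.univ : Finset (Fin 3)) l, derivNorm α p f

/-- The Sobolev norm `‖f‖_{k,p} = ∑_{|α| ≤ k} ‖∂^α f‖_{L^p}`, equal to `∞` off `W^{k,p}`. -/
def sobolevNorm (k : ℕ) (p : ℝ≥0∞) (f : R3 → ℝ) : ℝ≥0∞ :=
  ∑ l ∈ Finset.range (k + 1), orderNorm l p f

/-- The sum over all thirteen scalar components of `U` of a (semi)norm `N`. -/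
def compSum {p : ℝ≥0∞} (N : (R3 → ℝ) → ℝ≥0∞) (U : Triple p) : ℝ≥0∞ :=
  N U.1 + ∑ i, N (U.2.1 i) + ∑ i, ∑ j, N (U.2.2 i j)

/-- The `L^q` norm of a triple. -/
def lqNorm {p : ℝ≥0∞} (q : ℝ≥0∞) (U : Triple p) : ℝ≥0∞ :=
  compSum (fun f => eLpNorm f q volume) U

/-- The norm `‖∂_x^l U‖_{L^q}` of all spatial derivatives of order `l`. -/
def dxNorm {p : ℝ≥0∞} (l : ℕ) (q : ℝ≥0∞) (U : Triple p) : ℝ≥0∞ :=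
  compSum (orderNorm l q) U

/-- The Sobolev norm `‖U‖_{k,2}` of a triple. -/
def hNorm {p : ℝ≥0∞} (k : ℕ) (U : Triple p) : ℝ≥0∞ := compSum (sobolevNorm k 2) U

/-- The mixed norm `‖U‖_{W_2^{k,m}} = ‖(I - P) U‖_{k,2} + ‖P U‖_{m,2}`. -/
def wNorm {p : ℝ≥0∞} (k m : ℕ) (U : Triple p) : ℝ≥0∞ := hNorm k (projIP U) + hNorm m (projP U)

/-- The linearized constraints, in the sense of distributions:
`∂_k n + ∑_j ∂_j E^{jk} = 0` and `∂_l E^{jk} = ∂_k E^{jl}`. -/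
def Constrained {p : ℝ≥0∞} (F : Triple p) : Prop :=
  (∀ φ, IsTest φ → ∀ k, pair F.1 (pderiv k φ) + ∑ j, pair (F.2.2 j k) (pderiv j φ) = 0) ∧
  (∀ φ, IsTest φ → ∀ j k l, pair (F.2.2 j k) (pderiv l φ) = pair (F.2.2 j l) (pderiv k φ))

/-- `U ∈ C([0,∞); L²)` is a weak solution on `[0,∞) × ℝ³`, with initial value `F`, of
`n_t + div v = 0`,
`∂_t v_i - mu Δ v_i - (lam + mu) ∂_i div v + ∂_i n - ∑_k ∂_k E^{ik} = 0`,
`∂_t E^{ij} - ∂_j v_i = 0`. -/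
structure IsSolution (mu lam : ℝ) (F : Triple 2) (U : ℝ → Triple 2) : Prop where
  continuousOn : ContinuousOn U (Ici 0)
  initial : U 0 = F
  density : ∀ φ, IsTest φ → ∀ t, 0 ≤ t →
    HasDerivWithinAt (fun s => pair (U s).1 φ)
      (∑ i, pair ((U t).2.1 i) (pderiv i φ)) (Ici 0) t
  velocity : ∀ φ, IsTest φ → ∀ i, ∀ t, 0 ≤ t →
    HasDerivWithinAt (fun s => pair ((U s).2.1 i) φ)
      (mu * ∑ j, pair ((U t).2.1 i) (pderiv j (pderiv j φ))
        + (lam + mu) * ∑ j, pair ((U t).2.1 j) (pderiv j (pderiv i φ))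
        + pair (U t).1 (pderiv i φ)
        - ∑ k, pair ((U t).2.2 i k) (pderiv k φ)) (Ici 0) t
  deformation : ∀ φ, IsTest φ → ∀ i j, ∀ t, 0 ≤ t →
    HasDerivWithinAt (fun s => pair ((U s).2.2 i j) φ)
      (-pair ((U t).2.1 i) (pderiv j φ)) (Ici 0) t

/-- `E(t)`, `t ≥ 0`, is the solution operator: for every initial value `F ∈ L²`, the function
`t ↦ E(t) F` is a solution, and it is the only one. -/
def IsSolutionOperator (mu lam : ℝ) (E : ℝ → Triple 2 →L[ℝ] Triple 2) : Prop :=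
  ∀ (F : Triple 2) (U : ℝ → Triple 2),
    IsSolution mu lam F U ↔ EqOn U (fun t => E t F) (Ici 0)

/-- Almost everywhere equality of triples that may belong to different Lebesgue spaces. -/
def SameTriple {p q : ℝ≥0∞} (F : Triple p) (G : Triple q) : Prop :=
  F.1 =ᵐ[volume] G.1 ∧ (∀ i, F.2.1 i =ᵐ[volume] G.2.1 i) ∧
    ∀ i j, F.2.2 i j =ᵐ[volume] G.2.2 i j

/-- The time derivative `∂_t^m` of a curve in `L²`, at time `t`. -/
def dtIter (m : ℕ) (U : ℝ → Triple 2) (t : ℝ) : Triple 2 := iteratedDeriv m U t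

end Viscoelastic

end

open Viscoelastic

noncomputable section

namespace Viscoelastic

open FourierTransform LineDeriv Filter Topology
open scoped SchwartzMap

/-! ### Test functions are dense in the Schwartz space -/

/-! After a Fourier transform the system is an ordinary differential equation at each frequency.
Write r for the length of the angular frequency and ω for its direction. The constraints say that E
= q ⊗ ω and n = -ω·q (`Adm.deformation_eq`, `Adm.density_eq`), so an admissible state is a pair of
vectors (v, q). Split both across and along ω: each part of q solves a damped oscillator y'' + ν r²
y' + κ r² y = 0, with (ν, κ) = (μ, 1) across ω and (2μ + λ, 2) along ω, where the pressure doubles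
the elastic force. The hypotheses on μ and λ make both values of ν positive. Hence the symbol `sym`
of the solution operator is a bounded matrix depending on ω, with entries multiplied by combinations
of the fundamental solution S of the oscillators (`block`).

Two estimates of S carry the theorem. For r ≤ R an energy with a small cross term decays like exp(-c
r² t), and every time derivative gains a factor r (`exists_osc_low`, `exists_block_low`). For large
r the characteristic roots are real; one stays close to -κ/ν and the other is comparable to -r²
(`exists_osc_high`, `exists_block_high`). The first root gives exponential decay without smoothing,
the second gives the smoothing of a heat equation, and each velocity index of a matrix entry lowers
the power of r in front of the first mode and raises it in front of the second. This is the source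
of the mixed norms. The two parts of the decomposition are the solution operator below and above a
sharp cutoff at R.

At low frequencies the Fourier transform of an L^q function is defined by duality, because
band-limited L² functions are bounded. Multiplication by a symbol is then estimated by an
interpolation between the sup norm and the L² norm of the symbol (`norm_mulOp_lowFourier_le`), and
the L² norm t^(-3/4) of a Gaussian gives the decay rate. At high frequencies the L² estimates are
Plancherel. The L^∞ estimates bound the inverse transform by an L¹ norm and apply Cauchy–Schwarz
with r⁻², which is square integrable at infinity in dimension three, or with a Gaussian
(`exists_derivNorm_high_top_le`).

For data in L² that are not admissible, `coefP` projects at each frequency onto the admissible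
vectors; the complement has no velocity and does not move (`static_relation`). For uniqueness, the
time integral W of a solution w with zero data satisfies w = A W on the frequency side; below any
cutoff A is bounded, so Grönwall's inequality yields W = 0 (`eq_zero_of_isSolution_zero`). -/

lemma exists_cutoff : ∃ χ : R3 → ℝ, ContDiff ℝ ∞ χ ∧ HasCompactSupport χ ∧
    (∀ x, ‖x‖ ≤ 1 → χ x = 1) := by
  let f : ContDiffBump (0 : R3) := ⟨1, 2, one_pos, one_lt_two⟩
  refine ⟨f, f.contDiff, f.hasCompactSupport, fun x hx => ?_⟩
  exact f.one_of_mem_closedBall (by simpa using hx)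

/-- The function vanishes near every point with ‖x‖ < N. Elsewhere one more power of ‖x‖ ≥ N,
available by Schwartz decay, pays for the factor 1/N; derivatives of the rescaled cutoff are bounded
uniformly in N because the dilation is a contraction. -/
lemma tendsto_cutoff_smul (χ : R3 → ℝ) (hχ : ContDiff ℝ ∞ χ) (hs : HasCompactSupport χ)
    (h1 : ∀ x, ‖x‖ ≤ 1 → χ x = 1) (h : 𝓢(R3, ℂ)) (k n : ℕ) :
    ∃ C : ℝ, ∀ N : ℕ, 0 < N → ∀ x, ‖x‖ ^ k *
      ‖iteratedFDeriv ℝ n (fun y => (1 - χ ((N : ℝ)⁻¹ • y)) • h y) x‖ ≤ C / N := by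
  have hψ : ContDiff ℝ ∞ (fun y => 1 - χ y) := contDiff_const.sub hχ
  have hb : ∀ i : ℕ, ∃ B : ℝ, ∀ x, ‖iteratedFDeriv ℝ i (fun y => 1 - χ y) x‖ ≤ B := by
    intro i
    rcases Nat.eq_zero_or_pos i with rfl | hi
    · have hc : Continuous (fun x => 1 - χ x) := hψ.continuous
      obtain ⟨B, hB⟩ := hs.exists_bound_of_continuous hχ.continuous
      refine ⟨1 + B, fun x => ?_⟩
      rw [norm_iteratedFDeriv_zero]
      exact (norm_sub_le _ _).trans (by simpa using hB x)
    · have hc := (hs.iteratedFDeriv (𝕜 := ℝ) i)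
      obtain ⟨B, hB⟩ := hc.exists_bound_of_continuous
        (hχ.continuous_iteratedFDeriv (m := i) (mod_cast le_top))
      refine ⟨B, fun x => ?_⟩
      have : iteratedFDeriv ℝ i (fun y => 1 - χ y) x = - iteratedFDeriv ℝ i χ x := by
        have := iteratedFDeriv_sub_apply (𝕜 := ℝ) (i := i) (f := fun _ : R3 => (1 : ℝ)) (g := χ)
          (x := x) contDiffAt_const (hχ.contDiffAt.of_le (mod_cast le_top))
        have h2 : (fun y => 1 - χ y) = (fun _ : R3 => (1 : ℝ)) - χ := rfl
        rw [h2, this, iteratedFDeriv_const_of_ne hi.ne']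
        simp
      rw [this, norm_neg]
      exact hB x
  choose B hB using hb
  have hB0 : ∀ i, 0 ≤ B i := fun i => (norm_nonneg _).trans (hB i 0)
  refine ⟨∑ i ∈ Finset.range (n + 1), (n.choose i : ℝ) * B i *
    SchwartzMap.seminorm ℝ (k + 1) (n - i) h, fun N hN x => ?_⟩
  have hN' : (0 : ℝ) < N := Nat.cast_pos.2 hN
  have hN1 : (1 : ℝ) ≤ N := by exact_mod_cast hN
  let L : R3 →L[ℝ] R3 := (N : ℝ)⁻¹ • ContinuousLinearMap.id ℝ R3
  have hL : ‖L‖ ≤ 1 := by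
    refine ContinuousLinearMap.opNorm_le_bound _ zero_le_one fun x => ?_
    have : L x = (N : ℝ)⁻¹ • x := rfl
    rw [this, norm_smul, norm_inv, Real.norm_of_nonneg hN'.le]
    gcongr
    exact inv_le_one_of_one_le₀ hN1
  have hfac : ∀ i, ‖iteratedFDeriv ℝ i (fun y => 1 - χ ((N : ℝ)⁻¹ • y)) x‖ ≤ B i := by
    intro i
    have := L.iteratedFDeriv_comp_right (f := fun y => 1 - χ y) hψ x (i := i) (mod_cast le_top)
    have h2 : (fun y => 1 - χ ((N : ℝ)⁻¹ • y)) = (fun y => 1 - χ y) ∘ L := rfl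
    rw [h2, this]
    refine (ContinuousMultilinearMap.norm_compContinuousLinearMap_le _ _).trans ?_
    have h3 : ∏ _j : Fin i, ‖L‖ ≤ 1 := Finset.prod_le_one (fun _ _ => norm_nonneg _) (fun _ _ => hL)
    exact (mul_le_of_le_one_right (norm_nonneg _) h3).trans (hB i _)
  rcases lt_or_ge ‖x‖ N with hx | hx
  · have hz : (fun y => (1 - χ ((N : ℝ)⁻¹ • y)) • h y) =ᶠ[𝓝 x] fun _ => 0 := by
      filter_upwards [(isOpen_lt continuous_norm continuous_const).mem_nhds hx] with y hy
      have : χ ((N : ℝ)⁻¹ • y) = 1 := by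
        apply h1
        rw [norm_smul, norm_inv, Real.norm_of_nonneg hN'.le, inv_mul_le_iff₀ hN', mul_one]
        exact le_of_lt hy
      simp [this]
    rw [(hz.iteratedFDeriv ℝ n).eq_of_nhds]
    have : iteratedFDeriv ℝ n (fun _ : R3 => (0 : ℂ)) x = 0 := by
      have := iteratedFDeriv_fun_zero (𝕜 := ℝ) (E := R3) (F := ℂ) (n := n)
      simp [this]
    rw [this, norm_zero, mul_zero]
    exact div_nonneg (Finset.sum_nonneg fun i _ => mul_nonneg
      (mul_nonneg (by positivity) (hB0 i)) (apply_nonneg _ _)) hN'.le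
  · have h2 := norm_iteratedFDeriv_smul_le (𝕜 := ℝ) (n := n)
      (f := fun y => 1 - χ ((N : ℝ)⁻¹ • y)) (g := h) (N := ∞)
      (hψ.comp (contDiff_const_smul _)) (h.smooth ⊤) x (mod_cast le_top)
    rw [le_div_iff₀ hN']
    calc ‖x‖ ^ k * ‖iteratedFDeriv ℝ n (fun y => (1 - χ ((N : ℝ)⁻¹ • y)) • h y) x‖ * N
        ≤ ‖x‖ ^ k * (∑ i ∈ Finset.range (n + 1), (n.choose i : ℝ) * B i *
          ‖iteratedFDeriv ℝ (n - i) h x‖) * ‖x‖ := by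
          refine mul_le_mul (mul_le_mul_of_nonneg_left (h2.trans ?_) (by positivity)) hx
            (by positivity) ?_
          · refine Finset.sum_le_sum fun i _ => ?_
            gcongr
            exact hfac i
          · exact mul_nonneg (by positivity) (Finset.sum_nonneg fun i _ =>
              mul_nonneg (mul_nonneg (by positivity) (hB0 i)) (norm_nonneg _))
      _ = ∑ i ∈ Finset.range (n + 1), (n.choose i : ℝ) * B i *
          (‖x‖ ^ (k + 1) * ‖iteratedFDeriv ℝ (n - i) h x‖) := by
          rw [Finset.mul_sum, Finset.sum_mul]
          exact Finset.sum_congr rfl fun i _ => by ring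
      _ ≤ _ := by
          refine Finset.sum_le_sum fun i _ => ?_
          refine mul_le_mul_of_nonneg_left (h.le_seminorm ℝ _ _ x)
            (mul_nonneg (by positivity) (hB0 i))

/-- A real test function as a complex Schwartz function. -/
def IsTest.toSchwartz {φ : R3 → ℝ} (h : IsTest φ) : 𝓢(R3, ℂ) :=
  HasCompactSupport.toSchwartzMap (f := fun x => (φ x : ℂ)) (h.2.comp_left (g := Complex.ofReal) rfl)
    (Complex.ofRealCLM.contDiff.comp h.1)

@[simp]
lemma IsTest.toSchwartz_apply {φ : R3 → ℝ} (h : IsTest φ) (x : R3) : h.toSchwartz x = φ x := rfl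

/-- A continuous functional on the Schwartz space that vanishes on test functions is zero. -/
theorem eq_zero_of_forall_isTest (T : 𝓢(R3, ℂ) →L[ℂ] ℂ)
    (hT : ∀ φ, ∀ h : IsTest φ, T h.toSchwartz = 0) (f : 𝓢(R3, ℂ)) : T f = 0 := by
  obtain ⟨χ, hχ, hs, h1⟩ := exists_cutoff
  have htest : ∀ N : ℕ, 0 < N → ∀ g : R3 → ℝ, ContDiff ℝ ∞ g →
      IsTest (fun x => χ ((N : ℝ)⁻¹ • x) * g x) := by
    intro N hN g hg
    refine ⟨(hχ.comp (contDiff_const_smul _)).mul hg, HasCompactSupport.mul_right ?_⟩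
    exact hs.comp_homeomorph (Homeomorph.smulOfNeZero ((N : ℝ)⁻¹)
      (inv_ne_zero (Nat.cast_ne_zero.2 hN.ne')))
  have hfre : ContDiff ℝ ∞ (fun x => (f x).re) := Complex.reCLM.contDiff.comp (f.smooth ⊤)
  have hfim : ContDiff ℝ ∞ (fun x => (f x).im) := Complex.imCLM.contDiff.comp (f.smooth ⊤)
  -- Test functions are real, so the real and imaginary parts are cut off separately.
  let g : ℕ → 𝓢(R3, ℂ) := fun N =>
    (htest (N + 1) N.succ_pos _ hfre).toSchwartz +
      Complex.I • (htest (N + 1) N.succ_pos _ hfim).toSchwartz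
  have hg : ∀ N, T (g N) = 0 := fun N => by
    simp only [g, map_add, map_smul, hT, smul_zero, add_zero]
  have hlim : Tendsto g atTop (𝓝 f) := by
    rw [(schwartz_withSeminorms ℝ R3 ℂ).tendsto_nhds _ _]
    rintro ⟨k, n⟩ ε hε
    obtain ⟨C, hC⟩ := tendsto_cutoff_smul χ hχ hs h1 f k n
    have hCN : Tendsto (fun N : ℕ => C / ((N + 1 : ℕ) : ℝ)) atTop (𝓝 0) :=
      (tendsto_const_div_atTop_nhds_zero_nat C).comp (tendsto_add_atTop_nat 1)
    filter_upwards [hCN.eventually (gt_mem_nhds hε)] with N hN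
    refine lt_of_le_of_lt ?_ hN
    rw [← neg_sub, map_neg_eq_map]
    have hC0 : 0 ≤ C / ((N + 1 : ℕ) : ℝ) :=
      le_trans (by positivity) (hC (N + 1) N.succ_pos 0)
    refine SchwartzMap.seminorm_le_bound ℝ k n _ hC0 fun x => ?_
    have : (⇑(f - g N) : R3 → ℂ) = fun y => (1 - χ (((N + 1 : ℕ) : ℝ)⁻¹ • y)) • f y := by
      ext y
      apply Complex.ext
      · simp [g, sub_mul]
      · simp [g, sub_mul]
    rw [this]
    exact hC (N + 1) N.succ_pos x
  have := (T.continuous.tendsto f).comp hlim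
  refine tendsto_nhds_unique this ?_
  simp only [Function.comp_def, hg, tendsto_const_nhds]

/-! ### Symbols of constant coefficient differential operators -/

/-- The angular frequency `2π ξ_i`. -/
def freq (i : Fin 3) (ξ : R3) : ℝ := 2 * Real.pi * ξ i

/-- `D` is a differential operator with symbol `p`. -/
structure IsSymbol (D : (R3 → ℝ) → R3 → ℝ) (p : R3 → ℂ) : Prop where
  growth : p.HasTemperateGrowth
  exists_clm : ∃ T : 𝓢(R3, ℂ) →L[ℂ] 𝓢(R3, ℂ),
    (∀ φ (h : IsTest φ), ∃ h' : IsTest (D φ), T h.toSchwartz = h'.toSchwartz) ∧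
    ∀ η : 𝓢(R3, ℂ), 𝓕 (T η) = SchwartzMap.smulLeftCLM ℂ p (𝓕 η)

lemma IsSymbol.id : IsSymbol (fun φ => φ) (fun _ => 1) :=
  ⟨by fun_prop, ContinuousLinearMap.id ℂ _, fun φ h => ⟨h, rfl⟩, fun η => by
    simp [SchwartzMap.smulLeftCLM_const]⟩

lemma IsSymbol.comp {D D' : (R3 → ℝ) → R3 → ℝ} {p p' : R3 → ℂ} (h : IsSymbol D p)
    (h' : IsSymbol D' p') : IsSymbol (fun φ => D (D' φ)) (fun ξ => p ξ * p' ξ) := by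
  obtain ⟨T, hT, hTp⟩ := h.exists_clm
  obtain ⟨T', hT', hTp'⟩ := h'.exists_clm
  refine ⟨h.growth.mul h'.growth, T.comp T', fun φ hφ => ?_, fun η => ?_⟩
  · obtain ⟨h1, h2⟩ := hT' φ hφ
    obtain ⟨h3, h4⟩ := hT _ h1
    exact ⟨h3, by simp [h2, h4]⟩
  · rw [ContinuousLinearMap.comp_apply, hTp, hTp',
      SchwartzMap.smulLeftCLM_smulLeftCLM_apply h.growth h'.growth]
    rfl

lemma IsSymbol.iterate {D : (R3 → ℝ) → R3 → ℝ} {p : R3 → ℂ} (h : IsSymbol D p) (n : ℕ) :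
    IsSymbol (D^[n]) (fun ξ => p ξ ^ n) := by
  induction n with
  | zero => simpa using! IsSymbol.id
  | succ n ih =>
    have := ih.comp h
    simp only [Function.iterate_succ, pow_succ]
    exact this

lemma isSymbol_pderiv (i : Fin 3) : IsSymbol (pderiv i) (fun ξ => Complex.I * freq i ξ) := by
  have hg : (fun ξ : R3 => (inner ℝ ξ (EuclideanSpace.single i (1 : ℝ)) : ℝ)).HasTemperateGrowth := by
    fun_prop
  have hg2 : (fun ξ : R3 => ((inner ℝ ξ (EuclideanSpace.single i (1 : ℝ)) : ℝ) : ℂ)).HasTemperateGrowth := by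
    fun_prop
  have he : (fun ξ => Complex.I * (freq i ξ : ℂ)) = fun ξ : R3 =>
      (2 * Real.pi * Complex.I) * ((inner ℝ ξ (EuclideanSpace.single i (1 : ℝ)) : ℝ) : ℂ) := by
    ext ξ
    simp [freq, EuclideanSpace.inner_single_right]
    ring
  refine ⟨?_, lineDerivOpCLM ℂ 𝓢(R3, ℂ) (EuclideanSpace.single i (1 : ℝ)), fun φ h => ?_,
    fun η => ?_⟩
  · rw [he]
    fun_prop
  · have h1 : IsTest (pderiv i φ) :=
      ⟨(h.1.fderiv_right (m := ∞) (by simp)).clm_apply contDiff_const, h.2.fderiv_apply ℝ _⟩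
    refine ⟨h1, ?_⟩
    ext x
    rw [lineDerivOpCLM_apply, SchwartzMap.lineDerivOp_apply_eq_fderiv]
    have hd : HasFDerivAt φ (fderiv ℝ φ x) x :=
      (h.1.differentiable (by simp) x).hasFDerivAt
    have := (Complex.ofRealCLM.hasFDerivAt (x := φ x)).comp x hd
    have h2 : (⇑h.toSchwartz : R3 → ℂ) = Complex.ofRealCLM ∘ φ := rfl
    rw [h2, this.fderiv]
    rfl
  · rw [lineDerivOpCLM_apply, SchwartzMap.fourier_lineDerivOp_eq, he]
    ext ξ
    rw [SchwartzMap.smulLeftCLM_apply_apply (by fun_prop), _root_.smul_apply,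
      SchwartzMap.smulLeftCLM_apply_apply hg]
    simp [mul_assoc]

/-- The symbol of `∂^α`. -/
def monomial (α : Fin 3 → ℕ) (ξ : R3) : ℂ := ∏ i, (Complex.I * freq i ξ) ^ α i

lemma isSymbol_multiDeriv (α : Fin 3 → ℕ) : IsSymbol (multiDeriv α) (monomial α) := by
  have := ((isSymbol_pderiv 0).iterate (α 0)).comp
    (((isSymbol_pderiv 1).iterate (α 1)).comp ((isSymbol_pderiv 2).iterate (α 2)))
  have h2 : monomial α = fun ξ => (Complex.I * freq 0 ξ) ^ α 0 *
      ((Complex.I * freq 1 ξ) ^ α 1 * (Complex.I * freq 2 ξ) ^ α 2) := by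
    ext ξ
    simp [monomial, Fin.prod_univ_three, mul_assoc]
  rw [h2]
  exact this

lemma continuous_freq (i : Fin 3) : Continuous (freq i) := by unfold freq; fun_prop

/-- The length of the angular frequency. -/
def rad (ξ : R3) : ℝ := 2 * Real.pi * ‖ξ‖

lemma continuous_rad : Continuous rad := by unfold rad; fun_prop

lemma rad_nonneg (ξ : R3) : 0 ≤ rad ξ := by unfold rad; positivity

lemma abs_freq_le (i : Fin 3) (ξ : R3) : |freq i ξ| ≤ rad ξ := by
  have := EuclideanSpace.norm_eq ξ
  have h : ‖ξ i‖ ≤ ‖ξ‖ := PiLp.norm_apply_le ξ i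
  rw [Real.norm_eq_abs] at h
  rw [freq, rad, abs_mul, abs_of_pos Real.two_pi_pos]
  gcongr

lemma norm_monomial_le (α : Fin 3 → ℕ) (ξ : R3) : ‖monomial α ξ‖ ≤ rad ξ ^ (∑ i, α i) := by
  rw [monomial, norm_prod, ← Finset.prod_pow_eq_pow_sum]
  refine Finset.prod_le_prod (fun _ _ => norm_nonneg _) fun i _ => ?_
  rw [norm_pow, norm_mul, Complex.norm_I, one_mul, Complex.norm_real, Real.norm_eq_abs]
  exact pow_le_pow_left₀ (abs_nonneg _) (abs_freq_le i ξ) _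

lemma conj_monomial (α : Fin 3 → ℕ) (ξ : R3) :
    (starRingEnd ℂ) (monomial α ξ) = (-1) ^ (∑ i, α i) * monomial α ξ := by
  simp only [monomial, map_prod, map_pow, map_mul, Complex.conj_I, Complex.conj_ofReal]
  rw [← Finset.prod_pow_eq_pow_sum, ← Finset.prod_mul_distrib]
  refine Finset.prod_congr rfl fun i _ => ?_
  rw [← mul_pow]
  ring

lemma continuous_monomial (α : Fin 3 → ℕ) : Continuous (monomial α) := by
  unfold monomial
  have := continuous_freq
  fun_prop

lemma sum_freq_sq (ξ : R3) : ∑ i, freq i ξ ^ 2 = rad ξ ^ 2 := by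
  rw [rad, mul_pow, EuclideanSpace.norm_sq_eq, Finset.mul_sum]
  simp [freq, mul_pow]

/-! ### Complexification and the pairing on the frequency side -/

/-- The inclusion of real in complex functions. -/
def cplx (p : ℝ≥0∞) [Fact (1 ≤ p)] : ScalarLp p →L[ℝ] Lp ℂ p (volume : Measure R3) :=
  Complex.ofRealCLM.compLpL p volume

lemma coeFn_cplx {p : ℝ≥0∞} [Fact (1 ≤ p)] (f : ScalarLp p) :
    cplx p f =ᵐ[volume] fun x => (f x : ℂ) := Complex.ofRealCLM.coeFn_compLpL f

/-- Complex valued `L²` functions. -/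
abbrev CL2 : Type := Lp ℂ 2 (volume : Measure R3)

/-- The real part. -/
def realPart : CL2 →L[ℝ] ScalarLp 2 := Complex.reCLM.compLpL 2 volume

lemma coeFn_realPart (f : CL2) : realPart f =ᵐ[volume] fun x => (f x).re :=
  Complex.reCLM.coeFn_compLpL f

lemma realPart_cplx (f : ScalarLp 2) : realPart (cplx 2 f) = f := by
  ext1
  filter_upwards [coeFn_realPart (cplx 2 f), coeFn_cplx f] with x h1 h2
  rw [h1, h2, Complex.ofReal_re]

lemma inner_CL2 (f g : CL2) : inner ℂ f g = ∫ x, (starRingEnd ℂ) (f x) * g x := by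
  rw [L2.inner_def]
  simp [mul_comm]

lemma integrable_conj_mul (f g : CL2) : Integrable (fun x => (starRingEnd ℂ) (f x) * g x) := by
  have := L2.integrable_inner (𝕜 := ℂ) f g
  simpa [mul_comm] using this

lemma inner_toLp (η : 𝓢(R3, ℂ)) (w : CL2) :
    inner ℂ (η.toLp 2) w = ∫ x, (starRingEnd ℂ) (η x) * w x := by
  rw [inner_CL2]
  refine integral_congr_ae ?_
  filter_upwards [η.coeFn_toLp 2] with x hx
  rw [hx]

lemma integrable_schwartz_mul (η : 𝓢(R3, ℂ)) (w : CL2) :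
    Integrable (fun x => (starRingEnd ℂ) (η x) * w x) := by
  refine (integrable_conj_mul (η.toLp 2) w).congr ?_
  filter_upwards [η.coeFn_toLp 2] with x hx
  rw [hx]

lemma inner_fourierInv (η : 𝓢(R3, ℂ)) (w : CL2) :
    inner ℂ (η.toLp 2 : CL2) (𝓕⁻ w : CL2) = inner ℂ ((𝓕 η : 𝓢(R3, ℂ)).toLp 2) w := by
  rw [← SchwartzMap.toLp_fourier_eq, ← Lp.inner_fourier_eq, fourier_fourierInv_eq]

lemma pair_realPart {φ : R3 → ℝ} (h : IsTest φ) (w : CL2) :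
    pair (realPart w) φ = (inner ℂ (h.toSchwartz.toLp 2) w).re := by
  rw [inner_toLp]
  change _ = Complex.reCLM _
  rw [← ContinuousLinearMap.integral_comp_comm _ (integrable_schwartz_mul _ w)]
  refine integral_congr_ae ?_
  filter_upwards [coeFn_realPart w] with x hx
  simp [hx, mul_comm]

/-- The pairing of an inverse Fourier transform with a derivative of a test function. -/
lemma IsSymbol.pair_realPart_fourierInv {D : (R3 → ℝ) → R3 → ℝ} {p : R3 → ℂ} (hD : IsSymbol D p)
    {φ : R3 → ℝ} (h : IsTest φ) (w : CL2) :
    pair (realPart (𝓕⁻ w)) (D φ) =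
      (∫ ξ, (starRingEnd ℂ) (p ξ * (𝓕 h.toSchwartz) ξ) * w ξ).re := by
  obtain ⟨T, hT, hTp⟩ := hD.exists_clm
  obtain ⟨h1, h2⟩ := hT φ h
  rw [pair_realPart h1, ← h2, inner_fourierInv, hTp, inner_toLp]
  simp only [SchwartzMap.smulLeftCLM_apply_apply hD.growth, smul_eq_mul]

lemma IsSymbol.integrable {D : (R3 → ℝ) → R3 → ℝ} {p : R3 → ℂ} (hD : IsSymbol D p)
    (η : 𝓢(R3, ℂ)) (w : CL2) :
    Integrable (fun ξ => (starRingEnd ℂ) (p ξ * η ξ) * w ξ) := by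
  have := integrable_schwartz_mul (SchwartzMap.smulLeftCLM ℂ p η) w
  simpa only [SchwartzMap.smulLeftCLM_apply_apply hD.growth, smul_eq_mul] using this

/-- `a` is the Fourier transform of `f` on the set `Ω`. -/
def Represents (Ω : Set R3) {q : ℝ≥0∞} (f : ScalarLp q) (a : CL2) : Prop :=
  ∀ η : 𝓢(R3, ℂ), tsupport η ⊆ Ω → inner ℂ a (η.toLp 2) = ∫ x, (𝓕⁻ η) x * (f x : ℂ)

lemma represents_fourier (f : ScalarLp 2) : Represents univ f (𝓕 (cplx 2 f)) := by
  intro η _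
  have : η.toLp 2 = 𝓕 ((𝓕⁻ η).toLp 2 : CL2) := by
    rw [SchwartzMap.toLp_fourier_eq, fourier_fourierInv_eq]
  rw [this, Lp.inner_fourier_eq, inner_CL2]
  refine integral_congr_ae ?_
  filter_upwards [coeFn_cplx f, (𝓕⁻ η).coeFn_toLp 2] with x h1 h2
  rw [h1, h2, Complex.conj_ofReal, mul_comm]

lemma exists_schwartz_functional {q : ℝ≥0∞} [Fact (1 ≤ q)] (f : ScalarLp q) :
    ∃ Λ : 𝓢(R3, ℂ) →L[ℂ] ℂ, ∀ η, Λ η = ∫ x, η x * (f x : ℂ) := by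
  refine ⟨(Lp.toTemperedDistribution (cplx q f)), fun η => ?_⟩
  refine (Lp.toTemperedDistribution_apply (cplx q f) η).trans ?_
  refine integral_congr_ae ?_
  filter_upwards [coeFn_cplx f] with x hx
  rw [hx, smul_eq_mul]

/-- A linear differential relation in the sense of distributions holds pointwise on the
frequency side. -/
theorem Represents.sum_symbol_eq_zero {Ω : Set R3} (hΩ : IsOpen Ω) {q : ℝ≥0∞} [Fact (1 ≤ q)]
    {ι : Type*} [Fintype ι] {f : ι → ScalarLp q} {a : ι → CL2} (ha : ∀ c, Represents Ω (f c) (a c))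
    {D : ι → (R3 → ℝ) → R3 → ℝ} {p : ι → R3 → ℂ} (hD : ∀ c, IsSymbol (D c) (p c)) (k : ι → ℝ)
    (h : ∀ φ, IsTest φ → ∑ c, k c * pair (f c) (D c φ) = 0) :
    ∀ᵐ ξ, ξ ∈ Ω → ∑ c, k c * p c ξ * (starRingEnd ℂ) (a c ξ) = 0 := by
  choose T hT hTp using fun c => (hD c).exists_clm
  choose Φ hΦ using fun c => exists_schwartz_functional (f c)
  let Λ : 𝓢(R3, ℂ) →L[ℂ] ℂ := ∑ c, (k c : ℂ) • (Φ c).comp (T c)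
  have hΛ : ∀ η, Λ η = ∑ c, (k c : ℂ) * ∫ x, T c η x * (f c x : ℂ) := by
    intro η
    simp [Λ, hΦ]
  have h0 : ∀ η, Λ η = 0 := by
    refine eq_zero_of_forall_isTest Λ fun φ hφ => ?_
    rw [hΛ]
    have : ∀ c, (k c : ℂ) * ∫ x, T c hφ.toSchwartz x * (f c x : ℂ) =
        ((k c * pair (f c) (D c φ) : ℝ) : ℂ) := by
      intro c
      obtain ⟨h1, h2⟩ := hT c φ hφ
      rw [h2, Complex.ofReal_mul, pair, ← integral_complex_ofReal]
      congr 2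
      ext x
      simp [mul_comm]
    rw [Finset.sum_congr rfl fun c _ => this c, ← Complex.ofReal_sum, h φ hφ, Complex.ofReal_zero]
  have hloc : LocallyIntegrable
      (fun ξ => ∑ c, k c * p c ξ * (starRingEnd ℂ) (a c ξ)) volume := by
    refine locallyIntegrable_finsetSum _ fun c _ => ?_
    have h1 : LocallyIntegrable (fun ξ => (starRingEnd ℂ) (a c ξ)) volume := by
      have : MemLp (fun ξ => (starRingEnd ℂ) (a c ξ)) 2 volume := (Lp.memLp (a c)).star
      exact this.locallyIntegrable one_le_two
    have h2 : Continuous (fun ξ => k c * p c ξ) :=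
      continuous_const.mul (hD c).growth.1.continuous
    exact h1.continuous_smul h2
  refine hΩ.ae_eq_zero_of_integral_contDiff_smul_eq_zero (hloc.locallyIntegrableOn _) ?_
  intro g hg hgs hgΩ
  have hgt : IsTest g := ⟨hg, hgs⟩
  have hsup : ∀ c, tsupport (SchwartzMap.smulLeftCLM ℂ (p c) hgt.toSchwartz) ⊆ Ω := by
    intro c
    refine (SchwartzMap.tsupport_smulLeftCLM_subset (p c) hgt.toSchwartz).trans ?_
    refine inter_subset_left.trans (subset_trans ?_ hgΩ)
    exact closure_mono fun x hx => by
      simpa using hx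
  -- The inverse transform of a compactly supported function is not a test function; the extension
  -- `h0` to all Schwartz functions is what allows localization in frequency.
  have key := h0 (𝓕⁻ hgt.toSchwartz)
  rw [hΛ] at key
  have : ∀ c, ∫ x, T c (𝓕⁻ hgt.toSchwartz) x * (f c x : ℂ) =
      ∫ ξ, (starRingEnd ℂ) (a c ξ) * (p c ξ * g ξ) := by
    intro c
    have e1 : T c (𝓕⁻ hgt.toSchwartz) = 𝓕⁻ (SchwartzMap.smulLeftCLM ℂ (p c) hgt.toSchwartz) := by
      rw [show T c (𝓕⁻ hgt.toSchwartz) = 𝓕⁻ (𝓕 (T c (𝓕⁻ hgt.toSchwartz))) from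
        (fourierInv_fourier_eq _).symm, hTp, fourier_fourierInv_eq]
    rw [e1, ← ha c _ (hsup c), inner_CL2]
    refine integral_congr_ae ?_
    filter_upwards [SchwartzMap.coeFn_toLp (SchwartzMap.smulLeftCLM ℂ (p c) hgt.toSchwartz) 2]
      with ξ hξ
    rw [hξ, SchwartzMap.smulLeftCLM_apply_apply (hD c).growth]
    rfl
  rw [Finset.sum_congr rfl fun c _ => by rw [this c]] at key
  rw [← key]
  have hint : ∀ c, Integrable (fun ξ => (starRingEnd ℂ) (a c ξ) * (p c ξ * g ξ)) := by
    intro c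
    refine (integrable_conj_mul (a c)
      ((SchwartzMap.smulLeftCLM ℂ (p c) hgt.toSchwartz).toLp 2)).congr ?_
    filter_upwards [SchwartzMap.coeFn_toLp (SchwartzMap.smulLeftCLM ℂ (p c) hgt.toSchwartz) 2]
      with ξ hξ
    rw [hξ, SchwartzMap.smulLeftCLM_apply_apply (hD c).growth]
    rfl
  simp_rw [← integral_const_mul]
  rw [← integral_finsetSum _ fun c _ => (hint c).const_mul _]
  refine integral_congr_ae (Eventually.of_forall fun ξ => ?_)
  simp only [Finset.smul_sum, Complex.real_smul]
  exact Finset.sum_congr rfl fun c _ => by ring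

/-! ### Norms of derivatives on the frequency side -/

lemma locallyIntegrable_Lp {p : ℝ≥0∞} [hp : Fact (1 ≤ p)] (f : ScalarLp p) :
    LocallyIntegrable f (volume : Measure R3) := (Lp.memLp f).locallyIntegrable hp.out

/-- No Hermitian symmetry of `w` is needed: test functions are real, so taking the real part
commutes with the pairing. The sign comes from the conjugate of the monomial. -/
lemma hasWeakDeriv_realPart (α : Fin 3 → ℕ) {w w' : CL2}
    (h : w' =ᵐ[volume] fun ξ => monomial α ξ * w ξ) :
    HasWeakDeriv α (realPart (𝓕⁻ w)) (realPart (𝓕⁻ w')) := by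
  refine ⟨locallyIntegrable_Lp _, locallyIntegrable_Lp _, fun φ hφ => ?_⟩
  rw [(isSymbol_multiDeriv α).pair_realPart_fourierInv hφ w,
    IsSymbol.id.pair_realPart_fourierInv hφ w']
  have : ∫ ξ, (starRingEnd ℂ) (monomial α ξ * (𝓕 hφ.toSchwartz) ξ) * w ξ =
      (((-1 : ℝ) ^ (∑ i, α i) : ℝ) : ℂ) *
        ∫ ξ, (starRingEnd ℂ) (1 * (𝓕 hφ.toSchwartz) ξ) * w' ξ := by
    rw [← integral_const_mul]
    refine integral_congr_ae ?_
    filter_upwards [h] with ξ hξ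
    rw [hξ, map_mul, conj_monomial, one_mul]
    push_cast
    ring
  rw [this, Complex.re_ofReal_mul]

lemma eLpNorm_realPart_le (w : CL2) (p : ℝ≥0∞) :
    eLpNorm (realPart w) p volume ≤ eLpNorm w p volume := by
  refine eLpNorm_mono_ae ?_
  filter_upwards [coeFn_realPart w] with x hx
  rw [hx]
  exact Complex.abs_re_le_norm _

lemma eLpNorm_fourierInv (w : CL2) :
    eLpNorm (𝓕⁻ w : CL2) 2 volume = eLpNorm w 2 volume := by
  rw [← Lp.enorm_def, ← Lp.enorm_def, ← ofReal_norm, ← ofReal_norm,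
    ← Lp.norm_fourier_eq (𝓕⁻ w : CL2), fourier_fourierInv_eq]

lemma aestronglyMeasurable_monomial_mul (α : Fin 3 → ℕ) (w : CL2) :
    AEStronglyMeasurable (fun ξ => monomial α ξ * w ξ) volume :=
  (continuous_monomial α).aestronglyMeasurable.mul (Lp.aestronglyMeasurable w)

lemma derivNorm_two_realPart_le (α : Fin 3 → ℕ) (w : CL2) :
    derivNorm α 2 (realPart (𝓕⁻ w)) ≤ eLpNorm (fun ξ => monomial α ξ * w ξ) 2 volume := by
  by_cases h : eLpNorm (fun ξ => monomial α ξ * w ξ) 2 volume = (⊤ : ℝ≥0∞)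
  · simp [h]
  have hm : MemLp (fun ξ => monomial α ξ * w ξ) 2 volume :=
    ⟨aestronglyMeasurable_monomial_mul α w, lt_top_iff_ne_top.2 h⟩
  refine (iInf₂_le _ (hasWeakDeriv_realPart α hm.coeFn_toLp)).trans ?_
  refine (eLpNorm_realPart_le _ _).trans ?_
  rw [eLpNorm_fourierInv, eLpNorm_congr_ae hm.coeFn_toLp]

/-- Both sides have the same pairing with every test function: Plancherel treats the L² transform,
Fubini the integral. -/
lemma fourierInv_ae_eq (v : CL2) (hv : Integrable v volume) :
    (𝓕⁻ v : CL2) =ᵐ[volume] 𝓕⁻ (v : R3 → ℂ) := by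
  have hcont : Continuous (𝓕⁻ (v : R3 → ℂ)) := by
    rw [Real.fourierInv_eq_fourier_comp_neg]
    exact VectorFourier.fourierIntegral_continuous Real.continuous_fourierChar
      (by exact continuous_inner) hv.comp_neg
  refine ae_eq_of_integral_contDiff_smul_eq
    ((Lp.memLp _).locallyIntegrable one_le_two) hcont.locallyIntegrable fun g hg hgs => ?_
  have hgt : IsTest g := ⟨hg, hgs⟩
  have h1 := VectorFourier.integral_sesq_fourierIntegral_eq_neg_flip (innerSL ℂ)
    (L := innerₗ R3) (f := hgt.toSchwartz) (g := v) (μ := volume) (ν := volume)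
    Real.continuous_fourierChar (by exact continuous_inner) hgt.toSchwartz.integrable hv
  have h2 := inner_fourierInv hgt.toSchwartz v
  rw [inner_toLp, inner_toLp] at h2
  have h3 : ∫ ξ, (starRingEnd ℂ) ((𝓕 hgt.toSchwartz : 𝓢(R3, ℂ)) ξ) * v ξ =
      ∫ x, (starRingEnd ℂ) (hgt.toSchwartz x) * (𝓕⁻ (v : R3 → ℂ)) x := by
    simpa [mul_comm, SchwartzMap.fourier_coe, flip_innerₗ] using! h1
  rw [h3] at h2
  simpa using h2

lemma eLpNorm_top_fourierInv_le (v : CL2) :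
    eLpNorm (𝓕⁻ v : CL2) ∞ volume ≤ eLpNorm v 1 volume := by
  by_cases h : eLpNorm v 1 volume = (⊤ : ℝ≥0∞)
  · simp [h]
  have hv : Integrable v volume :=
    memLp_one_iff_integrable.1 ⟨Lp.aestronglyMeasurable v, lt_top_iff_ne_top.2 h⟩
  rw [eLpNorm_congr_ae (fourierInv_ae_eq v hv), eLpNorm_exponent_top]
  refine eLpNormEssSup_le_of_ae_enorm_bound (Eventually.of_forall fun x => ?_)
  rw [eLpNorm_one_eq_lintegral_enorm, Real.fourierInv_eq]
  refine (enorm_integral_le_lintegral_enorm _).trans (lintegral_mono fun ξ => ?_)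
  rw [Circle.smul_def, enorm_smul]
  have : ‖((Real.fourierChar (inner ℝ ξ x) : Circle) : ℂ)‖ₑ = 1 := by
    rw [← ofReal_norm, Circle.norm_coe, ENNReal.ofReal_one]
  rw [this, one_mul]

lemma derivNorm_top_realPart_le (α : Fin 3 → ℕ) (w : CL2)
    (h : MemLp (fun ξ => monomial α ξ * w ξ) 2 volume) :
    derivNorm α ∞ (realPart (𝓕⁻ w)) ≤ eLpNorm (fun ξ => monomial α ξ * w ξ) 1 volume := by
  refine (iInf₂_le _ (hasWeakDeriv_realPart α h.coeFn_toLp)).trans ?_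
  refine (eLpNorm_realPart_le _ _).trans ((eLpNorm_top_fourierInv_le _).trans ?_)
  rw [eLpNorm_congr_ae h.coeFn_toLp]

lemma pair_congr {f g : R3 → ℝ} (h : f =ᵐ[volume] g) (φ : R3 → ℝ) : pair f φ = pair g φ :=
  integral_congr_ae (h.mono fun x hx => by simp [hx])

/-- The definition of a weak derivative `g` is a linear differential relation between `f` and `g`.
On the frequency side it reads |monomial · f̂| = |ĝ| almost everywhere, and Plancherel finishes. -/
lemma eLpNorm_monomial_fourier_le (α : Fin 3 → ℕ) (f : ScalarLp 2) :
    eLpNorm (fun ξ => monomial α ξ * (𝓕 (cplx 2 f) : CL2) ξ) 2 volume ≤ derivNorm α 2 f := by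
  refine le_iInf₂ fun g hg => ?_
  by_cases h : eLpNorm g 2 volume = (⊤ : ℝ≥0∞)
  · simp [h]
  have hm : MemLp g 2 volume := ⟨hg.2.1.aestronglyMeasurable, lt_top_iff_ne_top.2 h⟩
  have key := Represents.sum_symbol_eq_zero (ι := Fin 2) isOpen_univ
    (f := ![f, hm.toLp g]) (a := ![𝓕 (cplx 2 f), 𝓕 (cplx 2 (hm.toLp g))])
    (fun c => by fin_cases c <;> exact represents_fourier _)
    (D := ![multiDeriv α, fun φ => φ]) (p := ![monomial α, fun _ => 1])
    (fun c => by fin_cases c; exacts [isSymbol_multiDeriv α, IsSymbol.id])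
    ![1, -(-1) ^ (∑ i, α i)] (fun φ hφ => by
      simp [hg.2.2 φ hφ, pair_congr hm.coeFn_toLp])
  have hae : ∀ᵐ ξ, ‖monomial α ξ * (𝓕 (cplx 2 f) : CL2) ξ‖ =
      ‖(𝓕 (cplx 2 (hm.toLp g)) : CL2) ξ‖ := by
    filter_upwards [key] with ξ hξ
    have := hξ (mem_univ _)
    simp only [Fin.sum_univ_two, Matrix.cons_val_zero, Matrix.cons_val_one,
      Complex.ofReal_one, one_mul, mul_one] at this
    have h2 := congrArg norm (eq_neg_of_add_eq_zero_left this)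
    simpa using h2
  rw [eLpNorm_congr_norm_ae hae]
  have : ∀ u : CL2, eLpNorm (𝓕 u : CL2) 2 volume = eLpNorm u 2 volume := fun u => by
    rw [← eLpNorm_fourierInv, fourierInv_fourier_eq]
  rw [this, eLpNorm_congr_norm_ae (g := g)]
  filter_upwards [coeFn_cplx (hm.toLp g), hm.coeFn_toLp] with x h1 h2
  rw [h1, h2]
  simp

lemma monomial_single (k : ℕ) (i : Fin 3) (ξ : R3) :
    monomial (Pi.single i k) ξ = (Complex.I * freq i ξ) ^ k := by
  rw [monomial, Finset.prod_eq_single i]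
  · simp
  · intro j _ hj
    simp [hj]
  · simp

/-- Some coordinate carries a fixed fraction of the length, so pure derivatives suffice and no mixed
monomials need be expanded. The constant 3 is a rough substitute for √3. -/
lemma rad_pow_le (k : ℕ) (ξ : R3) :
    rad ξ ^ k ≤ 3 ^ k * ∑ i, ‖monomial (Pi.single i k) ξ‖ := by
  have : ∃ i, rad ξ ≤ 3 * |freq i ξ| := by
    by_contra! h
    have h2 := sum_freq_sq ξ
    have h3 : ∀ i, (3 * |freq i ξ|) ^ 2 < rad ξ ^ 2 := fun i =>
      pow_lt_pow_left₀ (h i) (by positivity) two_ne_zero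
    simp only [mul_pow, sq_abs] at h3
    rw [Fin.sum_univ_three] at h2
    nlinarith [h3 0, h3 1, h3 2, sq_nonneg (rad ξ)]
  obtain ⟨i, hi⟩ := this
  calc rad ξ ^ k ≤ (3 * |freq i ξ|) ^ k := pow_le_pow_left₀ (rad_nonneg ξ) hi k
    _ = 3 ^ k * ‖monomial (Pi.single i k) ξ‖ := by
      rw [monomial_single, mul_pow, norm_pow, norm_mul, Complex.norm_I, one_mul,
        Complex.norm_real, Real.norm_eq_abs]
    _ ≤ _ := by
      gcongr
      exact Finset.single_le_sum (f := fun i => ‖monomial (Pi.single i k) ξ‖)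
        (fun _ _ => norm_nonneg _) (Finset.mem_univ i)

/-- The Sobolev norm controls weighted norms of the Fourier transform. -/
lemma eLpNorm_rad_pow_fourier_le (k : ℕ) (f : ScalarLp 2) :
    eLpNorm (fun ξ => rad ξ ^ k * ‖(𝓕 (cplx 2 f) : CL2) ξ‖) 2 volume ≤
      ENNReal.ofReal (3 ^ (k + 1)) * sobolevNorm k 2 f := by
  have h1 : ∀ i : Fin 3, eLpNorm (fun ξ => monomial (Pi.single i k) ξ *
      (𝓕 (cplx 2 f) : CL2) ξ) 2 volume ≤ sobolevNorm k 2 f := by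
    intro i
    refine (eLpNorm_monomial_fourier_le _ f).trans ?_
    have h2 : derivNorm (Pi.single i k) 2 f ≤ orderNorm k 2 f :=
      Finset.single_le_sum (f := fun α => derivNorm α 2 (f : R3 → ℝ)) (fun _ _ => zero_le)
        (by simp [Finset.mem_piAntidiag])
    exact h2.trans (Finset.single_le_sum (f := fun l => orderNorm l 2 (f : R3 → ℝ))
      (fun _ _ => zero_le) (by simp))
  let G : Fin 3 → R3 → ℝ := fun i ξ =>
    ‖monomial (Pi.single i k) ξ * (𝓕 (cplx 2 f) : CL2) ξ‖
  have hG : ∀ i, AEStronglyMeasurable (G i) volume := fun i =>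
    (aestronglyMeasurable_monomial_mul _ _).norm
  calc eLpNorm (fun ξ => rad ξ ^ k * ‖(𝓕 (cplx 2 f) : CL2) ξ‖) 2 volume
      ≤ eLpNorm ((3 : ℝ) ^ k • ∑ i, G i) 2 volume := by
        refine eLpNorm_mono_real fun ξ => ?_
        rw [Real.norm_of_nonneg (mul_nonneg (pow_nonneg (rad_nonneg _) _) (norm_nonneg _))]
        refine (mul_le_mul_of_nonneg_right (rad_pow_le k ξ) (norm_nonneg _)).trans_eq ?_
        simp [G, mul_assoc, Finset.sum_mul]
    _ = ENNReal.ofReal (3 ^ k) * eLpNorm (∑ i, G i) 2 volume := by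
        rw [eLpNorm_const_smul, ← ofReal_norm, Real.norm_of_nonneg (by positivity)]
    _ ≤ ENNReal.ofReal (3 ^ k) * ∑ i, eLpNorm (G i) 2 volume := by
        gcongr
        exact eLpNorm_sum_le (fun i _ => hG i) one_le_two
    _ ≤ ENNReal.ofReal (3 ^ k) * ∑ _i : Fin 3, sobolevNorm k 2 f := by
        gcongr with i
        rw [eLpNorm_norm]
        exact h1 i
    _ = _ := by
        rw [Finset.sum_const, Finset.card_univ, Fintype.card_fin, nsmul_eq_mul, ← mul_assoc,
          pow_succ, ENNReal.ofReal_mul (by positivity)]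
        norm_num

/-! ### The damped oscillator `y'' + ν r² y' + κ r² y = 0` -/

/-- The solution of `y'' = d y`, `y(0) = 0`, `y'(0) = 1`. -/
def oscSin (d t : ℝ) : ℝ :=
  if 0 < d then Real.sinh (√d * t) / √d else if d < 0 then Real.sin (√(-d) * t) / √(-d) else t

/-- The solution of `y'' = d y`, `y(0) = 1`, `y'(0) = 0`. -/
def oscCos (d t : ℝ) : ℝ :=
  if 0 < d then Real.cosh (√d * t) else if d < 0 then Real.cos (√(-d) * t) else 1

@[simp] lemma oscSin_zero (d : ℝ) : oscSin d 0 = 0 := by simp [oscSin]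

@[simp] lemma oscCos_zero (d : ℝ) : oscCos d 0 = 1 := by simp [oscCos]

lemma hasDerivAt_oscSin (d t : ℝ) : HasDerivAt (oscSin d) (oscCos d t) t := by
  unfold oscSin oscCos
  split_ifs with h1 h2
  · have hs : √d ≠ 0 := (Real.sqrt_pos.2 h1).ne'
    have := ((Real.hasDerivAt_sinh (√d * t)).comp t ((hasDerivAt_id t).const_mul √d)).div_const √d
    refine this.congr_deriv ?_
    field_simp
  · have hs : √(-d) ≠ 0 := (Real.sqrt_pos.2 (neg_pos.2 h2)).ne'
    have := ((Real.hasDerivAt_sin (√(-d) * t)).comp t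
      ((hasDerivAt_id t).const_mul √(-d))).div_const √(-d)
    refine this.congr_deriv ?_
    field_simp
  · exact hasDerivAt_id t

lemma hasDerivAt_oscCos (d t : ℝ) : HasDerivAt (oscCos d) (d * oscSin d t) t := by
  unfold oscSin oscCos
  split_ifs with h1 h2
  · have hs : √d ≠ 0 := (Real.sqrt_pos.2 h1).ne'
    have := ((Real.hasDerivAt_cosh (√d * t)).comp t ((hasDerivAt_id t).const_mul √d))
    refine this.congr_deriv ?_
    have h := Real.sq_sqrt h1.le
    field_simp
    rw [h]; ring
  · have hs : √(-d) ≠ 0 := (Real.sqrt_pos.2 (neg_pos.2 h2)).ne'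
    have := ((Real.hasDerivAt_cos (√(-d) * t)).comp t ((hasDerivAt_id t).const_mul √(-d)))
    refine this.congr_deriv ?_
    have h := Real.sq_sqrt (neg_pos.2 h2).le
    field_simp
    rw [h]; ring
  · have : d = 0 := le_antisymm (not_lt.1 h1) (not_lt.1 h2)
    simpa [this] using hasDerivAt_const t (1 : ℝ)

lemma measurable_oscSin (t : ℝ) : Measurable (fun d => oscSin d t) := by
  unfold oscSin
  refine Measurable.ite (measurableSet_lt measurable_const measurable_id) (by fun_prop) ?_
  exact Measurable.ite (measurableSet_lt measurable_id measurable_const) (by fun_prop) (by fun_prop)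

lemma measurable_oscCos (t : ℝ) : Measurable (fun d => oscCos d t) := by
  unfold oscCos
  refine Measurable.ite (measurableSet_lt measurable_const measurable_id) (by fun_prop) ?_
  exact Measurable.ite (measurableSet_lt measurable_id measurable_const) (by fun_prop) (by fun_prop)

/-- The `k`-th time derivative of the solution `S` of `S'' + ν r² S' + κ r² S = 0`, `S(0) = 0`,
`S'(0) = 1`. -/
def osc (ν κ r t : ℝ) : ℕ → ℝ
  | 0 => Real.exp (-(ν * r ^ 2 / 2 * t)) * oscSin ((ν * r ^ 2 / 2) ^ 2 - κ * r ^ 2) t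
  | 1 => Real.exp (-(ν * r ^ 2 / 2 * t)) * (oscCos ((ν * r ^ 2 / 2) ^ 2 - κ * r ^ 2) t -
      ν * r ^ 2 / 2 * oscSin ((ν * r ^ 2 / 2) ^ 2 - κ * r ^ 2) t)
  | k + 2 => -(ν * r ^ 2) * osc ν κ r t (k + 1) - κ * r ^ 2 * osc ν κ r t k

lemma osc_add_two (ν κ r t : ℝ) (k : ℕ) : osc ν κ r t (k + 2) =
    -(ν * r ^ 2) * osc ν κ r t (k + 1) - κ * r ^ 2 * osc ν κ r t k := by rw [osc]

lemma hasDerivAt_osc (ν κ r t : ℝ) (k : ℕ) :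
    HasDerivAt (fun t => osc ν κ r t k) (osc ν κ r t (k + 1)) t := by
  induction k using Nat.twoStepInduction with
  | zero =>
    simp only [osc]
    have he : HasDerivAt (fun t : ℝ => Real.exp (-(ν * r ^ 2 / 2 * t)))
        (Real.exp (-(ν * r ^ 2 / 2 * t)) * (-(ν * r ^ 2 / 2 * 1))) t :=
      (((hasDerivAt_id t).const_mul (ν * r ^ 2 / 2)).neg).exp
    refine (he.mul (hasDerivAt_oscSin _ t)).congr_deriv ?_
    ring
  | one =>
    simp only [osc]
    have he : HasDerivAt (fun t : ℝ => Real.exp (-(ν * r ^ 2 / 2 * t)))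
        (Real.exp (-(ν * r ^ 2 / 2 * t)) * (-(ν * r ^ 2 / 2 * 1))) t :=
      (((hasDerivAt_id t).const_mul (ν * r ^ 2 / 2)).neg).exp
    refine (he.mul ((hasDerivAt_oscCos _ t).sub
      ((hasDerivAt_oscSin _ t).const_mul (ν * r ^ 2 / 2)))).congr_deriv ?_
    simp only [Pi.sub_apply]
    ring
  | more k ih1 ih2 =>
    simp only [osc_add_two]
    exact (ih2.const_mul _).sub (ih1.const_mul _)

lemma osc_zero_zero (ν κ r : ℝ) : osc ν κ r 0 0 = 0 := by simp [osc]

lemma osc_zero_one (ν κ r : ℝ) : osc ν κ r 0 1 = 1 := by simp [osc]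

lemma measurable_osc (ν κ t : ℝ) (k : ℕ) : Measurable (fun r => osc ν κ r t k) := by
  have hs := measurable_oscSin t
  have hc := measurable_oscCos t
  induction k using Nat.twoStepInduction with
  | zero =>
    simp only [osc]
    exact (by fun_prop : Measurable _).mul (hs.comp (by fun_prop))
  | one =>
    simp only [osc]
    exact (by fun_prop : Measurable _).mul ((hc.comp (by fun_prop)).sub
      ((by fun_prop : Measurable _).mul (hs.comp (by fun_prop))))
  | more k ih1 ih2 =>
    simp only [osc_add_two]
    fun_prop

/-- The building blocks of the symbol of the solution operator: with `S` as in `osc`, the `m`-th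
time derivative of `S' + ν r² S` for `g = 0`, of `r S` for `g = 1` and of `S'` for `g = 2`. -/
def block (ν κ : ℝ) (g m : ℕ) (t r : ℝ) : ℝ :=
  match g, m with
  | 0, 0 => osc ν κ r t 1 + ν * r ^ 2 * osc ν κ r t 0
  | 0, m + 1 => -(κ * r ^ 2) * osc ν κ r t m
  | 1, m => r * osc ν κ r t m
  | _ + 2, m => osc ν κ r t (m + 1)

/-- For g = 0 the oscillator equation gives (S' + ν r² S)' = -κ r² S. -/
lemma hasDerivAt_block (ν κ : ℝ) (g m : ℕ) (t r : ℝ) :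
    HasDerivAt (fun t => block ν κ g m t r) (block ν κ g (m + 1) t r) t := by
  match g, m with
  | 0, 0 =>
    simp only [block]
    refine ((hasDerivAt_osc ν κ r t 1).add
      ((hasDerivAt_osc ν κ r t 0).const_mul (ν * r ^ 2))).congr_deriv ?_
    rw [osc_add_two]; ring
  | 0, m + 1 => exact (hasDerivAt_osc ν κ r t m).const_mul _
  | 1, m => exact (hasDerivAt_osc ν κ r t m).const_mul _
  | _ + 2, m => exact hasDerivAt_osc ν κ r t (m + 1)

lemma measurable_block (ν κ : ℝ) (g m : ℕ) (t : ℝ) : Measurable (block ν κ g m t) := by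
  have h := measurable_osc ν κ t
  unfold block
  match g, m with
  | 0, 0 => simp only; fun_prop
  | 0, m + 1 => simp only; fun_prop
  | 1, m => simp only; fun_prop
  | _ + 2, m => simp only; fun_prop

/-- Multiplied by exp(c s), the function is nonincreasing. -/
lemma le_of_deriv_le_neg_mul {f f' : ℝ → ℝ} {c t : ℝ} (hf : ∀ s, HasDerivAt f (f' s) s)
    (h : ∀ s, f' s ≤ -c * f s) (ht : 0 ≤ t) : f t ≤ f 0 * Real.exp (-c * t) := by
  have hg : ∀ s, HasDerivAt (fun s => f s * Real.exp (c * s))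
      (f' s * Real.exp (c * s) + f s * (Real.exp (c * s) * (c * 1))) s := fun s =>
    (hf s).mul (((hasDerivAt_id s).const_mul c).exp)
  have hanti : Antitone (fun s => f s * Real.exp (c * s)) := by
    refine antitone_of_deriv_nonpos (fun s => (hg s).differentiableAt) fun s => ?_
    rw [(hg s).deriv]
    nlinarith [h s, Real.exp_pos (c * s)]
  have := hanti ht
  simp only [mul_zero, Real.exp_zero, mul_one] at this
  rwa [neg_mul, Real.exp_neg, ← div_eq_mul_inv, le_div_iff₀ (Real.exp_pos _)]

/-- The derivative of the energy is -2ν r² S'². -/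
lemma osc_energy_le {ν κ r t : ℝ} (hν : 0 < ν) (ht : 0 ≤ t) :
    osc ν κ r t 1 ^ 2 + κ * r ^ 2 * osc ν κ r t 0 ^ 2 ≤ 1 := by
  have := le_of_deriv_le_neg_mul (c := 0)
    (f := fun t => osc ν κ r t 1 ^ 2 + κ * r ^ 2 * osc ν κ r t 0 ^ 2)
    (fun s => ((hasDerivAt_osc ν κ r s 1).pow 2).add
      (((hasDerivAt_osc ν κ r s 0).pow 2).const_mul _)) (fun s => ?_) ht
  · simpa [osc_zero_zero, osc_zero_one] using this
  · rw [osc_add_two]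
    have : 0 ≤ ν * r ^ 2 * osc ν κ r s 1 ^ 2 := by positivity
    simp only [Nat.cast_ofNat, Nat.reduceSub, pow_one]
    linarith

/-- A second energy, with S' replaced by S' + ν r² S. Its derivative is -2κν r⁴ S²; it bounds the
block g = 0 uniformly in r, which the first energy does not. -/
lemma block_zero_energy_le {ν κ r t : ℝ} (hν : 0 < ν) (hκ : 0 < κ) (ht : 0 ≤ t) :
    block ν κ 0 0 t r ^ 2 + κ * r ^ 2 * osc ν κ r t 0 ^ 2 ≤ 1 := by
  have := le_of_deriv_le_neg_mul (c := 0)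
    (f := fun t => block ν κ 0 0 t r ^ 2 + κ * r ^ 2 * osc ν κ r t 0 ^ 2)
    (fun s => ((hasDerivAt_block ν κ 0 0 s r).pow 2).add
      (((hasDerivAt_osc ν κ r s 0).pow 2).const_mul _)) (fun s => ?_) ht
  · simpa [block, osc_zero_zero, osc_zero_one] using this
  · simp only [block, Nat.cast_ofNat, Nat.reduceSub, pow_one]
    have : 0 ≤ κ * r ^ 2 * ν * r ^ 2 * osc ν κ r s 0 ^ 2 := by positivity
    linarith

/-- Uniform bound of the blocks without time derivatives. -/
lemma abs_block_zero_le {ν κ r t : ℝ} (hν : 0 < ν) (hκ : 1 ≤ κ) (ht : 0 ≤ t) (g : ℕ) :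
    |block ν κ g 0 t r| ≤ 1 := by
  have h1 := osc_energy_le (κ := κ) (r := r) hν ht
  have hκ0 : 0 < κ := by linarith
  have h2 := block_zero_energy_le (r := r) hν hκ0 ht
  rw [← sq_le_one_iff_abs_le_one]
  match g with
  | 0 =>
    have : 0 ≤ κ * r ^ 2 * osc ν κ r t 0 ^ 2 := by positivity
    linarith
  | 1 =>
    simp only [block, mul_pow]
    have : 0 ≤ (κ - 1) * (r ^ 2 * osc ν κ r t 0 ^ 2) :=
      mul_nonneg (by linarith) (by positivity)
    nlinarith [sq_nonneg (osc ν κ r t 1)]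
  | _ + 2 =>
    simp only [block]
    have : 0 ≤ κ * r ^ 2 * osc ν κ r t 0 ^ 2 := by positivity
    linarith

/-! #### Low frequencies -/

/-- The plain energy dissipates only S'. Adding the cross term δ r² S S' makes S dissipate as well,
at the rate r², while the energy changes only by a factor. -/
lemma exists_osc_low {ν κ R : ℝ} (hν : 0 < ν) (hκ : 1 ≤ κ) (hR : 1 ≤ R) :
    ∃ c : ℝ, 0 < c ∧ ∀ r t, 0 ≤ r → r ≤ R → 0 ≤ t →
      osc ν κ r t 1 ^ 2 + κ * (r * osc ν κ r t 0) ^ 2 ≤ 2 * Real.exp (-(c * r ^ 2) * t) := by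
  have hR0 : 0 < R := by linarith
  have hκ0 : 0 < κ := by linarith
  -- The three bounds serve, in order, to keep the dissipation of S' despite the term δ r² S'² from
  -- the cross term, to keep the modified energy comparable with the plain one for r ≤ R, and to
  -- absorb the mixed product δ ν r⁴ S S'.
  set δ : ℝ := min (ν / 2) (min (1 / R) (1 / (ν * R ^ 2))) with hδ
  have hδ0 : 0 < δ := by positivity
  have hδ1 : δ ≤ ν / 2 := min_le_left _ _
  have hδ2 : δ * R ≤ 1 := by
    have : δ ≤ 1 / R := (min_le_right _ _).trans (min_le_left _ _)
    rwa [le_div_iff₀ hR0] at this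
  have hδ3 : δ * (ν * R ^ 2) ≤ 1 := by
    have : δ ≤ 1 / (ν * R ^ 2) := (min_le_right _ _).trans (min_le_right _ _)
    rwa [le_div_iff₀ (by positivity)] at this
  -- The modified energy is at most 3/2 of the plain one, whence the 2/3 in the rate. It is at least
  -- 1/2 of it and equals 1 at time 0, whence the factor 2 in the bound.
  refine ⟨2 / 3 * min ν (δ / 2), by positivity, fun r t hr hrR ht => ?_⟩
  have hcross : ∀ X Y : ℝ, |δ * r * X * Y| ≤ 1 / 2 * (X ^ 2 + κ * Y ^ 2) := by
    intro X Y
    have h1 : δ * r ≤ 1 := (mul_le_mul_of_nonneg_left hrR hδ0.le).trans hδ2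
    have h0 : 0 ≤ δ * r := by positivity
    rw [mul_assoc, abs_mul, abs_of_nonneg h0, abs_mul]
    nlinarith [sq_nonneg (|X| - |Y|), sq_abs X, sq_abs Y, mul_nonneg (abs_nonneg X) (abs_nonneg Y),
      sq_nonneg Y]
  have hcross2 : ∀ X Y : ℝ, -(δ * ν * r * X * Y) ≤ δ * κ / 2 * Y ^ 2 + ν / 2 * X ^ 2 := by
    intro X Y
    have h1 : δ * (ν * r ^ 2) ≤ 1 := by
      refine le_trans ?_ hδ3
      gcongr
    have h2 : 0 ≤ δ * (κ - 1) * Y ^ 2 := mul_nonneg (mul_nonneg hδ0.le (by linarith)) (sq_nonneg _)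
    have h3 : 0 ≤ δ * (Y + ν * r * X) ^ 2 := by positivity
    have h4 : 0 ≤ ν * X ^ 2 * (1 - δ * (ν * r ^ 2)) :=
      mul_nonneg (by positivity) (by linarith)
    nlinarith
  have key := le_of_deriv_le_neg_mul (c := 2 / 3 * min ν (δ / 2) * r ^ 2)
    (f := fun t => osc ν κ r t 1 ^ 2 + κ * r ^ 2 * osc ν κ r t 0 ^ 2 +
      δ * r ^ 2 * (osc ν κ r t 0 * osc ν κ r t 1))
    (fun s => (((hasDerivAt_osc ν κ r s 1).pow 2).add
      (((hasDerivAt_osc ν κ r s 0).pow 2).const_mul _)).add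
      (((hasDerivAt_osc ν κ r s 0).mul (hasDerivAt_osc ν κ r s 1)).const_mul _)) (fun s => ?_) ht
  · have h2 := hcross (osc ν κ r t 1) (r * osc ν κ r t 0)
    have h3 := (abs_le.1 h2).1
    simp only [osc_zero_zero, osc_zero_one] at key
    rw [neg_mul] at key ⊢
    nlinarith
  · rw [osc_add_two]
    simp only [Nat.cast_ofNat, Nat.reduceSub, pow_one, zero_add]
    set X := osc ν κ r s 1
    set Y := osc ν κ r s 0
    have h1 := (abs_le.1 (hcross X (r * Y))).2
    have h2 := hcross2 X (r * Y)
    set c' := min ν (δ / 2) with hc'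
    have h0 : 0 < c' := by positivity
    have ha : c' ≤ ν := min_le_left _ _
    have hb : c' ≤ δ / 2 := min_le_right _ _
    have hG : X ^ 2 + κ * r ^ 2 * Y ^ 2 + δ * r ^ 2 * (Y * X) ≤
        3 / 2 * (X ^ 2 + κ * (r * Y) ^ 2) := by nlinarith
    have hm : -(2 * ν - δ) * X ^ 2 - δ * κ * (r * Y) ^ 2 - δ * ν * r * X * (r * Y) ≤
        -c' * (X ^ 2 + κ * (r * Y) ^ 2) := by
      have e1 : 0 ≤ (ν / 2 - δ) * X ^ 2 := mul_nonneg (by linarith) (sq_nonneg _)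
      have e2 : 0 ≤ (ν - c') * X ^ 2 := mul_nonneg (by linarith) (sq_nonneg _)
      have e3 : 0 ≤ (δ / 2 - c') * (κ * (r * Y) ^ 2) := mul_nonneg (by linarith) (by positivity)
      nlinarith
    have hm2 := mul_le_mul_of_nonneg_left hm (sq_nonneg r)
    have hG2 := mul_le_mul_of_nonneg_left hG (by positivity : 0 ≤ 2 / 3 * c' * r ^ 2)
    nlinarith

/-- The quadratic energy bound is for squares, so the rate is halved. Each time derivative gains a
factor r because the recursion for S^(k+2) has coefficients ν r² and κ r², one r of the latter being
used up by r S^(k). -/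
lemma exists_block_low {ν κ R : ℝ} (hν : 0 < ν) (hκ : 1 ≤ κ) (hR : 1 ≤ R) :
    ∃ c : ℝ, 0 < c ∧ ∀ m : ℕ, ∃ C : ℝ, 0 < C ∧ ∀ g r t, 0 ≤ r → r ≤ R → 0 ≤ t →
      |block ν κ g m t r| ≤ C * r ^ m * Real.exp (-(c * r ^ 2 * t)) := by
  obtain ⟨c, hc, h⟩ := exists_osc_low hν hκ hR
  have hR0 : 0 < R := by linarith
  have hκ0 : 0 < κ := by linarith
  have hsq : ∀ r t, Real.exp (-(c * r ^ 2) * t) = Real.exp (-(c / 2 * r ^ 2 * t)) ^ 2 := by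
    intro r t
    rw [← Real.exp_nat_mul]
    congr 1
    push_cast
    ring
  -- S itself need not be small at small r; only r S^(k) and S^(k+1) have bounds of the same size,
  -- and they are propagated together.
  have hk : ∀ k : ℕ, ∃ C : ℝ, 0 < C ∧ ∀ r t, 0 ≤ r → r ≤ R → 0 ≤ t →
      |r * osc ν κ r t k| ≤ C * r ^ k * Real.exp (-(c / 2 * r ^ 2 * t)) ∧
      |osc ν κ r t (k + 1)| ≤ C * r ^ k * Real.exp (-(c / 2 * r ^ 2 * t)) := by
    intro k
    induction k with
    | zero =>
      refine ⟨2, two_pos, fun r t hr hrR ht => ?_⟩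
      have h1 := h r t hr hrR ht
      rw [hsq] at h1
      have hE := Real.exp_pos (-(c / 2 * r ^ 2 * t))
      rw [pow_zero, mul_one]
      constructor
      · refine abs_le_of_sq_le_sq ?_ (by positivity)
        nlinarith [sq_nonneg (osc ν κ r t 1), sq_nonneg (r * osc ν κ r t 0)]
      · refine abs_le_of_sq_le_sq ?_ (by positivity)
        nlinarith [sq_nonneg (osc ν κ r t 1), sq_nonneg (r * osc ν κ r t 0)]
    | succ k ih =>
      obtain ⟨C, hC, ih⟩ := ih
      refine ⟨C * (1 + ν * R + κ), by positivity, fun r t hr hrR ht => ?_⟩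
      obtain ⟨h1, h2⟩ := ih r t hr hrR ht
      set E := Real.exp (-(c / 2 * r ^ 2 * t)) with hE'
      have hE : 0 < E := Real.exp_pos _
      have hA : 0 ≤ C * r ^ k * E := by positivity
      constructor
      · rw [abs_mul, abs_of_nonneg hr]
        calc r * |osc ν κ r t (k + 1)| ≤ r * (C * r ^ k * E) := by gcongr
          _ = (C * r ^ k * E) * r * 1 := by ring
          _ ≤ (C * r ^ k * E) * r * (1 + ν * R + κ) := by
            gcongr
            nlinarith [mul_pos hν hR0]
          _ = _ := by ring
      · rw [osc_add_two]
        calc |-(ν * r ^ 2) * osc ν κ r t (k + 1) - κ * r ^ 2 * osc ν κ r t k|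
            ≤ |-(ν * r ^ 2) * osc ν κ r t (k + 1)| + |κ * r ^ 2 * osc ν κ r t k| := abs_sub _ _
          _ = ν * r ^ 2 * |osc ν κ r t (k + 1)| + κ * r * |r * osc ν κ r t k| := by
            rw [abs_mul, abs_neg, abs_of_nonneg (by positivity : 0 ≤ ν * r ^ 2),
              show κ * r ^ 2 * osc ν κ r t k = κ * r * (r * osc ν κ r t k) by ring, abs_mul,
              abs_of_nonneg (by positivity : 0 ≤ κ * r)]
          _ ≤ ν * r ^ 2 * (C * r ^ k * E) + κ * r * (C * r ^ k * E) := by gcongr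
          _ = (C * r ^ k * E) * r * (ν * r + κ) := by ring
          _ ≤ (C * r ^ k * E) * r * (1 + ν * R + κ) := by
            gcongr
            nlinarith
          _ = _ := by ring
  refine ⟨c / 2, by positivity, fun m => ?_⟩
  obtain ⟨C, hC, hCm⟩ := hk m
  obtain ⟨C', hC', hCm'⟩ := hk (m - 1)
  refine ⟨C + ν * R * C + κ * R * C' + κ * C', by positivity, fun g r t hr hrR ht => ?_⟩
  obtain ⟨h1, h2⟩ := hCm r t hr hrR ht
  obtain ⟨h3, h4⟩ := hCm' r t hr hrR ht
  set E := Real.exp (-(c / 2 * r ^ 2 * t)) with hE'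
  have hE : 0 < E := Real.exp_pos _
  have hle : C * r ^ m * E ≤ (C + ν * R * C + κ * R * C' + κ * C') * r ^ m * E := by
    gcongr
    have : 0 < ν * R * C + κ * R * C' + κ * C' := by positivity
    linarith
  match g, m with
  | 0, 0 =>
    simp only [block, pow_zero, mul_one, zero_add] at *
    calc |osc ν κ r t 1 + ν * r ^ 2 * osc ν κ r t 0|
        ≤ |osc ν κ r t 1| + |ν * r ^ 2 * osc ν κ r t 0| := abs_add_le _ _
      _ = |osc ν κ r t 1| + ν * r * |r * osc ν κ r t 0| := by
          rw [show ν * r ^ 2 * osc ν κ r t 0 = ν * r * (r * osc ν κ r t 0) by ring, abs_mul,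
            abs_of_nonneg (by positivity : 0 ≤ ν * r)]
      _ ≤ C * E + ν * R * (C * E) := by gcongr
      _ = (C + ν * R * C) * E := by ring
      _ ≤ _ := by
          have : 0 < κ * R * C' + κ * C' := by positivity
          exact mul_le_mul_of_nonneg_right (by linarith) hE.le
  | 0, m + 1 =>
    simp only [block, Nat.add_sub_cancel] at *
    calc |-(κ * r ^ 2) * osc ν κ r t m| = κ * r * |r * osc ν κ r t m| := by
          rw [show -(κ * r ^ 2) * osc ν κ r t m = -(κ * r * (r * osc ν κ r t m)) by ring, abs_neg,
            abs_mul, abs_of_nonneg (by positivity : 0 ≤ κ * r)]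
      _ ≤ κ * r * (C' * r ^ m * E) := by gcongr
      _ = κ * C' * r ^ (m + 1) * E := by ring
      _ ≤ _ := by
          gcongr
          have : 0 < C + ν * R * C + κ * R * C' := by positivity
          linarith
  | 1, m => exact h1.trans hle
  | _ + 2, m => exact h2.trans hle

/-! #### High frequencies -/

/-- In the overdamped regime S = (exp(z₁ t) - exp(z₂ t)) / (z₁ - z₂) with the real roots z₁, z₂ of
the characteristic equation. The induction uses that both roots satisfy the recursion. -/
lemma osc_eq_exp {ν κ r : ℝ} (hd : 0 < (ν * r ^ 2 / 2) ^ 2 - κ * r ^ 2) (t : ℝ) (k : ℕ) :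
    osc ν κ r t k =
      ((-(ν * r ^ 2 / 2) + √((ν * r ^ 2 / 2) ^ 2 - κ * r ^ 2)) ^ k *
        Real.exp ((-(ν * r ^ 2 / 2) + √((ν * r ^ 2 / 2) ^ 2 - κ * r ^ 2)) * t) -
      (-(ν * r ^ 2 / 2) - √((ν * r ^ 2 / 2) ^ 2 - κ * r ^ 2)) ^ k *
        Real.exp ((-(ν * r ^ 2 / 2) - √((ν * r ^ 2 / 2) ^ 2 - κ * r ^ 2)) * t)) /
      (2 * √((ν * r ^ 2 / 2) ^ 2 - κ * r ^ 2)) := by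
  set s := √((ν * r ^ 2 / 2) ^ 2 - κ * r ^ 2) with hs
  have hs0 : 0 < s := Real.sqrt_pos.2 hd
  have hsq : s ^ 2 = (ν * r ^ 2 / 2) ^ 2 - κ * r ^ 2 := Real.sq_sqrt hd.le
  have e1 : Real.exp ((-(ν * r ^ 2 / 2) + s) * t) =
      Real.exp (-(ν * r ^ 2 / 2 * t)) * Real.exp (s * t) := by
    rw [← Real.exp_add]; congr 1; ring
  have e2 : Real.exp ((-(ν * r ^ 2 / 2) - s) * t) =
      Real.exp (-(ν * r ^ 2 / 2 * t)) * Real.exp (-(s * t)) := by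
    rw [← Real.exp_add]; congr 1; ring
  induction k using Nat.twoStepInduction with
  | zero =>
    rw [osc, oscSin, if_pos hd, ← hs, e1, e2, Real.sinh_eq]
    field_simp
  | one =>
    rw [osc, oscSin, oscCos, if_pos hd, if_pos hd, ← hs, e1, e2, Real.sinh_eq, Real.cosh_eq]
    field_simp
    ring
  | more k ih1 ih2 =>
    rw [osc_add_two, ih1, ih2]
    have p1 : (-(ν * r ^ 2 / 2) + s) ^ (k + 2) = -(ν * r ^ 2) * (-(ν * r ^ 2 / 2) + s) ^ (k + 1) -
        κ * r ^ 2 * (-(ν * r ^ 2 / 2) + s) ^ k := by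
      have : (-(ν * r ^ 2 / 2) + s) ^ 2 = -(ν * r ^ 2) * (-(ν * r ^ 2 / 2) + s) - κ * r ^ 2 := by
        linear_combination hsq
      rw [pow_add, this]; ring
    have p2 : (-(ν * r ^ 2 / 2) - s) ^ (k + 2) = -(ν * r ^ 2) * (-(ν * r ^ 2 / 2) - s) ^ (k + 1) -
        κ * r ^ 2 * (-(ν * r ^ 2 / 2) - s) ^ k := by
      have : (-(ν * r ^ 2 / 2) - s) ^ 2 = -(ν * r ^ 2) * (-(ν * r ^ 2 / 2) - s) - κ * r ^ 2 := by
        linear_combination hsq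
      rw [pow_add, this]; ring
    rw [p1, p2]
    ring

set_option maxHeartbeats 1000000 in
-- The gap z₁ - z₂ = 2s is comparable to r², which gives the weight r² on the left. The root z₂ is
-- comparable to -r² and produces the parabolic term; z₁ is bounded and bounded away from zero and
-- produces the term without smoothing.
lemma exists_osc_high {ν κ : ℝ} (hν : 0 < ν) (hκ : 1 ≤ κ) :
    ∃ R c : ℝ, 1 ≤ R ∧ 0 < c ∧ ∀ k : ℕ, ∃ C : ℝ, 0 < C ∧ ∀ r t, R ≤ r → 0 ≤ t →
      r ^ 2 * |osc ν κ r t k| ≤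
        C * (Real.exp (-(c * t)) + r ^ (2 * k) * Real.exp (-(c * r ^ 2 * t))) := by
  have hκ0 : 0 < κ := by linarith
  -- The two candidates for the rate are the bounds z₁ ≤ -κ/ν and z₂ ≤ -(3ν/4) r² below. The
  -- threshold makes the discriminant large.
  refine ⟨1 + 4 * κ / ν, min (κ / ν) (3 * ν / 4), ?_, by positivity, fun k => ?_⟩
  · have : 0 < 4 * κ / ν := by positivity
    linarith
  refine ⟨2 / ν * (4 * κ / (3 * ν)) ^ k + 2 / ν * ν ^ k, by positivity, fun r t hr ht => ?_⟩
  have hr1 : 1 ≤ r := by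
    have : 0 < 4 * κ / ν := by positivity
    linarith
  have hr0 : 0 < r := by linarith
  have hνr : 4 * κ ≤ ν * r := by
    have : 4 * κ / ν ≤ r := by linarith
    rw [div_le_iff₀ hν] at this
    linarith
  -- Since κ ≥ 1, this follows from ν r ≥ 4κ; it is what is needed for s ≥ ν r²/4.
  have hκr : 16 * κ ≤ 3 * ν ^ 2 * r ^ 2 := by nlinarith [mul_pos hν hr0]
  have hd : (ν * r ^ 2 / 4) ^ 2 ≤ (ν * r ^ 2 / 2) ^ 2 - κ * r ^ 2 := by
    nlinarith [mul_le_mul_of_nonneg_right hκr (sq_nonneg r)]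
  have hd0 : 0 < (ν * r ^ 2 / 2) ^ 2 - κ * r ^ 2 := lt_of_lt_of_le (by positivity) hd
  rw [osc_eq_exp hd0]
  set s := √((ν * r ^ 2 / 2) ^ 2 - κ * r ^ 2) with hs
  have hsq : s ^ 2 = (ν * r ^ 2 / 2) ^ 2 - κ * r ^ 2 := Real.sq_sqrt hd0.le
  have hs1 : ν * r ^ 2 / 4 ≤ s := Real.le_sqrt_of_sq_le hd
  have hs0 : 0 < s := lt_of_lt_of_le (by positivity) hs1
  have hs2 : s ≤ ν * r ^ 2 / 2 := by
    refine Real.sqrt_le_iff.2 ⟨by positivity, ?_⟩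
    have : 0 < κ * r ^ 2 := by positivity
    linarith
  set z₁ := -(ν * r ^ 2 / 2) + s with hz₁
  set z₂ := -(ν * r ^ 2 / 2) - s with hz₂
  have hprod : z₁ * z₂ = κ * r ^ 2 := by rw [hz₁, hz₂]; linear_combination -hsq
  have hz2l : -(ν * r ^ 2) ≤ z₂ := by rw [hz₂]; linarith
  have hz2u : z₂ ≤ -(3 * ν / 4 * r ^ 2) := by rw [hz₂]; linarith
  have hz2n : z₂ < 0 := lt_of_le_of_lt hz2u (by simp only [neg_lt_zero]; positivity)
  have hr2 : 0 < r ^ 2 := by positivity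
  -- The small root is a difference of two large numbers, so its bounds are read off from the
  -- product z₁ z₂ = κ r² and the bounds of z₂.
  have hz1u : z₁ ≤ -(κ / ν) := by
    by_contra! hcon
    have : z₁ * z₂ < -(κ / ν) * z₂ := mul_lt_mul_of_neg_right hcon hz2n
    have h2 : -(κ / ν) * z₂ ≤ κ / ν * (ν * r ^ 2) := by
      have : 0 < κ / ν := by positivity
      nlinarith
    rw [hprod] at this
    have h3 : κ / ν * (ν * r ^ 2) = κ * r ^ 2 := by field_simp
    linarith
  have hz1l : -(4 * κ / (3 * ν)) ≤ z₁ := by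
    by_contra! hcon
    have : -(4 * κ / (3 * ν)) * z₂ < z₁ * z₂ := mul_lt_mul_of_neg_right hcon hz2n
    have h2 : 4 * κ / (3 * ν) * (3 * ν / 4 * r ^ 2) ≤ -(4 * κ / (3 * ν)) * z₂ := by
      have : 0 < 4 * κ / (3 * ν) := by positivity
      nlinarith
    rw [hprod] at this
    have h3 : 4 * κ / (3 * ν) * (3 * ν / 4 * r ^ 2) = κ * r ^ 2 := by field_simp
    linarith
  have hκν : 0 < κ / ν := by positivity
  have ha1 : |z₁| ≤ 4 * κ / (3 * ν) := abs_le.2 ⟨hz1l, by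
    have : 0 < 4 * κ / (3 * ν) := by positivity
    linarith⟩
  have ha2 : |z₂| ≤ ν * r ^ 2 := abs_le.2 ⟨hz2l, by
    have : 0 < ν * r ^ 2 := by positivity
    linarith⟩
  have hc1 := min_le_left (κ / ν) (3 * ν / 4)
  have hc2 := min_le_right (κ / ν) (3 * ν / 4)
  set c := min (κ / ν) (3 * ν / 4)
  have he1 : Real.exp (z₁ * t) ≤ Real.exp (-(c * t)) := by
    apply Real.exp_le_exp.2
    nlinarith
  have he2 : Real.exp (z₂ * t) ≤ Real.exp (-(c * r ^ 2 * t)) := by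
    apply Real.exp_le_exp.2
    rw [← neg_mul]
    refine mul_le_mul_of_nonneg_right ?_ ht
    nlinarith
  have hA : |z₁ ^ k * Real.exp (z₁ * t) - z₂ ^ k * Real.exp (z₂ * t)| ≤
      (4 * κ / (3 * ν)) ^ k * Real.exp (-(c * t)) +
        (ν * r ^ 2) ^ k * Real.exp (-(c * r ^ 2 * t)) := by
    refine (abs_sub _ _).trans ?_
    rw [abs_mul, abs_mul, abs_pow, abs_pow, Real.abs_exp, Real.abs_exp]
    gcongr
  rw [abs_div, abs_of_pos (by positivity : 0 < 2 * s), ← mul_div_assoc]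
  calc r ^ 2 * |z₁ ^ k * Real.exp (z₁ * t) - z₂ ^ k * Real.exp (z₂ * t)| / (2 * s)
      ≤ r ^ 2 * ((4 * κ / (3 * ν)) ^ k * Real.exp (-(c * t)) +
        (ν * r ^ 2) ^ k * Real.exp (-(c * r ^ 2 * t))) / (2 * (ν * r ^ 2 / 4)) := by gcongr
    _ = 2 / ν * (4 * κ / (3 * ν)) ^ k * Real.exp (-(c * t)) +
        2 / ν * ν ^ k * (r ^ (2 * k) * Real.exp (-(c * r ^ 2 * t))) := by
      rw [mul_pow, ← pow_mul]
      field_simp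
      ring
    _ ≤ _ := by
      have e1 : 0 < 2 / ν * (4 * κ / (3 * ν)) ^ k := by positivity
      have e2 : 0 < 2 / ν * ν ^ k := by positivity
      have e3 : 0 < Real.exp (-(c * t)) := Real.exp_pos _
      have e4 : 0 < r ^ (2 * k) * Real.exp (-(c * r ^ 2 * t)) := by positivity
      nlinarith [mul_pos e1 e4, mul_pos e2 e3]

/-- The index g counts the velocity indices of the matrix entry. Each of them costs the parabolic
mode one power of r and saves one in the slow mode. -/
lemma exists_block_high {ν κ : ℝ} (hν : 0 < ν) (hκ : 1 ≤ κ) :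
    ∃ R c : ℝ, 1 ≤ R ∧ 0 < c ∧ ∀ m : ℕ, ∃ C : ℝ, 0 < C ∧ ∀ g, g ≤ 2 → ∀ r t, R ≤ r → 0 ≤ t →
      r ^ 2 * |block ν κ g m t r| ≤
        C * (r ^ (2 - g) * Real.exp (-(c * t)) + r ^ (2 * m + g) * Real.exp (-(c * r ^ 2 * t))) := by
  obtain ⟨R, c, hR, hc, h⟩ := exists_osc_high hν hκ
  have hκ0 : 0 < κ := by linarith
  refine ⟨R, c, hR, hc, fun m => ?_⟩
  obtain ⟨C₀, hC₀, h₀⟩ := h (m - 1)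
  obtain ⟨C₁, hC₁, h₁⟩ := h m
  obtain ⟨C₂, hC₂, h₂⟩ := h (m + 1)
  refine ⟨κ * C₀ + C₁ + 2 * C₂ + 2 * ν * C₁, by positivity, fun g hg r t hr ht => ?_⟩
  have hr1 : 1 ≤ r := hR.trans hr
  have hr0 : 0 < r := by linarith
  replace h₀ := h₀ r t hr ht
  replace h₁ := h₁ r t hr ht
  replace h₂ := h₂ r t hr ht
  have hE21 : Real.exp (-(c * r ^ 2 * t)) ≤ Real.exp (-(c * t)) := by
    apply Real.exp_le_exp.2
    have : 1 ≤ r ^ 2 := one_le_pow₀ hr1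
    nlinarith [mul_nonneg hc.le ht]
  set E₁ := Real.exp (-(c * t)) with hE₁
  set E₂ := Real.exp (-(c * r ^ 2 * t)) with hE₂
  have hE1 : 0 < E₁ := Real.exp_pos _
  have hE2 : 0 < E₂ := Real.exp_pos _
  have hfin : ∀ C' X : ℝ, 0 ≤ X → C' ≤ κ * C₀ + C₁ + 2 * C₂ + 2 * ν * C₁ →
      C' * X ≤ (κ * C₀ + C₁ + 2 * C₂ + 2 * ν * C₁) * X :=
    fun C' X hX hC => mul_le_mul_of_nonneg_right hC hX
  have p0 : 0 < κ * C₀ := by positivity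
  have p1 : 0 < ν * C₁ := by positivity
  match g, m with
  | 0, 0 =>
    simp only [block, mul_zero, zero_add, pow_zero, one_mul, mul_one, Nat.sub_zero] at *
    have hr2 : 1 ≤ r ^ 2 := one_le_pow₀ hr1
    calc r ^ 2 * |osc ν κ r t 1 + ν * r ^ 2 * osc ν κ r t 0|
        ≤ r ^ 2 * (|osc ν κ r t 1| + ν * r ^ 2 * |osc ν κ r t 0|) := by
          gcongr
          refine (abs_add_le _ _).trans_eq ?_
          rw [abs_mul (ν * r ^ 2), abs_of_pos (by positivity : 0 < ν * r ^ 2)]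
      _ = r ^ 2 * |osc ν κ r t 1| + ν * r ^ 2 * (r ^ 2 * |osc ν κ r t 0|) := by ring
      _ ≤ C₂ * (E₁ + r ^ 2 * E₂) + ν * r ^ 2 * (C₁ * (E₁ + E₂)) := by gcongr
      -- The claim leaves no room for r² in front of E₂ here, so the fast exponential is absorbed in
      -- the slow one; this doubles the constants.
      _ ≤ C₂ * (r ^ 2 * E₁ + r ^ 2 * E₁) + ν * r ^ 2 * (C₁ * (E₁ + E₁)) := by
          gcongr
          nlinarith
      _ = (2 * C₂ + 2 * ν * C₁) * (r ^ 2 * E₁) := by ring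
      _ ≤ (κ * C₀ + C₁ + 2 * C₂ + 2 * ν * C₁) * (r ^ 2 * E₁) :=
          hfin _ _ (by positivity) (by linarith)
      _ ≤ _ := by
          gcongr
          linarith
  | 0, m + 1 =>
    simp only [block, Nat.add_sub_cancel, Nat.sub_zero, add_zero] at *
    calc r ^ 2 * |-(κ * r ^ 2) * osc ν κ r t m| = κ * r ^ 2 * (r ^ 2 * |osc ν κ r t m|) := by
          rw [abs_mul, abs_neg, abs_of_pos (by positivity : 0 < κ * r ^ 2)]; ring
      _ ≤ κ * r ^ 2 * (C₀ * (E₁ + r ^ (2 * m) * E₂)) := by gcongr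
      _ = κ * C₀ * (r ^ 2 * E₁ + r ^ (2 * (m + 1)) * E₂) := by ring
      _ ≤ _ := hfin _ _ (by positivity) (by linarith)
  | 1, m =>
    simp only [block]
    calc r ^ 2 * |r * osc ν κ r t m| = r * (r ^ 2 * |osc ν κ r t m|) := by
          rw [abs_mul, abs_of_pos hr0]; ring
      _ ≤ r * (C₁ * (E₁ + r ^ (2 * m) * E₂)) := by gcongr
      _ = C₁ * (r ^ (2 - 1) * E₁ + r ^ (2 * m + 1) * E₂) := by
          rw [show 2 - 1 = 1 from rfl]; ring
      _ ≤ _ := hfin _ _ (by positivity) (by linarith)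
  | 2, m =>
    simp only [block]
    refine h₂.trans ?_
    have : r ^ (2 - 2) * E₁ + r ^ (2 * m + 2) * E₂ = E₁ + r ^ (2 * (m + 1)) * E₂ := by
      rw [show 2 - 2 = 0 from rfl, pow_zero, one_mul]; ring_nf
    rw [this]
    exact hfin _ _ (by positivity) (by linarith)
  | g + 3, m => omega

/-! ### The symbol of the solution operator -/

/-- Indices of the thirteen components: density, velocity and deformation. -/
abbrev Idx : Type := Unit ⊕ Fin 3 ⊕ (Fin 3 × Fin 3)

/-- `1` for the velocity components and `0` for the others. -/
def vel : Idx → ℕ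
  | .inl _ => 0
  | .inr (.inl _) => 1
  | .inr (.inr _) => 0

lemma vel_le_one (a : Idx) : vel a ≤ 1 := by
  rcases a with _ | _ | _ <;> simp [vel]

/-- The direction of a frequency. -/
def dir (i : Fin 3) (ξ : R3) : ℝ := ξ i / ‖ξ‖

lemma measurable_dir (i : Fin 3) : Measurable (dir i) := by
  unfold dir
  fun_prop

lemma abs_dir_le (i : Fin 3) (ξ : R3) : |dir i ξ| ≤ 1 := by
  rw [dir, abs_div, abs_norm]
  exact div_le_one_of_le₀ (PiLp.norm_apply_le ξ i) (norm_nonneg _)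

lemma freq_eq (i : Fin 3) (ξ : R3) : freq i ξ = rad ξ * dir i ξ := by
  unfold freq rad dir
  by_cases h : ‖ξ‖ = 0
  · simp [norm_eq_zero.1 h]
  · field_simp

lemma sum_dir_mul_self {ξ : R3} (h : ξ ≠ 0) : ∑ i, dir i ξ * dir i ξ = 1 := by
  have hn : ‖ξ‖ ≠ 0 := norm_ne_zero_iff.2 h
  have h2 := EuclideanSpace.norm_sq_eq ξ
  simp only [Real.norm_eq_abs, sq_abs] at h2
  have : ∀ i, dir i ξ * dir i ξ = ξ i ^ 2 / ‖ξ‖ ^ 2 := fun i => by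
    unfold dir; field_simp
  simp only [this]
  rw [← Finset.sum_div, ← h2]
  field_simp

/-- The Kronecker delta. -/
def kron (i j : Fin 3) : ℂ := if i = j then 1 else 0

lemma norm_kron_le (i j : Fin 3) : ‖kron i j‖ ≤ 1 := by unfold kron; split_ifs <;> simp

/-- The direction of a frequency, as a complex number. -/
def cdir (i : Fin 3) (ξ : R3) : ℂ := (dir i ξ : ℂ)

lemma measurable_cdir (i : Fin 3) : Measurable (cdir i) := by
  unfold cdir
  exact Complex.measurable_ofReal.comp (measurable_dir i)

lemma norm_cdir_le (i : Fin 3) (ξ : R3) : ‖cdir i ξ‖ ≤ 1 := by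
  rw [cdir, Complex.norm_real]
  exact abs_dir_le i ξ

lemma sum_cdir_mul_self {ξ : R3} (h : ξ ≠ 0) : ∑ i, cdir i ξ * cdir i ξ = 1 := by
  unfold cdir
  exact_mod_cast sum_dir_mul_self h

/-- The coefficients of the transversal modes. -/
def coefT (a b : Idx) (ξ : R3) : ℂ :=
  match a, b with
  | .inr (.inl i), .inr (.inl j) => kron i j - cdir i ξ * cdir j ξ
  | .inr (.inl i), .inr (.inr (j, k)) => Complex.I * cdir k ξ * (kron i j - cdir i ξ * cdir j ξ)
  | .inr (.inr (i, j)), .inr (.inl k) => Complex.I * cdir j ξ * (kron i k - cdir i ξ * cdir k ξ)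
  | .inr (.inr (i, j)), .inr (.inr (k, l)) => kron j l * (kron i k - cdir i ξ * cdir k ξ)
  | _, _ => 0

/-- The coefficients of the longitudinal modes. -/
def coefL (a b : Idx) (ξ : R3) : ℂ :=
  match a, b with
  | .inl _, .inl _ => 1
  | .inl _, .inr (.inl j) => -(Complex.I * cdir j ξ)
  | .inr (.inl i), .inr (.inl j) => cdir i ξ * cdir j ξ
  | .inr (.inl i), .inr (.inr (j, k)) => 2 * Complex.I * cdir k ξ * (cdir i ξ * cdir j ξ)
  | .inr (.inr (i, j)), .inr (.inl k) => Complex.I * cdir j ξ * (cdir i ξ * cdir k ξ)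
  | .inr (.inr (i, j)), .inr (.inr (k, l)) => kron j l * (cdir i ξ * cdir k ξ)
  | _, _ => 0

/-- The projection onto the admissible directions. -/
def coefP (a b : Idx) (ξ : R3) : ℂ :=
  match a, b with
  | .inl _, .inl _ => 1 / 2
  | .inl _, .inr (.inr (i, j)) => -(1 / 2) * (cdir i ξ * cdir j ξ)
  | .inr (.inl i), .inr (.inl j) => kron i j
  | .inr (.inr (i, j)), .inl _ => -(1 / 2) * (cdir i ξ * cdir j ξ)
  | .inr (.inr (i, j)), .inr (.inr (k, l)) =>
    cdir j ξ * (kron i k * cdir l ξ - 1 / 2 * (cdir i ξ * (cdir k ξ * cdir l ξ)))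
  | _, _ => 0

lemma norm_mul_le_one {a b : ℂ} (ha : ‖a‖ ≤ 1) (hb : ‖b‖ ≤ 1) : ‖a * b‖ ≤ 1 := by
  rw [norm_mul]; exact mul_le_one₀ ha (norm_nonneg _) hb

lemma norm_mul_le_two {a b : ℂ} (ha : ‖a‖ ≤ 1) (hb : ‖b‖ ≤ 2) : ‖a * b‖ ≤ 2 := by
  rw [norm_mul]
  exact (mul_le_mul ha hb (norm_nonneg _) zero_le_one).trans_eq (one_mul 2)

lemma norm_kron_sub_le (i j : Fin 3) (ξ : R3) : ‖kron i j - cdir i ξ * cdir j ξ‖ ≤ 2 := by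
  refine (norm_sub_le _ _).trans ?_
  have := norm_mul_le_one (norm_cdir_le i ξ) (norm_cdir_le j ξ)
  linarith [norm_kron_le i j]

lemma norm_I_mul_cdir_le (i : Fin 3) (ξ : R3) : ‖Complex.I * cdir i ξ‖ ≤ 1 :=
  norm_mul_le_one (by simp) (norm_cdir_le i ξ)

lemma norm_coefT_le (a b : Idx) (ξ : R3) : ‖coefT a b ξ‖ ≤ 2 := by
  rcases a with _ | i | ⟨i, j⟩ <;> rcases b with _ | k | ⟨k, l⟩ <;>
    simp only [coefT, norm_zero, Nat.ofNat_nonneg]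
  · exact norm_kron_sub_le _ _ _
  · exact norm_mul_le_two (norm_I_mul_cdir_le _ _) (norm_kron_sub_le _ _ _)
  · exact norm_mul_le_two (norm_I_mul_cdir_le _ _) (norm_kron_sub_le _ _ _)
  · exact norm_mul_le_two (norm_kron_le _ _) (norm_kron_sub_le _ _ _)

lemma norm_coefL_le (a b : Idx) (ξ : R3) : ‖coefL a b ξ‖ ≤ 2 := by
  have h2 : ∀ i j, ‖cdir i ξ * cdir j ξ‖ ≤ 1 := fun i j =>
    norm_mul_le_one (norm_cdir_le i ξ) (norm_cdir_le j ξ)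
  rcases a with _ | i | ⟨i, j⟩ <;> rcases b with _ | k | ⟨k, l⟩ <;>
    simp only [coefL, norm_zero, Nat.ofNat_nonneg]
  · simp
  · rw [norm_neg]; exact (norm_I_mul_cdir_le _ _).trans one_le_two
  · exact (h2 _ _).trans one_le_two
  · rw [mul_assoc 2, mul_assoc 2, norm_mul]
    have := norm_mul_le_one (norm_I_mul_cdir_le l ξ) (h2 i k)
    simpa using this
  · exact (norm_mul_le_one (norm_I_mul_cdir_le _ _) (h2 _ _)).trans one_le_two
  · exact (norm_mul_le_one (norm_kron_le _ _) (h2 _ _)).trans one_le_two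

lemma norm_coefP_le (a b : Idx) (ξ : R3) : ‖coefP a b ξ‖ ≤ 2 := by
  have h2 : ∀ i j, ‖cdir i ξ * cdir j ξ‖ ≤ 1 := fun i j =>
    norm_mul_le_one (norm_cdir_le i ξ) (norm_cdir_le j ξ)
  rcases a with _ | i | ⟨i, j⟩ <;> rcases b with _ | k | ⟨k, l⟩ <;>
    simp only [coefP, norm_zero, Nat.ofNat_nonneg]
  · norm_num
  · exact (norm_mul_le_one (by norm_num) (h2 _ _)).trans one_le_two
  · exact (norm_kron_le _ _).trans one_le_two
  · exact (norm_mul_le_one (by norm_num) (h2 _ _)).trans one_le_two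
  · refine norm_mul_le_two (norm_cdir_le _ _) ((norm_sub_le _ _).trans ?_)
    have e1 := norm_mul_le_one (norm_kron_le i k) (norm_cdir_le l ξ)
    have e2 : ‖(1 / 2 : ℂ) * (cdir i ξ * (cdir k ξ * cdir l ξ))‖ ≤ 1 :=
      norm_mul_le_one (by norm_num) (norm_mul_le_one (norm_cdir_le _ _) (h2 _ _))
    linarith

lemma measurable_coefT (a b : Idx) : Measurable (coefT a b) := by
  have := measurable_cdir
  unfold coefT
  rcases a with _ | i | ⟨i, j⟩ <;> rcases b with _ | k | ⟨k, l⟩ <;> simp only <;> fun_prop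

lemma measurable_coefL (a b : Idx) : Measurable (coefL a b) := by
  have := measurable_cdir
  unfold coefL
  rcases a with _ | i | ⟨i, j⟩ <;> rcases b with _ | k | ⟨k, l⟩ <;> simp only <;> fun_prop

lemma measurable_coefP (a b : Idx) : Measurable (coefP a b) := by
  have := measurable_cdir
  unfold coefP
  rcases a with _ | i | ⟨i, j⟩ <;> rcases b with _ | k | ⟨k, l⟩ <;> simp only <;> fun_prop

/-- The `m`-th time derivative of the symbol of the solution operator on admissible data. -/
def sym (mu lam : ℝ) (m : ℕ) (t : ℝ) (a b : Idx) (ξ : R3) : ℂ :=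
  coefT a b ξ * block mu 1 (vel a + vel b) m t (rad ξ) +
    coefL a b ξ * block (2 * mu + lam) 2 (vel a + vel b) m t (rad ξ)

lemma hasDerivAt_sym (mu lam : ℝ) (m : ℕ) (t : ℝ) (a b : Idx) (ξ : R3) :
    HasDerivAt (fun t => sym mu lam m t a b ξ) (sym mu lam (m + 1) t a b ξ) t :=
  ((hasDerivAt_block _ _ _ m t _).ofReal_comp.const_mul _).add
    ((hasDerivAt_block _ _ _ m t _).ofReal_comp.const_mul _)

lemma measurable_sym (mu lam : ℝ) (m : ℕ) (t : ℝ) (a b : Idx) :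
    Measurable (sym mu lam m t a b) := by
  have h1 : ∀ ν κ, Measurable (fun ξ : R3 =>
      ((block ν κ (vel a + vel b) m t (rad ξ) : ℝ) : ℂ)) := fun ν κ =>
    Complex.measurable_ofReal.comp ((measurable_block _ _ _ _ _).comp continuous_rad.measurable)
  exact ((measurable_coefT a b).mul (h1 _ _)).add ((measurable_coefL a b).mul (h1 _ _))

lemma norm_sym_le_of_abs_block_le {mu lam : ℝ} {m : ℕ} {t : ℝ} {a b : Idx} {ξ : R3} {A B : ℝ}
    (hA : |block mu 1 (vel a + vel b) m t (rad ξ)| ≤ A)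
    (hB : |block (2 * mu + lam) 2 (vel a + vel b) m t (rad ξ)| ≤ B) :
    ‖sym mu lam m t a b ξ‖ ≤ 2 * A + 2 * B := by
  refine (norm_add_le _ _).trans (add_le_add ?_ ?_)
  · rw [norm_mul, Complex.norm_real]
    exact mul_le_mul (norm_coefT_le _ _ _) hA (norm_nonneg _) zero_le_two
  · rw [norm_mul, Complex.norm_real]
    exact mul_le_mul (norm_coefL_le _ _ _) hB (norm_nonneg _) zero_le_two

lemma norm_sym_zero_le {mu lam : ℝ} (hmu : 0 < mu) (hlam : 0 ≤ 2 * mu + 3 * lam) {t : ℝ}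
    (ht : 0 ≤ t) (a b : Idx) (ξ : R3) : ‖sym mu lam 0 t a b ξ‖ ≤ 4 := by
  refine (norm_sym_le_of_abs_block_le (abs_block_zero_le hmu le_rfl ht _)
    (abs_block_zero_le (by linarith) one_le_two ht _)).trans (by norm_num)

/-- Unlike the high frequency bounds this one is uniform down to t = 0, at the price of r². It
supplies the dominating function for differentiating the pairings with test functions. -/
lemma abs_block_one_le {ν κ r t : ℝ} (hν : 0 < ν) (hκ : 1 ≤ κ) (hr : 0 ≤ r) (ht : 0 ≤ t)
    {g : ℕ} : |block ν κ g 1 t r| ≤ (κ + 1 + ν) * (1 + r ^ 2) := by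
  have h1 := abs_block_zero_le (r := r) hν hκ ht 1
  have h2 := abs_block_zero_le (r := r) hν hκ ht 2
  simp only [block, zero_add] at h1 h2
  have hκ0 : 0 < κ := by linarith
  have hr1 : r ≤ 1 + r ^ 2 := by nlinarith [sq_nonneg (r - 1)]
  match g with
  | 0 =>
    simp only [block]
    rw [show -(κ * r ^ 2) * osc ν κ r t 0 = -(κ * r * (r * osc ν κ r t 0)) by ring, abs_neg,
      abs_mul, abs_of_nonneg (by positivity : 0 ≤ κ * r)]
    calc κ * r * |r * osc ν κ r t 0| ≤ κ * (1 + r ^ 2) * 1 := by gcongr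
      _ ≤ _ := by nlinarith [sq_nonneg r, mul_nonneg hν.le (sq_nonneg r)]
  | 1 =>
    simp only [block]
    rw [abs_mul, abs_of_nonneg hr]
    calc r * |osc ν κ r t 1| ≤ (1 + r ^ 2) * 1 := by gcongr
      _ ≤ _ := by nlinarith [sq_nonneg r, mul_nonneg hν.le (sq_nonneg r),
                    mul_nonneg hκ0.le (sq_nonneg r)]
  | _ + 2 =>
    simp only [block]
    rw [osc_add_two]
    calc |-(ν * r ^ 2) * osc ν κ r t 1 - κ * r ^ 2 * osc ν κ r t 0|
        ≤ |-(ν * r ^ 2) * osc ν κ r t 1| + |κ * r ^ 2 * osc ν κ r t 0| := abs_sub _ _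
      _ = ν * r ^ 2 * |osc ν κ r t 1| + κ * r * |r * osc ν κ r t 0| := by
        rw [abs_mul, abs_neg, abs_of_nonneg (by positivity : 0 ≤ ν * r ^ 2),
          show κ * r ^ 2 * osc ν κ r t 0 = κ * r * (r * osc ν κ r t 0) by ring, abs_mul,
          abs_of_nonneg (by positivity : 0 ≤ κ * r)]
      _ ≤ ν * r ^ 2 * 1 + κ * (1 + r ^ 2) * 1 := by gcongr
      _ ≤ _ := by nlinarith [sq_nonneg r]

lemma exists_norm_sym_one_le {mu lam : ℝ} (hmu : 0 < mu) (hlam : 0 ≤ 2 * mu + 3 * lam) :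
    ∃ C : ℝ, 0 < C ∧ ∀ t, 0 ≤ t → ∀ a b ξ, ‖sym mu lam 1 t a b ξ‖ ≤ C * (1 + rad ξ ^ 2) := by
  have hν : 0 < 2 * mu + lam := by linarith
  refine ⟨2 * (1 + 1 + mu) + 2 * (2 + 1 + (2 * mu + lam)), by positivity, fun t ht a b ξ => ?_⟩
  refine (norm_sym_le_of_abs_block_le (abs_block_one_le hmu le_rfl (rad_nonneg ξ) ht)
    (abs_block_one_le hν one_le_two (rad_nonneg ξ) ht)).trans (le_of_eq ?_)
  ring

/-! #### Algebra of the symbol -/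

/-- The constraints at a single frequency. -/
def Adm (ξ : R3) (x : Idx → ℂ) : Prop :=
  (∀ k, cdir k ξ * x (.inl ()) + ∑ j, cdir j ξ * x (.inr (.inr (j, k))) = 0) ∧
  (∀ j k l, cdir l ξ * x (.inr (.inr (j, k))) = cdir k ξ * x (.inr (.inr (j, l))))

/-- Each row of E is curl free, hence parallel to ω: insert |ω|² = 1 and exchange the indices by the
second constraint. -/
lemma Adm.deformation_eq {ξ : R3} (hξ : ξ ≠ 0) {x : Idx → ℂ} (h : Adm ξ x) (i j : Fin 3) :
    x (.inr (.inr (i, j))) = (∑ k, cdir k ξ * x (.inr (.inr (i, k)))) * cdir j ξ := by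
  have h1 := sum_cdir_mul_self hξ
  calc x (.inr (.inr (i, j))) = (∑ k, cdir k ξ * cdir k ξ) * x (.inr (.inr (i, j))) := by
        rw [h1, one_mul]
    _ = ∑ k, cdir k ξ * (cdir k ξ * x (.inr (.inr (i, j)))) := by
        rw [Finset.sum_mul]; exact Finset.sum_congr rfl fun k _ => by ring
    _ = ∑ k, cdir k ξ * (cdir j ξ * x (.inr (.inr (i, k)))) :=
        Finset.sum_congr rfl fun k _ => by rw [h.2 i j k]
    _ = _ := by rw [Finset.sum_mul]; exact Finset.sum_congr rfl fun k _ => by ring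

/-- Contract the first constraint with ω and use |ω| = 1. -/
lemma Adm.density_eq {ξ : R3} (hξ : ξ ≠ 0) {x : Idx → ℂ} (h : Adm ξ x) :
    x (.inl ()) = -∑ i, cdir i ξ * ∑ k, cdir k ξ * x (.inr (.inr (i, k))) := by
  have h1 := sum_cdir_mul_self hξ
  have h2 : ∑ k, cdir k ξ * (cdir k ξ * x (.inl ()) +
      ∑ j, cdir j ξ * x (.inr (.inr (j, k)))) = 0 :=
    Finset.sum_eq_zero fun k _ => by rw [h.1 k, mul_zero]
  simp only [Fin.sum_univ_three] at *
  linear_combination h2 - x (.inl ()) * h1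

lemma sum_Idx (f : Idx → ℂ) : ∑ b, f b =
    f (.inl ()) + (∑ j, f (.inr (.inl j)) + ∑ j, ∑ k, f (.inr (.inr (j, k)))) := by
  simp [Fintype.sum_sum_type, Fintype.sum_prod_type]

lemma sum_kron_sub (i : Fin 3) (ξ : R3) (v : Fin 3 → ℂ) :
    ∑ j, (kron i j - cdir i ξ * cdir j ξ) * v j = v i - cdir i ξ * ∑ j, cdir j ξ * v j := by
  simp [sub_mul, kron, Finset.mul_sum, mul_assoc]

lemma sum_sym_density {mu lam : ℝ} {m : ℕ} {t : ℝ} {ξ : R3} {x : Idx → ℂ} :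
    ∑ b, sym mu lam m t (.inl ()) b ξ * x b =
      block (2 * mu + lam) 2 0 m t (rad ξ) * x (.inl ()) -
        Complex.I * block (2 * mu + lam) 2 1 m t (rad ξ) * ∑ j, cdir j ξ * x (.inr (.inl j)) := by
  rw [sum_Idx]
  simp only [sym, coefT, coefL, vel, zero_mul, zero_add, add_zero, one_mul, Finset.sum_const_zero,
    Finset.mul_sum, sub_eq_add_neg, ← Finset.sum_neg_distrib]
  congr 1
  exact Finset.sum_congr rfl fun j _ => by ring

/-- The density does not enter the velocity row. On admissible vectors it equals -ω·q, so the
pressure gradient acts along ω exactly like the divergence of E; this is the factor 2 in the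
longitudinal part. -/
lemma sum_sym_velocity {mu lam : ℝ} {m : ℕ} {t : ℝ} {ξ : R3} (hξ : ξ ≠ 0) {x : Idx → ℂ}
    (h : Adm ξ x) (i : Fin 3) {q : Fin 3 → ℂ}
    (hq : q = fun i => ∑ k, cdir k ξ * x (.inr (.inr (i, k)))) :
    ∑ b, sym mu lam m t (.inr (.inl i)) b ξ * x b =
      block mu 1 2 m t (rad ξ) *
        (x (.inr (.inl i)) - cdir i ξ * ∑ j, cdir j ξ * x (.inr (.inl j))) +
      block (2 * mu + lam) 2 2 m t (rad ξ) * (cdir i ξ * ∑ j, cdir j ξ * x (.inr (.inl j))) +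
      Complex.I * (block mu 1 1 m t (rad ξ) * (q i - cdir i ξ * ∑ j, cdir j ξ * q j) +
        2 * block (2 * mu + lam) 2 1 m t (rad ξ) * (cdir i ξ * ∑ j, cdir j ξ * q j)) := by
  have hE : ∀ j k, x (.inr (.inr (j, k))) = q j * cdir k ξ := fun j k => by
    rw [hq]; exact h.deformation_eq hξ j k
  have h1 := sum_cdir_mul_self hξ
  rw [sum_Idx, ← sum_kron_sub i ξ q, ← sum_kron_sub i ξ (fun j => x (.inr (.inl j)))]
  simp only [sym, coefT, coefL, vel, hE]
  have e1 : ∀ j, ∑ k, (Complex.I * cdir k ξ * (kron i j - cdir i ξ * cdir j ξ) *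
      (block mu 1 (1 + 0) m t (rad ξ) : ℂ) + 2 * Complex.I * cdir k ξ * (cdir i ξ * cdir j ξ) *
      (block (2 * mu + lam) 2 (1 + 0) m t (rad ξ) : ℂ)) * (q j * cdir k ξ) =
      Complex.I * ((block mu 1 1 m t (rad ξ) : ℂ) * ((kron i j - cdir i ξ * cdir j ξ) * q j) +
        2 * (block (2 * mu + lam) 2 1 m t (rad ξ) : ℂ) * (cdir i ξ * (cdir j ξ * q j))) := by
    intro j
    rw [← mul_one (Complex.I * _), ← h1, Finset.mul_sum]
    exact Finset.sum_congr rfl fun k _ => by ring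
  simp only [e1, Finset.mul_sum, ← Finset.sum_add_distrib, zero_mul, zero_add, add_zero]
  exact Finset.sum_congr rfl fun j _ => by ring

lemma sum_sym_deformation {mu lam : ℝ} {m : ℕ} {t : ℝ} {ξ : R3} (hξ : ξ ≠ 0) {x : Idx → ℂ}
    (h : Adm ξ x) (i j : Fin 3) {q : Fin 3 → ℂ}
    (hq : q = fun i => ∑ k, cdir k ξ * x (.inr (.inr (i, k)))) :
    ∑ b, sym mu lam m t (.inr (.inr (i, j))) b ξ * x b = cdir j ξ *
      (block mu 1 0 m t (rad ξ) * (q i - cdir i ξ * ∑ k, cdir k ξ * q k) +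
      block (2 * mu + lam) 2 0 m t (rad ξ) * (cdir i ξ * ∑ k, cdir k ξ * q k) +
      Complex.I * (block mu 1 1 m t (rad ξ) *
        (x (.inr (.inl i)) - cdir i ξ * ∑ k, cdir k ξ * x (.inr (.inl k))) +
        block (2 * mu + lam) 2 1 m t (rad ξ) *
          (cdir i ξ * ∑ k, cdir k ξ * x (.inr (.inl k))))) := by
  have hE : ∀ j k, x (.inr (.inr (j, k))) = q j * cdir k ξ := fun j k => by
    rw [hq]; exact h.deformation_eq hξ j k
  rw [sum_Idx, ← sum_kron_sub i ξ q, ← sum_kron_sub i ξ (fun j => x (.inr (.inl j)))]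
  simp only [sym, coefT, coefL, vel, hE]
  have e1 : ∀ k, ∑ l, (kron j l * (kron i k - cdir i ξ * cdir k ξ) *
      (block mu 1 (0 + 0) m t (rad ξ) : ℂ) + kron j l * (cdir i ξ * cdir k ξ) *
      (block (2 * mu + lam) 2 (0 + 0) m t (rad ξ) : ℂ)) * (q k * cdir l ξ) =
      cdir j ξ * ((block mu 1 0 m t (rad ξ) : ℂ) * ((kron i k - cdir i ξ * cdir k ξ) * q k) +
        (block (2 * mu + lam) 2 0 m t (rad ξ) : ℂ) * (cdir i ξ * (cdir k ξ * q k))) := by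
    intro k
    rw [Finset.sum_eq_single j]
    · simp only [kron]
      simp
      ring
    · intro l _ hl
      simp [kron, hl.symm]
    · simp
  simp only [e1, Finset.mul_sum, ← Finset.sum_add_distrib, zero_mul, zero_add, add_zero]
  exact Finset.sum_congr rfl fun j _ => by ring

lemma block_zero_one (ν κ t r : ℝ) : block ν κ 0 1 t r = -(κ * r * block ν κ 1 0 t r) := by
  simp only [block]; ring

lemma block_one_one (ν κ t r : ℝ) : block ν κ 1 1 t r = r * block ν κ 2 0 t r := rfl

lemma block_two_one (ν κ t r : ℝ) : block ν κ 2 1 t r =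
    -(ν * r ^ 2 * block ν κ 2 0 t r) - κ * r * block ν κ 1 0 t r := by
  simp only [block]
  rw [show 1 + 1 = 0 + 2 from rfl, osc_add_two]; ring

/-- This relation between the three blocks closes the velocity equation: the elastic force
multiplies r by the block g = 0, whereas differentiating the block g = 1 produces r times the block
g = 2. -/
lemma mul_block_zero_zero (ν κ t r : ℝ) : r * block ν κ 0 0 t r =
    r * block ν κ 2 0 t r + ν * r ^ 2 * block ν κ 1 0 t r := by
  simp only [block]; ring

/-! ### The symbol solves the system at a single frequency -/

section ODE

variable {mu lam t : ℝ} {ξ : R3} {x : Idx → ℂ}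

lemma sum_cdir_mul_velocity (hξ : ξ ≠ 0) (h : Adm ξ x) {q : Fin 3 → ℂ}
    (hq : q = fun i => ∑ k, cdir k ξ * x (.inr (.inr (i, k)))) :
    ∑ i, cdir i ξ * ∑ b, sym mu lam 0 t (.inr (.inl i)) b ξ * x b =
      block (2 * mu + lam) 2 2 0 t (rad ξ) * ∑ j, cdir j ξ * x (.inr (.inl j)) +
      2 * Complex.I * block (2 * mu + lam) 2 1 0 t (rad ξ) * ∑ j, cdir j ξ * q j := by
  have h1 := sum_cdir_mul_self hξ
  simp only [sum_sym_velocity hξ h _ hq]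
  set s := ∑ j, cdir j ξ * x (.inr (.inl j)) with hs
  set τ := ∑ j, cdir j ξ * q j with hτ
  simp only [Fin.sum_univ_three] at *
  linear_combination (-(block mu 1 2 0 t (rad ξ)) * s + block (2 * mu + lam) 2 2 0 t (rad ξ) * s
    - Complex.I * block mu 1 1 0 t (rad ξ) * τ
    + 2 * Complex.I * block (2 * mu + lam) 2 1 0 t (rad ξ) * τ) * h1
    - block mu 1 2 0 t (rad ξ) * hs - Complex.I * block mu 1 1 0 t (rad ξ) * hτ

lemma sym_density_ode (hξ : ξ ≠ 0) (h : Adm ξ x) :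
    ∑ b, sym mu lam 1 t (.inl ()) b ξ * x b =
      -(Complex.I * ∑ i, freq i ξ * ∑ b, sym mu lam 0 t (.inr (.inl i)) b ξ * x b) := by
  have hf : ∀ i, (freq i ξ : ℂ) = rad ξ * cdir i ξ := fun i => by
    rw [freq_eq]; push_cast; rfl
  simp only [hf, mul_assoc, ← Finset.mul_sum]
  rw [sum_cdir_mul_velocity hξ h rfl, sum_sym_density, h.density_eq hξ, block_zero_one,
    block_one_one]
  push_cast
  linear_combination (2 * (rad ξ : ℂ) * block (2 * mu + lam) 2 1 0 t (rad ξ) *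
    ∑ i, cdir i ξ * ∑ k, cdir k ξ * x (.inr (.inr (i, k)))) * Complex.I_sq

lemma sym_deformation_ode (hξ : ξ ≠ 0) (h : Adm ξ x) (i j : Fin 3) :
    ∑ b, sym mu lam 1 t (.inr (.inr (i, j))) b ξ * x b =
      Complex.I * freq j ξ * ∑ b, sym mu lam 0 t (.inr (.inl i)) b ξ * x b := by
  have hf : (freq j ξ : ℂ) = rad ξ * cdir j ξ := by
    rw [freq_eq]; push_cast; rfl
  rw [hf, sum_sym_velocity hξ h i rfl, sum_sym_deformation hξ h i j rfl, block_zero_one,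
    block_one_one, block_zero_one, block_one_one]
  push_cast
  set q : Fin 3 → ℂ := fun i => ∑ k, cdir k ξ * x (.inr (.inr (i, k)))
  linear_combination (-(rad ξ : ℂ) * cdir j ξ * (block mu 1 1 0 t (rad ξ) *
    (q i - cdir i ξ * ∑ j, cdir j ξ * q j) + 2 * block (2 * mu + lam) 2 1 0 t (rad ξ) *
    (cdir i ξ * ∑ j, cdir j ξ * q j))) * Complex.I_sq

lemma sum_deformation_mul_dir (hξ : ξ ≠ 0) (h : Adm ξ x) (i : Fin 3) {q : Fin 3 → ℂ}
    (hq : q = fun i => ∑ k, cdir k ξ * x (.inr (.inr (i, k)))) :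
    ∑ k, cdir k ξ * ∑ b, sym mu lam 0 t (.inr (.inr (i, k))) b ξ * x b =
      (block mu 1 0 0 t (rad ξ) * (q i - cdir i ξ * ∑ k, cdir k ξ * q k) +
      block (2 * mu + lam) 2 0 0 t (rad ξ) * (cdir i ξ * ∑ k, cdir k ξ * q k) +
      Complex.I * (block mu 1 1 0 t (rad ξ) *
        (x (.inr (.inl i)) - cdir i ξ * ∑ k, cdir k ξ * x (.inr (.inl k))) +
        block (2 * mu + lam) 2 1 0 t (rad ξ) *
          (cdir i ξ * ∑ k, cdir k ξ * x (.inr (.inl k))))) := by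
  simp only [sum_sym_deformation hξ h i _ hq, ← mul_assoc (cdir _ ξ) (cdir _ ξ)]
  rw [← Finset.sum_mul, sum_cdir_mul_self hξ, one_mul]

/-- After inserting the closed forms of all components, what remains is the oscillator equation for
S' across and along ω, together with `mul_block_zero_zero` for each of the two oscillators. -/
lemma sym_velocity_ode (hξ : ξ ≠ 0) (h : Adm ξ x) (i : Fin 3) :
    ∑ b, sym mu lam 1 t (.inr (.inl i)) b ξ * x b =
      -(mu * rad ξ ^ 2 * ∑ b, sym mu lam 0 t (.inr (.inl i)) b ξ * x b)
      - (lam + mu) * freq i ξ *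
        ∑ j, freq j ξ * ∑ b, sym mu lam 0 t (.inr (.inl j)) b ξ * x b
      - Complex.I * freq i ξ * ∑ b, sym mu lam 0 t (.inl ()) b ξ * x b
      + Complex.I * ∑ k, freq k ξ * ∑ b, sym mu lam 0 t (.inr (.inr (i, k))) b ξ * x b := by
  have hf : ∀ i, (freq i ξ : ℂ) = rad ξ * cdir i ξ := fun i => by
    rw [freq_eq]; push_cast; rfl
  simp only [hf, mul_assoc (rad ξ : ℂ), ← Finset.mul_sum]
  rw [sum_cdir_mul_velocity hξ h rfl, sum_sym_velocity hξ h i rfl, sum_sym_velocity hξ h i rfl,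
    sum_sym_density, sum_deformation_mul_dir hξ h i rfl, h.density_eq hξ, block_two_one,
    block_one_one, block_two_one, block_one_one]
  have m1 := congrArg (fun r : ℝ => (r : ℂ)) (mul_block_zero_zero mu 1 t (rad ξ))
  have m2 := congrArg (fun r : ℝ => (r : ℂ)) (mul_block_zero_zero (2 * mu + lam) 2 t (rad ξ))
  push_cast at m1 m2 ⊢
  set q : Fin 3 → ℂ := fun i => ∑ k, cdir k ξ * x (.inr (.inr (i, k)))
  set s := ∑ j, cdir j ξ * x (.inr (.inl j))
  set τ := ∑ j, cdir j ξ * q j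
  have hI := Complex.I_sq
  linear_combination (-Complex.I * (q i - cdir i ξ * τ)) * m1 - 2 * Complex.I * cdir i ξ * τ * m2
    + (-(rad ξ : ℂ) * block mu 1 1 0 t (rad ξ) * (x (.inr (.inl i)) - cdir i ξ * s)
      - 2 * (rad ξ : ℂ) * block (2 * mu + lam) 2 1 0 t (rad ξ) * cdir i ξ * s) * hI

lemma sym_zero_time (hξ : ξ ≠ 0) (h : Adm ξ x) (a : Idx) :
    ∑ b, sym mu lam 0 0 a b ξ * x b = x a := by
  have b0 : ∀ ν κ : ℝ, block ν κ 0 0 0 (rad ξ) = 1 := fun ν κ => by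
    simp [block, osc_zero_zero, osc_zero_one]
  have b1 : ∀ ν κ : ℝ, block ν κ 1 0 0 (rad ξ) = 0 := fun ν κ => by
    simp [block, osc_zero_zero]
  have b2 : ∀ ν κ : ℝ, block ν κ 2 0 0 (rad ξ) = 1 := fun ν κ => by
    simp [block, osc_zero_one]
  rcases a with _ | i | ⟨i, j⟩
  · rw [sum_sym_density, b0, b1]; simp
  · rw [sum_sym_velocity hξ h i rfl, b2, b1, b2, b1]; simp
  · rw [sum_sym_deformation hξ h i j rfl, b0, b1, b0, b1, h.deformation_eq hξ i j]
    simp; ring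

lemma sum_coefP_density : ∑ b, coefP (.inl ()) b ξ * x b =
    1 / 2 * (x (.inl ()) - ∑ i, cdir i ξ * ∑ k, cdir k ξ * x (.inr (.inr (i, k)))) := by
  rw [sum_Idx]
  simp only [coefP, Fin.sum_univ_three]
  ring

lemma sum_coefP_velocity (i : Fin 3) : ∑ b, coefP (.inr (.inl i)) b ξ * x b =
    x (.inr (.inl i)) := by
  rw [sum_Idx]
  simp [coefP, kron]

lemma sum_coefP_deformation (i j : Fin 3) : ∑ b, coefP (.inr (.inr (i, j))) b ξ * x b =
    cdir j ξ * (∑ k, cdir k ξ * x (.inr (.inr (i, k))) - 1 / 2 * cdir i ξ *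
      (x (.inl ()) + ∑ l, cdir l ξ * ∑ k, cdir k ξ * x (.inr (.inr (l, k))))) := by
  rw [sum_Idx]
  fin_cases i <;> simp [coefP, kron, Fin.sum_univ_three] <;> ring

/-- With `Adm.coefP_eq` this makes `coefP` a projection with range the admissible vectors. Its
matrix is real and symmetric, so the projection is orthogonal. -/
lemma adm_coefP (hξ : ξ ≠ 0) (x : Idx → ℂ) : Adm ξ (fun a => ∑ b, coefP a b ξ * x b) := by
  have h1 := sum_cdir_mul_self hξ
  constructor
  · intro k
    simp only [sum_coefP_density, sum_coefP_deformation]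
    set q : Fin 3 → ℂ := fun i => ∑ k, cdir k ξ * x (.inr (.inr (i, k))) with hq
    change cdir k ξ * (1 / 2 * (x (.inl ()) - ∑ i, cdir i ξ * q i)) + ∑ j, cdir j ξ * (cdir k ξ *
      (q j - 1 / 2 * cdir j ξ * (x (.inl ()) + ∑ l, cdir l ξ * q l))) = 0
    simp only [Fin.sum_univ_three] at *
    linear_combination (-(1 / 2) * cdir k ξ * (x (.inl ()) +
      (cdir 0 ξ * q 0 + cdir 1 ξ * q 1 + cdir 2 ξ * q 2))) * h1
  · intro j k l
    simp only [sum_coefP_deformation]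
    ring

lemma Adm.coefP_eq (hξ : ξ ≠ 0) (h : Adm ξ x) (a : Idx) : ∑ b, coefP a b ξ * x b = x a := by
  rcases a with _ | i | ⟨i, j⟩
  · rw [sum_coefP_density]
    have := h.density_eq hξ
    linear_combination (-(1 / 2)) * this
  · exact sum_coefP_velocity i
  · rw [sum_coefP_deformation, h.deformation_eq hξ i j]
    have := h.density_eq hξ
    linear_combination (-(1 / 2) * cdir i ξ * cdir j ξ) * this

/-- The complement of the admissible directions is static. -/
lemma static_relation (hξ : ξ ≠ 0) (x : Idx → ℂ) (i : Fin 3) :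
    freq i ξ * (x (.inl ()) - ∑ b, coefP (.inl ()) b ξ * x b) =
      ∑ k, freq k ξ *
        (x (.inr (.inr (i, k))) - ∑ b, coefP (.inr (.inr (i, k))) b ξ * x b) := by
  have hf : ∀ i, (freq i ξ : ℂ) = rad ξ * cdir i ξ := fun i => by
    rw [freq_eq]; push_cast; rfl
  have h1 := sum_cdir_mul_self hξ
  simp only [hf, sum_coefP_density, sum_coefP_deformation]
  set τ := ∑ l, cdir l ξ * ∑ k, cdir k ξ * x (.inr (.inr (l, k)))
  simp only [Fin.sum_univ_three] at *
  linear_combination (rad ξ : ℂ) * ((cdir 0 ξ * x (.inr (.inr (i, 0))) +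
    cdir 1 ξ * x (.inr (.inr (i, 1))) + cdir 2 ξ * x (.inr (.inr (i, 2)))) -
      1 / 2 * cdir i ξ * (x (.inl ()) + τ)) * h1

end ODE

/-! ### Multiplication operators -/

/-- A bounded measurable symbol. -/
structure Bdd (m : R3 → ℂ) : Prop where
  measurable : Measurable m
  bounded : ∃ A : ℝ, ∀ ξ, ‖m ξ‖ ≤ A

lemma Bdd.memLp {m : R3 → ℂ} (h : Bdd m) : MemLp m ∞ (volume : Measure R3) := by
  obtain ⟨A, hA⟩ := h.bounded
  exact memLp_top_of_bound h.measurable.aestronglyMeasurable A (Eventually.of_forall hA)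

lemma Bdd.mul {m m' : R3 → ℂ} (h : Bdd m) (h' : Bdd m') : Bdd (fun ξ => m ξ * m' ξ) := by
  obtain ⟨A, hA⟩ := h.bounded
  obtain ⟨A', hA'⟩ := h'.bounded
  refine ⟨h.measurable.mul h'.measurable, A * A', fun ξ => ?_⟩
  rw [norm_mul]
  exact mul_le_mul (hA ξ) (hA' ξ) (norm_nonneg _) ((norm_nonneg _).trans (hA ξ))

lemma Bdd.conj {m : R3 → ℂ} (h : Bdd m) : Bdd (fun ξ => (starRingEnd ℂ) (m ξ)) :=
  ⟨Complex.continuous_conj.measurable.comp h.measurable, h.bounded.imp fun A hA ξ => by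
    simpa using hA ξ⟩

open Classical in
/-- Multiplication by a bounded symbol. -/
def mulOp (m : R3 → ℂ) : CL2 →L[ℂ] CL2 :=
  if h : MemLp m ∞ (volume : Measure R3) then
    (ContinuousLinearMap.mul ℂ ℂ).holderL volume ∞ 2 2 (h.toLp m)
  else 0

lemma coeFn_mulOp {m : R3 → ℂ} (h : Bdd m) (f : CL2) :
    mulOp m f =ᵐ[volume] fun ξ => m ξ * f ξ := by
  rw [mulOp, dif_pos h.memLp, ContinuousLinearMap.holderL_apply_apply]
  filter_upwards [(ContinuousLinearMap.mul ℂ ℂ).coeFn_holder (r := 2) (h.memLp.toLp m) f,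
    h.memLp.coeFn_toLp] with ξ h1 h2
  rw [h1, h2]
  rfl

lemma norm_le_of_ae {f g : CL2} {C : ℝ} (h : ∀ᵐ ξ, ‖g ξ‖ ≤ C * ‖f ξ‖) : ‖g‖ ≤ C * ‖f‖ :=
  Lp.norm_le_mul_norm_of_ae_le_mul h

lemma inner_mulOp_left {m : R3 → ℂ} (h : Bdd m) (f g : CL2) :
    inner ℂ (mulOp m f) g = inner ℂ f (mulOp (fun ξ => (starRingEnd ℂ) (m ξ)) g) := by
  rw [inner_CL2, inner_CL2]
  refine integral_congr_ae ?_
  filter_upwards [coeFn_mulOp h f, coeFn_mulOp h.conj g] with ξ h1 h2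
  rw [h1, h2, map_mul]
  ring

/-- Taylor's formula of first order by applying the mean value inequality twice. The bound of the
second derivative is all that enters, so the remainder is uniform in the frequency. -/
lemma norm_sub_sub_le_of_hasDerivAt {f₀ f₁ f₂ : ℝ → ℂ} (h₀ : ∀ t, HasDerivAt f₀ (f₁ t) t)
    (h₁ : ∀ t, HasDerivAt f₁ (f₂ t) t) {ε B s t : ℝ} (hB : ∀ τ, ε ≤ τ → ‖f₂ τ‖ ≤ B)
    (hs : ε ≤ s) (ht : ε ≤ t) :
    ‖f₀ s - f₀ t - (s - t) * f₁ t‖ ≤ B * |s - t| ^ 2 := by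
  have h1 : ∀ τ ∈ uIcc t s, ‖f₁ τ - f₁ t‖ ≤ B * |s - t| := by
    intro τ hτ
    have hτε : ε ≤ τ := (le_min ht hs).trans hτ.1
    have := (convex_Ici ε).norm_image_sub_le_of_norm_hasDerivWithin_le (f := f₁) (f' := f₂)
      (fun x _ => (h₁ x).hasDerivWithinAt) (fun x hx => hB x hx) ht hτε
    refine this.trans ?_
    have hB0 : 0 ≤ B := (norm_nonneg _).trans (hB t ht)
    gcongr
    rw [Real.norm_eq_abs]
    rcases le_total t s with hts | hts
    · rw [uIcc_of_le hts] at hτ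
      rw [abs_of_nonneg (by linarith [hτ.1]), abs_of_nonneg (by linarith)]
      linarith [hτ.2]
    · rw [uIcc_of_ge hts] at hτ
      rw [abs_of_nonpos (by linarith [hτ.2]), abs_of_nonpos (by linarith)]
      linarith [hτ.1]
  have h2 : ∀ τ, HasDerivAt (fun τ : ℝ => f₀ τ - τ * f₁ t) (f₁ τ - f₁ t) τ := by
    intro τ
    have h3 : HasDerivAt (fun τ : ℝ => (τ : ℂ) * f₁ t) (1 * f₁ t) τ :=
      (hasDerivAt_id τ).ofReal_comp.mul_const (f₁ t)
    simpa using! (h₀ τ).sub h3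
  have := (convex_uIcc t s).norm_image_sub_le_of_norm_hasDerivWithin_le
    (f := fun τ : ℝ => f₀ τ - τ * f₁ t) (f' := fun τ => f₁ τ - f₁ t)
    (fun x _ => (h2 x).hasDerivWithinAt) h1 left_mem_uIcc right_mem_uIcc
  calc ‖f₀ s - f₀ t - (s - t) * f₁ t‖ = ‖(f₀ s - s * f₁ t) - (f₀ t - t * f₁ t)‖ := by
        congr 1; ring
    _ ≤ B * |s - t| * ‖s - t‖ := this
    _ = _ := by rw [Real.norm_eq_abs]; ring

/-- The pointwise Taylor remainder is O(|s - t|²) uniformly in ξ, so the difference quotients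
converge even in operator norm. Bounds are asked only for times after ε, since at high frequencies
they degenerate at time 0. -/
lemma hasDerivAt_mulOp {m₀ m₁ m₂ : ℝ → R3 → ℂ} {ε B t : ℝ} (hεt : ε < t)
    (h₀ : ∀ t ξ, HasDerivAt (fun t => m₀ t ξ) (m₁ t ξ) t)
    (h₁ : ∀ t ξ, HasDerivAt (fun t => m₁ t ξ) (m₂ t ξ) t)
    (hb₀ : ∀ s, ε ≤ s → Bdd (m₀ s)) (hb₁ : ∀ s, ε ≤ s → Bdd (m₁ s))
    (hB : ∀ s, ε ≤ s → ∀ ξ, ‖m₂ s ξ‖ ≤ B) :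
    HasDerivAt (fun s => mulOp (m₀ s)) (mulOp (m₁ t)) t := by
  rw [hasDerivAt_iff_isLittleO]
  have hO : (fun s => mulOp (m₀ s) - mulOp (m₀ t) - (s - t) • mulOp (m₁ t)) =O[𝓝 t]
      fun s => ‖s - t‖ ^ 2 := by
    refine Asymptotics.IsBigO.of_bound B ?_
    filter_upwards [Ioi_mem_nhds hεt] with s hs
    have hB0 : 0 ≤ B := (norm_nonneg _).trans (hB t hεt.le 0)
    refine ContinuousLinearMap.opNorm_le_bound _ (by positivity) fun f => ?_
    refine norm_le_of_ae ?_
    have e : (mulOp (m₀ s) - mulOp (m₀ t) - (s - t) • mulOp (m₁ t)) f =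
        mulOp (m₀ s) f - mulOp (m₀ t) f - (s - t) • mulOp (m₁ t) f := rfl
    rw [e]
    filter_upwards [Lp.coeFn_sub (mulOp (m₀ s) f - mulOp (m₀ t) f) ((s - t) • mulOp (m₁ t) f),
      Lp.coeFn_sub (mulOp (m₀ s) f) (mulOp (m₀ t) f), Lp.coeFn_smul (s - t) (mulOp (m₁ t) f),
      coeFn_mulOp (hb₀ s (le_of_lt hs)) f, coeFn_mulOp (hb₀ t hεt.le) f,
      coeFn_mulOp (hb₁ t hεt.le) f] with ξ e1 e2 e3 e4 e5 e6
    rw [e1, Pi.sub_apply, e2, Pi.sub_apply, e3, Pi.smul_apply, e4, e5, e6]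
    have key := norm_sub_sub_le_of_hasDerivAt (fun t => h₀ t ξ) (fun t => h₁ t ξ)
      (fun τ hτ => hB τ hτ ξ) (le_of_lt hs) hεt.le
    have e7 : m₀ s ξ * f ξ - m₀ t ξ * f ξ - (s - t) • (m₁ t ξ * f ξ) =
        (m₀ s ξ - m₀ t ξ - (s - t) * m₁ t ξ) * f ξ := by
      rw [Complex.real_smul]; push_cast; ring
    rw [e7, norm_mul]
    refine mul_le_mul_of_nonneg_right (key.trans_eq ?_) (norm_nonneg _)
    simp
  exact hO.trans_isLittleO (Asymptotics.isLittleO_pow_sub_sub t one_lt_two)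

/-! ### Smooth curves -/

lemma iteratedDeriv_of_hasDerivAt {V : Type*} [NormedAddCommGroup V] [NormedSpace ℝ V]
    {f : ℕ → ℝ → V} (h : ∀ k t, 0 < t → HasDerivAt (f k) (f (k + 1) t) t) (m : ℕ) {t : ℝ}
    (ht : 0 < t) : iteratedDeriv m (f 0) t = f m t := by
  induction m generalizing t with
  | zero => simp
  | succ m ih =>
    rw [iteratedDeriv_succ]
    have : iteratedDeriv m (f 0) =ᶠ[𝓝 t] f m := by
      filter_upwards [Ioi_mem_nhds ht] with s hs using ih hs
    rw [this.deriv_eq, (h m t ht).deriv]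

lemma contDiffOn_of_hasDerivAt {V : Type*} [NormedAddCommGroup V] [NormedSpace ℝ V]
    {f : ℕ → ℝ → V} (h : ∀ k t, 0 < t → HasDerivAt (f k) (f (k + 1) t) t) :
    ContDiffOn ℝ ∞ (f 0) (Ioi 0) := by
  have : ∀ n k : ℕ, ContDiffOn ℝ n (f k) (Ioi 0) := by
    intro n
    induction n with
    | zero =>
      intro k
      exact contDiffOn_zero.2 fun t ht => (h k t ht).continuousAt.continuousWithinAt
    | succ n ih =>
      intro k
      push_cast
      rw [contDiffOn_succ_iff_deriv_of_isOpen isOpen_Ioi]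
      refine ⟨fun t ht => (h k t ht).differentiableAt.differentiableWithinAt, by simp, ?_⟩
      exact (ih (k + 1)).congr fun t ht => (h k t ht).deriv
  exact contDiffOn_infty.2 fun n => this n 0

/-! ### Symbol bounds -/

/-- Rescale to x = r √t. Then x^N ≤ 1 + x^(2N), and (c x²)^N ≤ N! exp(c x²) by the exponential
series. -/
lemma exists_pow_mul_exp_le {c : ℝ} (hc : 0 < c) (N : ℕ) : ∃ C : ℝ, 0 < C ∧ ∀ r t, 0 ≤ r → 0 < t →
    r ^ N * Real.exp (-(c * r ^ 2 * t)) ≤ C * t ^ (-(N : ℝ) / 2) := by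
  refine ⟨1 + N.factorial / c ^ N, by positivity, fun r t hr ht => ?_⟩
  set x := r * √t with hx
  have hs : 0 < √t := Real.sqrt_pos.2 ht
  have hx2 : x ^ 2 = r ^ 2 * t := by rw [hx, mul_pow, Real.sq_sqrt ht.le]
  have hx0 : 0 ≤ x := by positivity
  have hpow : t ^ (-(N : ℝ) / 2) = (√t ^ N)⁻¹ := by
    rw [neg_div, Real.rpow_neg ht.le, Real.sqrt_eq_rpow, ← Real.rpow_natCast (t ^ (1 / 2 : ℝ)),
      ← Real.rpow_mul ht.le]
    congr 2
    ring
  have h1 : x ^ N ≤ 1 + (x ^ 2) ^ N := by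
    rw [← pow_mul, mul_comm 2 N, pow_mul]
    nlinarith [sq_nonneg (x ^ N - 1), sq_nonneg (x ^ N)]
  have h2 : (c * x ^ 2) ^ N ≤ N.factorial * Real.exp (c * x ^ 2) := by
    have := Real.pow_div_factorial_le_exp (c * x ^ 2) (by positivity) N
    rw [div_le_iff₀ (by positivity)] at this
    linarith
  have h3 : x ^ N * Real.exp (-(c * x ^ 2)) ≤ 1 + N.factorial / c ^ N := by
    have h4 : x ^ N ≤ 1 + N.factorial / c ^ N * Real.exp (c * x ^ 2) := by
      refine h1.trans ?_
      have : (x ^ 2) ^ N ≤ N.factorial / c ^ N * Real.exp (c * x ^ 2) := by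
        rw [mul_pow] at h2
        rw [div_mul_eq_mul_div, le_div_iff₀ (by positivity)]
        linarith
      linarith
    have h5 : 1 ≤ Real.exp (c * x ^ 2) := Real.one_le_exp (by positivity)
    rw [Real.exp_neg, ← div_eq_mul_inv, div_le_iff₀ (Real.exp_pos _)]
    nlinarith
  calc r ^ N * Real.exp (-(c * r ^ 2 * t))
      = (x ^ N * Real.exp (-(c * x ^ 2))) * (√t ^ N)⁻¹ := by
        rw [hx2, hx, mul_pow, mul_assoc c]
        field_simp
    _ ≤ _ := by
        rw [hpow]
        gcongr

/-- The bounds of the symbol with threshold `R` and rate `c`. -/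
structure SymbolBounds (mu lam R c : ℝ) : Prop where
  one_le : 1 ≤ R
  pos : 0 < c
  low : ∀ m : ℕ, ∃ C : ℝ, 0 < C ∧ ∀ a b ξ t, rad ξ ≤ R → 0 ≤ t →
    ‖sym mu lam m t a b ξ‖ ≤ C * rad ξ ^ m * Real.exp (-(c * rad ξ ^ 2 * t))
  high : ∀ m : ℕ, ∃ C : ℝ, 0 < C ∧ ∀ a b ξ t, R ≤ rad ξ → 0 ≤ t →
    rad ξ ^ 2 * ‖sym mu lam m t a b ξ‖ ≤ C * (rad ξ ^ (2 - (vel a + vel b)) * Real.exp (-(c * t)) +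
      rad ξ ^ (2 * m + (vel a + vel b)) * Real.exp (-(c * rad ξ ^ 2 * t)))

/-- The threshold R is dictated by the two high frequency estimates; the low frequency estimates
hold below any prescribed R, at the cost of the rate. A common c is the least of the four rates. -/
lemma exists_symbolBounds {mu lam : ℝ} (hmu : 0 < mu) (hlam : 0 ≤ 2 * mu + 3 * lam) :
    ∃ R c, SymbolBounds mu lam R c := by
  -- From λ ≥ -2μ/3 one gets 2μ + λ ≥ 4μ/3.
  have hν : 0 < 2 * mu + lam := by linarith
  obtain ⟨R₁, c₁, hR₁, hc₁, h₁⟩ := exists_block_high hmu le_rfl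
  obtain ⟨R₂, c₂, hR₂, hc₂, h₂⟩ := exists_block_high hν one_le_two
  set R := max R₁ R₂
  have hR : 1 ≤ R := hR₁.trans (le_max_left _ _)
  obtain ⟨c₃, hc₃, h₃⟩ := exists_block_low hmu le_rfl hR
  obtain ⟨c₄, hc₄, h₄⟩ := exists_block_low hν one_le_two hR
  set c := min (min c₁ c₂) (min c₃ c₄) with hc
  have hcc₁ : c ≤ c₁ := (min_le_left _ _).trans (min_le_left _ _)
  have hcc₂ : c ≤ c₂ := (min_le_left _ _).trans (min_le_right _ _)
  have hcc₃ : c ≤ c₃ := (min_le_right _ _).trans (min_le_left _ _)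
  have hcc₄ : c ≤ c₄ := (min_le_right _ _).trans (min_le_right _ _)
  have hexp : ∀ {c' : ℝ}, c ≤ c' → ∀ {y : ℝ}, 0 ≤ y →
      Real.exp (-(c' * y)) ≤ Real.exp (-(c * y)) := fun h y hy =>
    Real.exp_le_exp.2 (neg_le_neg (mul_le_mul_of_nonneg_right h hy))
  have hexp2 : ∀ {c' : ℝ}, c ≤ c' → ∀ {r t : ℝ}, 0 ≤ t →
      Real.exp (-(c' * r ^ 2 * t)) ≤ Real.exp (-(c * r ^ 2 * t)) := fun h r t ht => by
    rw [mul_assoc, mul_assoc]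
    exact hexp h (by positivity)
  refine ⟨R, c, hR, by positivity, fun m => ?_, fun m => ?_⟩
  · obtain ⟨C₃, hC₃, h₃⟩ := h₃ m
    obtain ⟨C₄, hC₄, h₄⟩ := h₄ m
    refine ⟨2 * C₃ + 2 * C₄, by positivity, fun a b ξ t hξ ht => ?_⟩
    have hr := rad_nonneg ξ
    refine (norm_sym_le_of_abs_block_le (h₃ _ _ _ hr hξ ht) (h₄ _ _ _ hr hξ ht)).trans ?_
    have e3 : C₃ * rad ξ ^ m * Real.exp (-(c₃ * rad ξ ^ 2 * t)) ≤
        C₃ * rad ξ ^ m * Real.exp (-(c * rad ξ ^ 2 * t)) :=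
      mul_le_mul_of_nonneg_left (hexp2 hcc₃ ht) (by positivity)
    have e4 : C₄ * rad ξ ^ m * Real.exp (-(c₄ * rad ξ ^ 2 * t)) ≤
        C₄ * rad ξ ^ m * Real.exp (-(c * rad ξ ^ 2 * t)) :=
      mul_le_mul_of_nonneg_left (hexp2 hcc₄ ht) (by positivity)
    linarith
  · obtain ⟨C₁, hC₁, h₁⟩ := h₁ m
    obtain ⟨C₂, hC₂, h₂⟩ := h₂ m
    refine ⟨2 * C₁ + 2 * C₂, by positivity, fun a b ξ t hξ ht => ?_⟩
    have hr := rad_nonneg ξ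
    have hr0 : 0 < rad ξ := by linarith
    have hg : vel a + vel b ≤ 2 := by have := vel_le_one a; have := vel_le_one b; omega
    have e1 := h₁ _ hg _ _ ((le_max_left _ _).trans hξ) ht
    have e2 := h₂ _ hg _ _ ((le_max_right _ _).trans hξ) ht
    rw [mul_comm, ← le_div_iff₀ (by positivity)] at e1 e2
    have e := norm_sym_le_of_abs_block_le e1 e2
    rw [mul_comm, ← le_div_iff₀ (by positivity)]
    refine e.trans ?_
    rw [← mul_div_assoc, ← mul_div_assoc, ← add_div]
    gcongr ?_ / _
    have f1 := hexp hcc₁ ht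
    have f2 := hexp hcc₂ ht
    have f3 := hexp2 hcc₁ (r := rad ξ) ht
    have f4 := hexp2 hcc₂ (r := rad ξ) ht
    rw [add_mul, ← mul_assoc 2, ← mul_assoc 2]
    gcongr

/-! ### Frequency cutoffs and uniform bounds of the localized symbols -/

section Cutoff

variable {mu lam R c : ℝ}

/-- The cutoff to frequencies below `R`. -/
def lowCut (R : ℝ) (ξ : R3) : ℂ := if rad ξ < R then 1 else 0

/-- The cutoff to frequencies above `R`. -/
def highCut (R : ℝ) (ξ : R3) : ℂ := if rad ξ < R then 0 else 1

lemma bdd_lowCut (R : ℝ) : Bdd (lowCut R) :=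
  ⟨Measurable.ite (measurableSet_lt continuous_rad.measurable measurable_const)
    measurable_const measurable_const, 1, fun ξ => by unfold lowCut; split_ifs <;> simp⟩

lemma bdd_highCut (R : ℝ) : Bdd (highCut R) :=
  ⟨Measurable.ite (measurableSet_lt continuous_rad.measurable measurable_const)
    measurable_const measurable_const, 1, fun ξ => by unfold highCut; split_ifs <;> simp⟩

lemma bdd_one : Bdd (fun _ => 1) := ⟨measurable_const, 1, fun ξ => by simp⟩

lemma SymbolBounds.exists_norm_low_le (h : SymbolBounds mu lam R c) (m : ℕ) :
    ∃ B : ℝ, ∀ t, 0 ≤ t → ∀ a b ξ, ‖lowCut R ξ * sym mu lam m t a b ξ‖ ≤ B := by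
  obtain ⟨C, hC, hb⟩ := h.low m
  have hR0 : 0 < R := by linarith [h.one_le]
  refine ⟨C * R ^ m, fun t ht a b ξ => ?_⟩
  unfold lowCut
  split_ifs with hξ
  · rw [one_mul]
    refine (hb a b ξ t hξ.le ht).trans ?_
    have h0 := rad_nonneg ξ
    have h1 : Real.exp (-(c * rad ξ ^ 2 * t)) ≤ 1 := by
      apply Real.exp_le_one_iff.2
      have := h.pos
      simp only [Left.neg_nonpos_iff]
      positivity
    calc C * rad ξ ^ m * Real.exp (-(c * rad ξ ^ 2 * t)) ≤ C * R ^ m * 1 := by gcongr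
      _ = _ := mul_one _
  · rw [zero_mul, norm_zero]; positivity

/-- The parabolic mode carries powers of r that only the Gaussian at a positive time can absorb, so
the bound is uniform only on times after ε. -/
lemma SymbolBounds.exists_norm_high_le (h : SymbolBounds mu lam R c) (m : ℕ) {ε : ℝ} (hε : 0 < ε) :
    ∃ B : ℝ, ∀ t, ε ≤ t → ∀ a b ξ, ‖highCut R ξ * sym mu lam m t a b ξ‖ ≤ B := by
  obtain ⟨C, hC, hb⟩ := h.high m
  -- The largest exponent of the parabolic mode is 2m + 2, reached when both indices are velocity
  -- indices.
  obtain ⟨C', hC', hp⟩ := exists_pow_mul_exp_le h.pos (2 * m + 2)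
  refine ⟨C * (1 + C' * ε ^ (-((2 * m + 2 : ℕ) : ℝ) / 2)), fun t ht a b ξ => ?_⟩
  unfold highCut
  split_ifs with hξ
  · rw [zero_mul, norm_zero]; positivity
  · rw [one_mul]
    have hξ' := not_lt.1 hξ
    have h1 : 1 ≤ rad ξ := h.one_le.trans hξ'
    have h0 : 0 < rad ξ := by linarith
    have ht0 : 0 < t := hε.trans_le ht
    have hg : vel a + vel b ≤ 2 := by have := vel_le_one a; have := vel_le_one b; omega
    have e := hb a b ξ t hξ' ht0.le
    have hr2 : 1 ≤ rad ξ ^ 2 := one_le_pow₀ h1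
    have e1 : rad ξ ^ (2 - (vel a + vel b)) * Real.exp (-(c * t)) ≤ rad ξ ^ 2 * 1 := by
      gcongr
      · omega
      · apply Real.exp_le_one_iff.2
        have := h.pos
        simp only [Left.neg_nonpos_iff]
        positivity
    have e2 : rad ξ ^ (2 * m + (vel a + vel b)) * Real.exp (-(c * rad ξ ^ 2 * t)) ≤
        rad ξ ^ 2 * (C' * ε ^ (-((2 * m + 2 : ℕ) : ℝ) / 2)) := by
      calc rad ξ ^ (2 * m + (vel a + vel b)) * Real.exp (-(c * rad ξ ^ 2 * t))
          ≤ rad ξ ^ (2 * m + 2) * Real.exp (-(c * rad ξ ^ 2 * t)) := by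
            gcongr
        _ ≤ C' * t ^ (-((2 * m + 2 : ℕ) : ℝ) / 2) := hp _ _ h0.le ht0
        _ ≤ C' * ε ^ (-((2 * m + 2 : ℕ) : ℝ) / 2) := by
            refine mul_le_mul_of_nonneg_left ?_ hC'.le
            refine Real.rpow_le_rpow_of_nonpos hε ht ?_
            rw [neg_div]
            simp only [Left.neg_nonpos_iff]
            positivity
        _ ≤ _ := by
            refine le_mul_of_one_le_left (by positivity) hr2
    refine le_of_mul_le_mul_left (e.trans ?_) (by positivity : 0 < rad ξ ^ 2)
    calc _ ≤ C * (rad ξ ^ 2 * 1 + rad ξ ^ 2 * (C' * ε ^ (-((2 * m + 2 : ℕ) : ℝ) / 2))) := by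
          gcongr
      _ = _ := by ring

end Cutoff

/-! ### The Fourier transform at low frequencies -/

lemma mulOp_mulOp {m m' : R3 → ℂ} (h : Bdd m) (h' : Bdd m') (u : CL2) :
    mulOp m (mulOp m' u) = mulOp (fun ξ => m ξ * m' ξ) u := by
  ext1
  filter_upwards [coeFn_mulOp h (mulOp m' u), coeFn_mulOp h' u, coeFn_mulOp (h.mul h') u]
    with ξ h1 h2 h3
  rw [h1, h2, h3, mul_assoc]

lemma norm_mulOp_apply_le {m : R3 → ℂ} (h : Bdd m) {A : ℝ} {u : CL2}
    (hA : ∀ᵐ ξ, ‖m ξ * u ξ‖ ≤ A * ‖u ξ‖) : ‖mulOp m u‖ ≤ A * ‖u‖ := by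
  refine norm_le_of_ae ?_
  filter_upwards [coeFn_mulOp h u, hA] with ξ h1 h2
  rwa [h1]

/-- Hölder's inequality, with the norm of one factor interpolated between `L²` and `L^∞`. -/
lemma integrable_and_norm_integral_mul_le {q : ℝ≥0∞} [hqf : Fact (1 ≤ q)] (hq2 : q ≤ 2)
    (f : ScalarLp q) (g : CL2) {G S : ℝ} (hG0 : 0 ≤ G)
    (hG : eLpNorm g ∞ volume ≤ ENNReal.ofReal G) (hS : ‖g‖ ≤ S) :
    Integrable (fun x => (f x : ℂ) * g x) ∧
      ‖∫ x, (f x : ℂ) * g x‖ ≤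
        G ^ (2 / q.toReal - 1) * S ^ (2 - 2 / q.toReal) * ‖f‖ := by
  have hq1 := hqf.out
  have hqt : q ≠ ⊤ := ne_top_of_le_ne_top (by simp) hq2
  have hq0 : q ≠ 0 := (one_pos.trans_le hq1).ne'
  set r := q.toReal with hr
  have hr1 : 1 ≤ r := by
    rw [hr]; simpa using ENNReal.toReal_mono hqt hq1
  have hr2 : r ≤ 2 := by
    rw [hr]; simpa using ENNReal.toReal_mono (by simp) hq2
  have hr0 : 0 < r := by linarith
  have hS0 : 0 ≤ S := (norm_nonneg _).trans hS
  have hθ : 0 ≤ 2 / r - 1 := by rw [sub_nonneg, le_div_iff₀ hr0]; linarith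
  have hθ' : 0 ≤ 1 - 1 / r := by rw [sub_nonneg, div_le_iff₀ hr0]; linarith
  have hmeas : AEStronglyMeasurable (fun x => (f x : ℂ) * g x) volume :=
    (Complex.continuous_ofReal.comp_aestronglyMeasurable (Lp.aestronglyMeasurable f)).mul
      (Lp.aestronglyMeasurable g)
  have hbd : ∀ᵐ x, ‖g x‖ₑ ≤ ENNReal.ofReal G := by
    rw [eLpNorm_exponent_top] at hG
    filter_upwards [enorm_ae_le_eLpNormEssSup (g : R3 → ℂ) volume] with x hx using hx.trans hG
  have hgS : eLpNorm g 2 volume ≤ ENNReal.ofReal S := by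
    rw [← Lp.enorm_def, ← ofReal_norm]; exact ENNReal.ofReal_le_ofReal hS
  have key : ∫⁻ x, ‖(f x : ℂ) * g x‖ₑ ≤
      ENNReal.ofReal (G ^ (2 / r - 1) * S ^ (2 - 2 / r) * ‖f‖) := by
    calc ∫⁻ x, ‖(f x : ℂ) * g x‖ₑ
        ≤ ∫⁻ x, ENNReal.ofReal G ^ (2 / r - 1) *
            ((‖f x‖ₑ ^ r) ^ (1 / r) * (‖g x‖ₑ ^ (2 : ℝ)) ^ (1 - 1 / r)) := by
          refine lintegral_mono_ae ?_
          filter_upwards [hbd] with x hx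
          rw [enorm_mul, ← ENNReal.rpow_mul, mul_one_div_cancel hr0.ne', ENNReal.rpow_one,
            ← ENNReal.rpow_mul]
          have e1 : ‖(f x : ℂ)‖ₑ = ‖f x‖ₑ := by
            rw [← ofReal_norm, ← ofReal_norm, Complex.norm_real]
          -- The exponent 1 is split as (2/r - 1) + 2(1 - 1/r): the first power is estimated by the
          -- sup norm, the second goes into Hölder's inequality as an L² factor.
          have e2 : ‖g x‖ₑ = ‖g x‖ₑ ^ (2 / r - 1) * ‖g x‖ₑ ^ (2 * (1 - 1 / r)) := by
            rw [← ENNReal.rpow_add_of_nonneg _ _ hθ (by positivity)]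
            conv_lhs => rw [← ENNReal.rpow_one ‖g x‖ₑ]
            congr 1
            ring
          rw [e1]
          conv_lhs => rw [e2]
          calc ‖f x‖ₑ * (‖g x‖ₑ ^ (2 / r - 1) * ‖g x‖ₑ ^ (2 * (1 - 1 / r)))
              ≤ ‖f x‖ₑ * (ENNReal.ofReal G ^ (2 / r - 1) * ‖g x‖ₑ ^ (2 * (1 - 1 / r))) := by
                gcongr
            _ = _ := by ring
      _ = ENNReal.ofReal G ^ (2 / r - 1) *
            ∫⁻ x, (‖f x‖ₑ ^ r) ^ (1 / r) * (‖g x‖ₑ ^ (2 : ℝ)) ^ (1 - 1 / r) := by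
          rw [lintegral_const_mul' _ _ (ENNReal.rpow_ne_top_of_nonneg hθ ENNReal.ofReal_ne_top)]
      _ ≤ ENNReal.ofReal G ^ (2 / r - 1) * ((∫⁻ x, ‖f x‖ₑ ^ r) ^ (1 / r) *
            (∫⁻ x, ‖g x‖ₑ ^ (2 : ℝ)) ^ (1 - 1 / r)) := by
          gcongr
          exact ENNReal.lintegral_mul_norm_pow_le
            ((Lp.aestronglyMeasurable f).enorm.pow_const _)
            ((Lp.aestronglyMeasurable g).enorm.pow_const _) (by positivity) hθ' (by ring)
      _ = ENNReal.ofReal G ^ (2 / r - 1) * (eLpNorm f q volume *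
            eLpNorm g 2 volume ^ (2 - 2 / r)) := by
          rw [eLpNorm_eq_lintegral_rpow_enorm_toReal hq0 hqt,
            eLpNorm_eq_lintegral_rpow_enorm_toReal two_ne_zero ENNReal.ofNat_ne_top,
            ← ENNReal.rpow_mul, ENNReal.toReal_ofNat]
          congr 3
          ring
      _ ≤ ENNReal.ofReal G ^ (2 / r - 1) * (ENNReal.ofReal ‖f‖ *
            ENNReal.ofReal S ^ (2 - 2 / r)) := by
          have e : eLpNorm f q volume = ENNReal.ofReal ‖f‖ := by
            rw [Lp.norm_def, ENNReal.ofReal_toReal (Lp.eLpNorm_ne_top f)]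
          rw [e]
          have : 0 ≤ 2 - 2 / r := by
            have : 2 - 2 / r = 2 * (1 - 1 / r) := by ring
            rw [this]; positivity
          gcongr
      _ = _ := by
          have : 0 ≤ 2 - 2 / r := by
            have : 2 - 2 / r = 2 * (1 - 1 / r) := by ring
            rw [this]; positivity
          have hG1 := Real.rpow_nonneg hG0 (2 / r - 1)
          rw [ENNReal.ofReal_rpow_of_nonneg hG0 hθ, ENNReal.ofReal_rpow_of_nonneg hS0 this,
            ← ENNReal.ofReal_mul (norm_nonneg _), ← ENNReal.ofReal_mul hG1]
          congr 1
          ring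
  refine ⟨⟨hmeas, lt_of_le_of_lt key ENNReal.ofReal_lt_top⟩, ?_⟩
  have := enorm_integral_le_lintegral_enorm (μ := volume) (fun x => (f x : ℂ) * g x)
  rw [← ofReal_norm] at this
  have hG1 := Real.rpow_nonneg hG0 (2 / r - 1)
  have hS1 := Real.rpow_nonneg hS0 (2 - 2 / r)
  exact (ENNReal.ofReal_le_ofReal_iff
    (mul_nonneg (mul_nonneg hG1 hS1) (norm_nonneg _))).1 (this.trans key)

/-- Square integrable symbols map `L²` to functions with bounded inverse Fourier transform. -/
lemma eLpNorm_top_fourierInv_mulOp_le {m : R3 → ℂ} (hm : Bdd m) {B : ℝ}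
    (hB : eLpNorm m 2 volume ≤ ENNReal.ofReal B) (u : CL2) :
    eLpNorm (𝓕⁻ (mulOp m u) : CL2) ∞ volume ≤ ENNReal.ofReal (B * ‖u‖) := by
  refine (eLpNorm_top_fourierInv_le _).trans ?_
  rw [eLpNorm_congr_ae (coeFn_mulOp hm u)]
  have := eLpNorm_smul_le_mul_eLpNorm (p := 2) (q := 2) (r := 1) (Lp.aestronglyMeasurable u)
    hm.measurable.aestronglyMeasurable (μ := volume)
  refine this.trans ?_
  rw [ENNReal.ofReal_mul' (norm_nonneg _), ofReal_norm, Lp.enorm_def]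
  gcongr

lemma eLpNorm_lowCut_mul_lt_top (R : ℝ) {m : R3 → ℂ} (hm : Bdd m) :
    eLpNorm (fun ξ => lowCut R ξ * m ξ) 2 volume < ⊤ := by
  obtain ⟨A, hA⟩ := hm.bounded
  have hs : MeasurableSet {ξ | rad ξ < R} :=
    measurableSet_lt continuous_rad.measurable measurable_const
  have hfin : volume {ξ : R3 | rad ξ < R} ≠ ⊤ := by
    refine ne_top_of_le_ne_top (measure_ball_lt_top (x := (0 : R3)) (r := R)).ne
      (measure_mono fun ξ hξ => ?_)
    rw [mem_ball_zero_iff]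
    refine lt_of_le_of_lt ?_ hξ
    unfold rad
    have : 1 ≤ 2 * Real.pi := by linarith [Real.pi_gt_three]
    exact le_mul_of_one_le_left (norm_nonneg _) this
  have : MemLp ({ξ : R3 | rad ξ < R}.indicator fun _ => A) 2 volume :=
    memLp_indicator_const 2 hs A (Or.inr hfin)
  refine lt_of_le_of_lt (eLpNorm_mono fun ξ => ?_) this.2
  unfold lowCut
  by_cases h : rad ξ < R
  · rw [if_pos h, one_mul, indicator_of_mem (by exact h)]
    exact (hA ξ).trans (le_abs_self A)
  · rw [if_neg h, zero_mul, norm_zero]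
    positivity

lemma exists_eLpNorm_lowCut_le (R : ℝ) : ∃ B : ℝ, 0 ≤ B ∧ eLpNorm (lowCut R) 2 volume ≤ ENNReal.ofReal B := by
  have := eLpNorm_lowCut_mul_lt_top R bdd_one
  simp only [mul_one] at this
  exact ⟨_, ENNReal.toReal_nonneg, ENNReal.le_ofReal_iff_toReal_le this.ne ENNReal.toReal_nonneg
    |>.2 le_rfl⟩

lemma norm_fourierInv (u : CL2) : ‖(𝓕⁻ u : CL2)‖ = ‖u‖ := by
  rw [← Lp.norm_fourier_eq (𝓕⁻ u : CL2), fourier_fourierInv_eq]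

section LowFourier

variable (R : ℝ) {q : ℝ≥0∞} [hq1 : Fact (1 ≤ q)]

/-- The functional `u ↦ ∫ f · 𝓕⁻(1_{rad < R} u)` is well defined and bounded. -/
lemma integrable_and_norm_integral_lowCut_le (hq2 : q ≤ 2) {B : ℝ}
    (hB : eLpNorm (lowCut R) 2 volume ≤ ENNReal.ofReal B) (hB0 : 0 ≤ B) (f : ScalarLp q)
    (u : CL2) :
    Integrable (fun x => (f x : ℂ) * (𝓕⁻ (mulOp (lowCut R) u) : CL2) x) ∧
      ‖∫ x, (f x : ℂ) * (𝓕⁻ (mulOp (lowCut R) u) : CL2) x‖ ≤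
        (B + 1) * ‖f‖ * ‖u‖ := by
  have h1 : ‖mulOp (lowCut R) u‖ ≤ 1 * ‖u‖ := by
    refine norm_mulOp_apply_le (bdd_lowCut R) (Eventually.of_forall fun ξ => ?_)
    rw [norm_mul]
    gcongr
    unfold lowCut; split_ifs <;> simp
  rw [one_mul] at h1
  -- The sup norm is bounded by B‖u‖ and the L² norm by ‖u‖; the common bound (B + 1)‖u‖ makes the
  -- interpolation exponents add up to 1.
  have hG : eLpNorm (𝓕⁻ (mulOp (lowCut R) u) : CL2) ∞ volume ≤
      ENNReal.ofReal ((B + 1) * ‖u‖) :=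
    (eLpNorm_top_fourierInv_mulOp_le (bdd_lowCut R) hB u).trans
      (ENNReal.ofReal_le_ofReal (by nlinarith [norm_nonneg u]))
  have h2 : ‖(𝓕⁻ (mulOp (lowCut R) u) : CL2)‖ ≤ (B + 1) * ‖u‖ := by
    rw [norm_fourierInv]
    exact h1.trans (le_mul_of_one_le_left (norm_nonneg _) (by linarith))
  obtain ⟨i1, i2⟩ := integrable_and_norm_integral_mul_le hq2 f _ (by positivity) hG h2
  refine ⟨i1, i2.trans (le_of_eq ?_)⟩
  have h0 : 0 ≤ (B + 1) * ‖u‖ := by positivity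
  rw [← Real.rpow_add' h0 (by ring_nf; norm_num),
    show 2 / q.toReal - 1 + (2 - 2 / q.toReal) = 1 by ring, Real.rpow_one]
  ring

/-- The functional is bounded on L², so Riesz representation yields the Fourier transform of `f`
below R as an L² function. -/
lemma exists_lowFourier (hq2 : q ≤ 2) : ∃ A : ScalarLp q →L[ℝ] CL2, ∀ f u,
    inner ℂ (A f) u = ∫ x, (f x : ℂ) * (𝓕⁻ (mulOp (lowCut R) u) : CL2) x := by
  obtain ⟨B, hB0, hB⟩ := exists_eLpNorm_lowCut_le R
  have hint := fun f u => (integrable_and_norm_integral_lowCut_le R hq2 hB hB0 f u).1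
  let L : ScalarLp q → CL2 →L[ℂ] ℂ := fun f => LinearMap.mkContinuous
    { toFun := fun u => ∫ x, (f x : ℂ) * (𝓕⁻ (mulOp (lowCut R) u) : CL2) x
      map_add' := fun u v => by
        rw [← integral_add (hint f u) (hint f v)]
        refine integral_congr_ae ?_
        have e : (𝓕⁻ (mulOp (lowCut R) (u + v)) : CL2) =
            (𝓕⁻ (mulOp (lowCut R) u) : CL2) + (𝓕⁻ (mulOp (lowCut R) v) : CL2) := by
          rw [map_add, fourierInv_add]
        rw [e]
        filter_upwards [Lp.coeFn_add (𝓕⁻ (mulOp (lowCut R) u) : CL2)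
          (𝓕⁻ (mulOp (lowCut R) v) : CL2)] with x hx
        rw [hx, Pi.add_apply, mul_add]
      map_smul' := fun c u => by
        rw [RingHom.id_apply, smul_eq_mul, ← integral_const_mul]
        refine integral_congr_ae ?_
        have e : (𝓕⁻ (mulOp (lowCut R) (c • u)) : CL2) =
            c • (𝓕⁻ (mulOp (lowCut R) u) : CL2) := by
          rw [map_smul, fourierInv_smul]
        rw [e]
        filter_upwards [Lp.coeFn_smul c (𝓕⁻ (mulOp (lowCut R) u) : CL2)] with x hx
        rw [hx, Pi.smul_apply, smul_eq_mul]
        ring }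
    ((B + 1) * ‖f‖) fun u => (integrable_and_norm_integral_lowCut_le R hq2 hB hB0 f u).2
  have hL : ∀ f u, inner ℂ ((InnerProductSpace.toDual ℂ CL2).symm (L f)) u =
      ∫ x, (f x : ℂ) * (𝓕⁻ (mulOp (lowCut R) u) : CL2) x := fun f u => by
    rw [InnerProductSpace.toDual_symm_apply]; rfl
  refine ⟨LinearMap.mkContinuous
    { toFun := fun f => (InnerProductSpace.toDual ℂ CL2).symm (L f)
      map_add' := fun f g => ?_
      map_smul' := fun c f => ?_ } (B + 1) fun f => ?_, hL⟩
  · refine ext_inner_right ℂ fun u => ?_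
    rw [inner_add_left, hL, hL, hL, ← integral_add (hint f u) (hint g u)]
    refine integral_congr_ae ?_
    filter_upwards [Lp.coeFn_add f g] with x hx
    rw [hx, Pi.add_apply]
    push_cast
    ring
  · refine ext_inner_right ℂ fun u => ?_
    rw [RingHom.id_apply, inner_smul_left_eq_smul, hL, hL, Complex.real_smul, ← integral_const_mul]
    refine integral_congr_ae ?_
    filter_upwards [Lp.coeFn_smul c f] with x hx
    rw [hx, Pi.smul_apply]
    simp [mul_assoc]
  · change ‖(InnerProductSpace.toDual ℂ CL2).symm (L f)‖ ≤ _
    rw [LinearIsometryEquiv.norm_map]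
    exact LinearMap.mkContinuous_norm_le _ (by positivity) _

open Classical in
/-- The Fourier transform of a function in `L^q`, `1 ≤ q ≤ 2`, at low frequencies. -/
def lowFourier (q : ℝ≥0∞) [Fact (1 ≤ q)] : ScalarLp q →L[ℝ] CL2 :=
  if h : q ≤ 2 then (exists_lowFourier R h).choose else 0

variable {R}

lemma inner_lowFourier (hq2 : q ≤ 2) (f : ScalarLp q) (u : CL2) :
    inner ℂ (lowFourier R q f) u =
      ∫ x, (f x : ℂ) * (𝓕⁻ (mulOp (lowCut R) u) : CL2) x := by
  rw [lowFourier, dif_pos hq2]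
  exact (exists_lowFourier R hq2).choose_spec f u

/-- The defining integral does not mention the exponent. This is the consistency of the low
frequency operators on different L^q. -/
lemma lowFourier_congr (hq2 : q ≤ 2) {r : ℝ≥0∞} [Fact (1 ≤ r)] (hr2 : r ≤ 2) {f : ScalarLp q}
    {g : ScalarLp r} (h : f =ᵐ[volume] g) : lowFourier R q f = lowFourier R r g := by
  refine ext_inner_right ℂ fun u => ?_
  rw [inner_lowFourier hq2, inner_lowFourier hr2]
  exact integral_congr_ae (h.mono fun x hx => by simp only [hx])

lemma conj_lowCut (ξ : R3) : (starRingEnd ℂ) (lowCut R ξ) = lowCut R ξ := by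
  unfold lowCut; split_ifs <;> simp

lemma lowCut_mul_self (ξ : R3) : lowCut R ξ * lowCut R ξ = lowCut R ξ := by
  unfold lowCut; split_ifs <;> simp

lemma lowFourier_two (f : ScalarLp 2) :
    lowFourier R 2 f = mulOp (lowCut R) (𝓕 (cplx 2 f) : CL2) := by
  refine ext_inner_right ℂ fun u => ?_
  rw [inner_mulOp_left (bdd_lowCut R), inner_lowFourier le_rfl]
  simp only [conj_lowCut]
  rw [show inner ℂ (𝓕 (cplx 2 f) : CL2) (mulOp (lowCut R) u) =
    inner ℂ (cplx 2 f) (𝓕⁻ (mulOp (lowCut R) u) : CL2) by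
      rw [← Lp.inner_fourier_eq (cplx 2 f), fourier_fourierInv_eq], inner_CL2]
  refine integral_congr_ae ?_
  filter_upwards [coeFn_cplx f] with x hx
  rw [hx, Complex.conj_ofReal]

lemma represents_lowFourier (hq2 : q ≤ 2) (f : ScalarLp q) :
    Represents {ξ | rad ξ < R} f (lowFourier R q f) := by
  intro η hη
  have e1 : mulOp (lowCut R) (η.toLp 2) = η.toLp 2 := by
    ext1
    filter_upwards [coeFn_mulOp (bdd_lowCut R) (η.toLp 2), η.coeFn_toLp 2] with ξ h1 h2
    rw [h1, h2]
    unfold lowCut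
    split_ifs with h
    · rw [one_mul]
    · rw [zero_mul]
      exact (image_eq_zero_of_notMem_tsupport fun h' => h (hη h')).symm
  have e2 : (𝓕⁻ (η.toLp 2 : CL2) : CL2) = (𝓕⁻ η : 𝓢(R3, ℂ)).toLp 2 := by
    rw [SchwartzMap.toLp_fourierInv_eq]
  rw [inner_lowFourier hq2, e1, e2]
  refine integral_congr_ae ?_
  filter_upwards [(𝓕⁻ η : 𝓢(R3, ℂ)).coeFn_toLp 2] with x hx
  rw [hx, mul_comm]

/-- A Hausdorff–Young type estimate. -/
lemma norm_mulOp_lowFourier_le (hq2 : q ≤ 2) {m : R3 → ℂ} (hm : Bdd m) {A B : ℝ}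
    (hA : ∀ ξ, ‖lowCut R ξ * m ξ‖ ≤ A) (hB0 : 0 ≤ B)
    (hB : eLpNorm (fun ξ => lowCut R ξ * m ξ) 2 volume ≤ ENNReal.ofReal B) (f : ScalarLp q) :
    ‖mulOp m (lowFourier R q f)‖ ≤
      B ^ (2 / q.toReal - 1) * A ^ (2 - 2 / q.toReal) * ‖f‖ := by
  have hA0 : 0 ≤ A := (norm_nonneg _).trans (hA 0)
  set w := mulOp m (lowFourier R q f) with hw
  have hlm : Bdd (fun ξ => lowCut R ξ * (starRingEnd ℂ) (m ξ)) := (bdd_lowCut R).mul hm.conj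
  have hnorm : ∀ ξ, ‖lowCut R ξ * (starRingEnd ℂ) (m ξ)‖ = ‖lowCut R ξ * m ξ‖ := fun ξ => by
    simp
  -- Duality with w itself: ‖w‖² is an integral of f against a band-limited function built from w,
  -- which is bounded by the interpolated Hölder inequality; then divide by ‖w‖.
  have e1 : inner ℂ w w = ∫ x, (f x : ℂ) *
      (𝓕⁻ (mulOp (fun ξ => lowCut R ξ * (starRingEnd ℂ) (m ξ)) w) : CL2) x := by
    conv_lhs => rw [hw]
    rw [inner_mulOp_left hm, inner_lowFourier hq2, mulOp_mulOp (bdd_lowCut R) hm.conj]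
  have h2 : ‖mulOp (fun ξ => lowCut R ξ * (starRingEnd ℂ) (m ξ)) w‖ ≤ A * ‖w‖ := by
    refine norm_mulOp_apply_le hlm (Eventually.of_forall fun ξ => ?_)
    rw [norm_mul, hnorm]
    gcongr
    exact hA ξ
  have h3 := eLpNorm_top_fourierInv_mulOp_le hlm
    (by rwa [eLpNorm_congr_norm_ae (Eventually.of_forall hnorm)]) w
  obtain ⟨-, h4⟩ := integrable_and_norm_integral_mul_le hq2 f _ (by positivity) h3
    ((norm_fourierInv _).le.trans h2)
  rw [← e1, inner_self_eq_norm_sq_to_K] at h4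
  rcases (norm_nonneg w).eq_or_lt with h0 | h0
  · rw [← h0]; positivity
  · rw [Real.mul_rpow hB0 h0.le, Real.mul_rpow hA0 h0.le] at h4
    have e5 : ‖w‖ ^ (2 / q.toReal - 1) * ‖w‖ ^ (2 - 2 / q.toReal) = ‖w‖ := by
      rw [← Real.rpow_add h0, show 2 / q.toReal - 1 + (2 - 2 / q.toReal) = 1 by ring,
        Real.rpow_one]
    have e6 : ‖((‖w‖ : ℂ)) ^ 2‖ = ‖w‖ * ‖w‖ := by simp [sq]
    refine le_of_mul_le_mul_right ?_ h0
    calc ‖w‖ * ‖w‖ = _ := e6.symm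
      _ ≤ _ := h4
      _ = B ^ (2 / q.toReal - 1) * A ^ (2 - 2 / q.toReal) * ‖f‖ *
          (‖w‖ ^ (2 / q.toReal - 1) * ‖w‖ ^ (2 - 2 / q.toReal)) := by ring
      _ = _ := by rw [e5]

end LowFourier

/-! ### Components of triples -/

/-- The scalar components of a triple. -/
def comp {p : ℝ≥0∞} (U : Triple p) : Idx → ScalarLp p
  | .inl _ => U.1
  | .inr (.inl i) => U.2.1 i
  | .inr (.inr (i, j)) => U.2.2 i j

lemma compSum_eq {p : ℝ≥0∞} (N : (R3 → ℝ) → ℝ≥0∞) (U : Triple p) :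
    compSum N U = ∑ a, N (comp U a) := by
  simp [compSum, comp, Fintype.sum_sum_type, Fintype.sum_prod_type, add_assoc]

lemma continuous_comp {p : ℝ≥0∞} [Fact (1 ≤ p)] (a : Idx) :
    Continuous (fun U : Triple p => comp U a) := by
  rcases a with _ | i | ⟨i, j⟩ <;> simp only [comp] <;> fun_prop

/-- The component of a triple, as a bounded operator. -/
def compCLM (p : ℝ≥0∞) [Fact (1 ≤ p)] (a : Idx) : Triple p →L[ℝ] ScalarLp p where
  toFun U := comp U a
  map_add' U V := by rcases a with _ | i | ⟨i, j⟩ <;> rfl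
  map_smul' c U := by rcases a with _ | i | ⟨i, j⟩ <;> rfl
  cont := continuous_comp a

/-- The triple with given components. -/
def ofComp : (Idx → ScalarLp 2) →L[ℝ] Triple 2 where
  toFun V := (V (.inl ()), fun i => V (.inr (.inl i)), fun i j => V (.inr (.inr (i, j))))
  map_add' _ _ := rfl
  map_smul' _ _ := rfl
  cont := by fun_prop

lemma comp_ofComp (V : Idx → ScalarLp 2) (a : Idx) : comp (ofComp V) a = V a := by
  rcases a with _ | i | ⟨i, j⟩ <;> rfl

lemma comp_injective {p : ℝ≥0∞} {U V : Triple p} (h : ∀ a, comp U a = comp V a) : U = V :=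
  Prod.ext (h (.inl ())) (Prod.ext (funext fun i => h (.inr (.inl i)))
    (funext fun i => funext fun j => h (.inr (.inr (i, j)))))

/-! ### Operators given by matrices of symbols -/

/-- The operator given by a matrix of symbols. -/
def matOp (M : Idx → Idx → R3 → ℂ) : (Idx → CL2) →L[ℂ] (Idx → CL2) :=
  ContinuousLinearMap.pi fun a => ∑ b, (mulOp (M a b)).comp (ContinuousLinearMap.proj b)

lemma matOp_apply (M : Idx → Idx → R3 → ℂ) (u : Idx → CL2) (a : Idx) :
    matOp M u a = ∑ b, mulOp (M a b) (u b) := by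
  simp [matOp]

lemma coeFn_matOp {M : Idx → Idx → R3 → ℂ} (hM : ∀ a b, Bdd (M a b)) (u : Idx → CL2) (a : Idx) :
    matOp M u a =ᵐ[volume] fun ξ => ∑ b, M a b ξ * u b ξ := by
  rw [matOp_apply]
  have h1 : ∀ᵐ ξ, ∀ b, mulOp (M a b) (u b) ξ = M a b ξ * u b ξ :=
    ae_all_iff.2 fun b => coeFn_mulOp (hM a b) (u b)
  have h2 := Lp.coeFn_finsetSum (Finset.univ : Finset Idx) fun b => mulOp (M a b) (u b)
  filter_upwards [h1, h2] with ξ h1 h2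
  rw [h2]
  simp only [Finset.sum_apply]
  exact Finset.sum_congr rfl fun b _ => h1 b

lemma hasDerivAt_matOp {m₀ m₁ m₂ : ℝ → Idx → Idx → R3 → ℂ} {ε B t : ℝ} (hεt : ε < t)
    (h₀ : ∀ t a b ξ, HasDerivAt (fun t => m₀ t a b ξ) (m₁ t a b ξ) t)
    (h₁ : ∀ t a b ξ, HasDerivAt (fun t => m₁ t a b ξ) (m₂ t a b ξ) t)
    (hb₀ : ∀ s, ε ≤ s → ∀ a b, Bdd (m₀ s a b)) (hb₁ : ∀ s, ε ≤ s → ∀ a b, Bdd (m₁ s a b))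
    (hB : ∀ s, ε ≤ s → ∀ a b ξ, ‖m₂ s a b ξ‖ ≤ B) (u : Idx → CL2) :
    HasDerivAt (fun s => matOp (m₀ s) u) (matOp (m₁ t) u) t := by
  rw [hasDerivAt_pi]
  intro a
  simp only [matOp_apply]
  refine HasDerivAt.fun_sum fun b _ => ?_
  have := (hasDerivAt_mulOp hεt (fun t => h₀ t a b) (fun t => h₁ t a b)
    (fun s hs => hb₀ s hs a b) (fun s hs => hb₁ s hs a b) (fun s hs => hB s hs a b))
  exact ((ContinuousLinearMap.apply ℝ CL2 (u b)).comp
    (ContinuousLinearMap.restrictScalarsL ℂ CL2 CL2 ℝ ℝ)).hasFDerivAt.comp_hasDerivAt t this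

/-! ### The solution operators -/

/-- The inverse Fourier transform as a real linear operator. -/
def fourierInvReal : CL2 →L[ℝ] CL2 :=
  ((Lp.fourierTransformₗᵢ R3 ℂ).symm.toContinuousLinearEquiv.toContinuousLinearMap).restrictScalars ℝ

/-- The transform back from the frequency side. -/
def synthesis : (Idx → CL2) →L[ℝ] Triple 2 :=
  ofComp.comp (ContinuousLinearMap.pi fun a =>
    (realPart.comp fourierInvReal).comp (ContinuousLinearMap.proj a))

lemma comp_synthesis (w : Idx → CL2) (a : Idx) :
    comp (synthesis w) a = realPart (𝓕⁻ (w a) : CL2) := by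
  rw [synthesis, ContinuousLinearMap.comp_apply, comp_ofComp]
  rfl

/-- The componentwise Fourier transform of a triple. -/
def analysis : Triple 2 →L[ℝ] (Idx → CL2) :=
  ContinuousLinearMap.pi fun a => (((Lp.fourierTransformₗᵢ R3 ℂ).toContinuousLinearEquiv
    |>.toContinuousLinearMap.restrictScalars ℝ).comp (cplx 2)).comp (compCLM 2 a)

lemma analysis_apply (F : Triple 2) (a : Idx) : analysis F a = (𝓕 (cplx 2 (comp F a)) : CL2) := rfl

/-- The componentwise Fourier transform of a triple in `L^q` at low frequencies. -/
def lowAnalysis (R : ℝ) (q : ℝ≥0∞) [Fact (1 ≤ q)] : Triple q →L[ℝ] (Idx → CL2) :=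
  ContinuousLinearMap.pi fun a => (lowFourier R q).comp (compCLM q a)

lemma lowAnalysis_apply (R : ℝ) {q : ℝ≥0∞} [Fact (1 ≤ q)] (F : Triple q) (a : Idx) :
    lowAnalysis R q F a = lowFourier R q (comp F a) := rfl

open Classical in
/-- The symbol of the solution operator on general data, which need not be admissible. -/
def propag (mu lam t : ℝ) (a b : Idx) (ξ : R3) : ℂ :=
  ∑ c, sym mu lam 0 t a c ξ * coefP c b ξ + ((if a = b then 1 else 0) - coefP a b ξ)

lemma sum_propag (mu lam t : ℝ) (a : Idx) (ξ : R3) (x : Idx → ℂ) :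
    ∑ b, propag mu lam t a b ξ * x b =
      ∑ c, sym mu lam 0 t a c ξ * ∑ b, coefP c b ξ * x b + (x a - ∑ b, coefP a b ξ * x b) := by
  simp only [propag, add_mul, sub_mul, Finset.sum_add_distrib, Finset.sum_sub_distrib, ite_mul,
    one_mul, zero_mul, Finset.sum_ite_eq, Finset.mem_univ, if_true, Finset.sum_mul, Finset.mul_sum]
  rw [Finset.sum_comm]
  simp only [mul_assoc]

lemma Adm.sum_propag {mu lam t : ℝ} {ξ : R3} (hξ : ξ ≠ 0) {x : Idx → ℂ} (h : Adm ξ x) (a : Idx) :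
    ∑ b, propag mu lam t a b ξ * x b = ∑ b, sym mu lam 0 t a b ξ * x b := by
  rw [Viscoelastic.sum_propag]
  simp only [h.coefP_eq hξ]
  ring

/-- The constant is 13 · (4 · 2) from the product of the symbol with the projection, plus 1 + 2 from
the static part. -/
lemma norm_propag_le {mu lam : ℝ} (hmu : 0 < mu) (hlam : 0 ≤ 2 * mu + 3 * lam) {t : ℝ}
    (ht : 0 ≤ t) (a b : Idx) (ξ : R3) : ‖propag mu lam t a b ξ‖ ≤ 107 := by
  have h1 : ‖∑ c, sym mu lam 0 t a c ξ * coefP c b ξ‖ ≤ ∑ _c : Idx, (4 * 2 : ℝ) := by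
    refine norm_sum_le_of_le _ fun c _ => ?_
    rw [norm_mul]
    exact mul_le_mul (norm_sym_zero_le hmu hlam ht a c ξ) (norm_coefP_le _ _ _) (norm_nonneg _)
      (by norm_num)
  have h2 : ‖(if a = b then 1 else 0) - coefP a b ξ‖ ≤ 1 + 2 := by
    refine (norm_sub_le _ _).trans (add_le_add ?_ (norm_coefP_le _ _ _))
    split_ifs <;> simp
  refine (norm_add_le _ _).trans ((add_le_add h1 h2).trans (le_of_eq ?_))
  simp
  norm_num

lemma measurable_propag (mu lam t : ℝ) (a b : Idx) : Measurable (propag mu lam t a b) := by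
  have h1 := measurable_sym mu lam 0 t
  have h2 := measurable_coefP
  unfold propag
  fun_prop

lemma bdd_propag {mu lam : ℝ} (hmu : 0 < mu) (hlam : 0 ≤ 2 * mu + 3 * lam) {t : ℝ}
    (ht : 0 ≤ t) (a b : Idx) : Bdd (propag mu lam t a b) :=
  ⟨measurable_propag mu lam t a b, 107, norm_propag_le hmu hlam ht a b⟩

/-- The solution operator on the frequency side, localized by the cutoff `κ`. -/
def evolve (mu lam : ℝ) (κ : R3 → ℂ) (t : ℝ) : (Idx → CL2) →L[ℂ] (Idx → CL2) :=
  matOp fun a b ξ => κ ξ * propag mu lam t a b ξ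

/-- Time derivatives of the solution operator on admissible data on the frequency side. -/
def evolveAdm (mu lam : ℝ) (κ : R3 → ℂ) (m : ℕ) (t : ℝ) : (Idx → CL2) →L[ℂ] (Idx → CL2) :=
  matOp fun a b ξ => κ ξ * sym mu lam m t a b ξ

/-- The solution operator. -/
def solOp (mu lam t : ℝ) : Triple 2 →L[ℝ] Triple 2 :=
  synthesis.comp (((evolve mu lam (fun _ => 1) t).restrictScalars ℝ).comp analysis)

/-- The low frequency part of the solution operator. -/
def lowOp (mu lam R t : ℝ) (q : ℝ≥0∞) [Fact (1 ≤ q)] : Triple q →L[ℝ] Triple 2 :=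
  synthesis.comp (((evolve mu lam (lowCut R) t).restrictScalars ℝ).comp (lowAnalysis R q))

/-- The high frequency part of the solution operator. -/
def highOp (mu lam R t : ℝ) : Triple 2 →L[ℝ] Triple 2 :=
  synthesis.comp (((evolve mu lam (highCut R) t).restrictScalars ℝ).comp analysis)

lemma ae_ne_zero : ∀ᵐ ξ : R3, ξ ≠ 0 := by
  have : (volume : Measure R3) {0} = 0 := by simp
  exact compl_mem_ae_iff.2 this

section Operators

variable {mu lam : ℝ} (hmu : 0 < mu) (hlam : 0 ≤ 2 * mu + 3 * lam)

include hmu hlam in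
lemma coeFn_evolve {κ : R3 → ℂ} (hκ : Bdd κ) {t : ℝ}
    (ht : 0 ≤ t) (u : Idx → CL2) (a : Idx) : evolve mu lam κ t u a =ᵐ[volume]
      fun ξ => κ ξ * ∑ b, propag mu lam t a b ξ * u b ξ := by
  filter_upwards [coeFn_matOp (fun a b => hκ.mul (bdd_propag hmu hlam ht a b)) u a] with ξ hξ
  rw [evolve, hξ, Finset.mul_sum]
  exact Finset.sum_congr rfl fun b _ => mul_assoc _ _ _

include hmu hlam in
-- The projection acts as the identity on admissible vectors. Admissibility is asked only on the
-- support of the cutoff, because for L^q data the transform is known only below R.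
lemma evolve_eq_evolveAdm {κ : R3 → ℂ} (hκ : Bdd κ) {t : ℝ} (ht : 0 ≤ t) {u : Idx → CL2}
    (hu : ∀ᵐ ξ, κ ξ ≠ 0 → Adm ξ (fun b => u b ξ)) :
    evolve mu lam κ t u = evolveAdm mu lam κ 0 t u := by
  have hs : ∀ a b, Bdd (sym mu lam 0 t a b) := fun a b =>
    ⟨measurable_sym mu lam 0 t a b, 4, norm_sym_zero_le hmu hlam ht a b⟩
  funext a
  ext1
  filter_upwards [coeFn_evolve hmu hlam hκ ht u a,
    coeFn_matOp (fun a b => hκ.mul (hs a b)) u a, hu, ae_ne_zero] with ξ h1 h2 h3 h0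
  rw [h1, evolveAdm, h2]
  simp only [mul_assoc]
  rw [← Finset.mul_sum]
  by_cases h : κ ξ = 0
  · simp [h]
  · rw [(h3 h).sum_propag h0]

include hmu hlam in
lemma solOp_eq_add (R : ℝ) {t : ℝ} (ht : 0 ≤ t) (F : Triple 2) :
    solOp mu lam t F = lowOp mu lam R t 2 F + highOp mu lam R t F := by
  simp only [solOp, lowOp, highOp, ContinuousLinearMap.comp_apply]
  rw [← map_add]
  congr 1
  funext a
  ext1
  have h4 : ∀ᵐ ξ, ∀ b, lowAnalysis R 2 F b ξ = lowCut R ξ * analysis F b ξ :=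
    ae_all_iff.2 fun b => by
      rw [lowAnalysis_apply, lowFourier_two]
      exact coeFn_mulOp (bdd_lowCut R) _
  filter_upwards [coeFn_evolve hmu hlam bdd_one ht (analysis F) a,
    coeFn_evolve hmu hlam (bdd_lowCut R) ht (lowAnalysis R 2 F) a,
    coeFn_evolve hmu hlam (bdd_highCut R) ht (analysis F) a,
    Lp.coeFn_add (evolve mu lam (lowCut R) t (lowAnalysis R 2 F) a)
      (evolve mu lam (highCut R) t (analysis F) a), h4] with ξ h1 h2 h3 h5 h4
  simp only [ContinuousLinearMap.coe_restrictScalars', Pi.add_apply] at *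
  rw [h1, h5, h2, h3]
  simp only [h4]
  unfold lowCut highCut
  split_ifs <;> simp

end Operators

lemma lowOp_congr {mu lam R t : ℝ} {q r : ℝ≥0∞} [Fact (1 ≤ q)] [Fact (1 ≤ r)] (hq : q ≤ 2)
    (hr : r ≤ 2) {F : Triple q} {G : Triple r} (h : SameTriple F G) :
    lowOp mu lam R t q F = lowOp mu lam R t r G := by
  have : lowAnalysis R q F = lowAnalysis R r G := by
    funext a
    refine lowFourier_congr hq hr ?_
    rcases a with _ | i | ⟨i, j⟩
    exacts [h.1, h.2.1 i, h.2.2 i j]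
  simp only [lowOp, ContinuousLinearMap.comp_apply, this]

/-! ### The constraints on the frequency side -/

/-- Both constraints are linear differential relations, so `Represents.sum_symbol_eq_zero` makes
them pointwise identities for the conjugate transforms. Dividing by the factor i and by the length
of the frequency leaves relations in the direction alone. -/
lemma adm_of_constrained {Ω : Set R3} (hΩ : IsOpen Ω) {q : ℝ≥0∞} [Fact (1 ≤ q)] {F : Triple q}
    (hF : Constrained F) {a : Idx → CL2} (ha : ∀ b, Represents Ω (comp F b) (a b)) :
    ∀ᵐ ξ, ξ ∈ Ω → Adm ξ (fun b => a b ξ) := by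
  have hconj : ∀ {z : ℂ}, (starRingEnd ℂ) z = 0 → z = 0 := fun {z} h => by simpa using h
  have h1 : ∀ k, ∀ᵐ ξ, ξ ∈ Ω → (freq k ξ : ℂ) * a (.inl ()) ξ +
      ∑ j, freq j ξ * a (.inr (.inr (j, k))) ξ = 0 := by
    intro k
    have := Represents.sum_symbol_eq_zero hΩ (ι := Option (Fin 3))
      (f := fun c => c.elim F.1 fun j => F.2.2 j k)
      (a := fun c => c.elim (a (.inl ())) fun j => a (.inr (.inr (j, k))))
      (fun c => by cases c; exacts [ha (.inl ()), ha (.inr (.inr (_, k)))])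
      (D := fun c => c.elim (pderiv k) fun j => pderiv j)
      (p := fun c => c.elim (fun ξ => Complex.I * freq k ξ) fun j ξ => Complex.I * freq j ξ)
      (fun c => by cases c; exacts [isSymbol_pderiv k, isSymbol_pderiv _]) (fun _ => 1)
      (fun φ hφ => by simpa [Fintype.sum_option] using hF.1 φ hφ k)
    filter_upwards [this] with ξ h hξ
    have h := h hξ
    simp only [Fintype.sum_option, Option.elim_none, Option.elim_some, Complex.ofReal_one,
      one_mul, mul_assoc, ← Finset.mul_sum, ← mul_add] at h
    have h := (mul_eq_zero.1 h).resolve_left Complex.I_ne_zero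
    refine hconj ?_
    rw [← h]
    simp
  have h2 : ∀ j k l, ∀ᵐ ξ, ξ ∈ Ω → (freq l ξ : ℂ) * a (.inr (.inr (j, k))) ξ =
      freq k ξ * a (.inr (.inr (j, l))) ξ := by
    intro j k l
    have := Represents.sum_symbol_eq_zero hΩ (ι := Bool)
      (f := fun c => cond c (F.2.2 j k) (F.2.2 j l))
      (a := fun c => cond c (a (.inr (.inr (j, k)))) (a (.inr (.inr (j, l)))))
      (fun c => by cases c; exacts [ha (.inr (.inr (j, l))), ha (.inr (.inr (j, k)))])
      (D := fun c => cond c (pderiv l) (pderiv k))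
      (p := fun c => cond c (fun ξ => Complex.I * freq l ξ) (fun ξ => Complex.I * freq k ξ))
      (fun c => by cases c; exacts [isSymbol_pderiv k, isSymbol_pderiv l]) (fun c => cond c 1 (-1))
      (fun φ hφ => by simp [hF.2 φ hφ j k l])
    filter_upwards [this] with ξ h hξ
    have h := h hξ
    simp only [Fintype.sum_bool, cond_true, cond_false, Complex.ofReal_one, Complex.ofReal_neg,
      one_mul] at h
    have h := (mul_eq_zero.1 (show Complex.I * (freq l ξ *
      (starRingEnd ℂ) (a (.inr (.inr (j, k))) ξ) - freq k ξ *
      (starRingEnd ℂ) (a (.inr (.inr (j, l))) ξ)) = 0 by linear_combination h)).resolve_left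
      Complex.I_ne_zero
    rw [← sub_eq_zero]
    refine hconj ?_
    rw [← h]
    simp
  have hf : ∀ i ξ, (freq i ξ : ℂ) = rad ξ * cdir i ξ := fun i ξ => by
    rw [freq_eq]; push_cast; rfl
  filter_upwards [ae_all_iff.2 h1, ae_all_iff.2 fun j => ae_all_iff.2 fun k =>
    ae_all_iff.2 (h2 j k), ae_ne_zero] with ξ h1 h2 h0 hξ
  have hr : (rad ξ : ℂ) ≠ 0 := by
    simp [rad, Real.pi_ne_zero, h0]
  refine ⟨fun k => ?_, fun j k l => ?_⟩
  · have := h1 k hξ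
    simp only [hf, mul_assoc, ← Finset.mul_sum, ← mul_add] at this
    exact (mul_eq_zero.1 this).resolve_left hr
  · have := h2 j k l hξ
    simp only [hf, mul_assoc] at this
    exact mul_left_cancel₀ hr this

lemma Constrained.adm_analysis {F : Triple 2} (hF : Constrained F) :
    ∀ᵐ ξ, Adm ξ (fun b => analysis F b ξ) := by
  filter_upwards [adm_of_constrained isOpen_univ hF (a := analysis F)
    fun b => represents_fourier _] with ξ hξ using hξ (mem_univ ξ)

lemma Constrained.adm_lowAnalysis {R : ℝ} {q : ℝ≥0∞} [Fact (1 ≤ q)] (hq : q ≤ 2) {F : Triple q}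
    (hF : Constrained F) : ∀ᵐ ξ, lowCut R ξ ≠ 0 → Adm ξ (fun b => lowAnalysis R q F b ξ) := by
  filter_upwards [adm_of_constrained (isOpen_lt continuous_rad continuous_const) hF
    (a := lowAnalysis R q F) fun b => represents_lowFourier hq _] with ξ hξ h
  refine hξ ?_
  by_contra h'
  exact h (if_neg h')

/-! ### Time derivatives -/

section TimeDerivatives

variable {mu lam R c : ℝ} (hmu : 0 < mu) (hlam : 0 ≤ 2 * mu + 3 * lam)
  (h : SymbolBounds mu lam R c)

include h in
lemma hasDerivAt_evolveAdm_low (u : Idx → CL2) (m : ℕ) {t : ℝ} (ht : 0 < t) :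
    HasDerivAt (fun s => synthesis (evolveAdm mu lam (lowCut R) m s u))
      (synthesis (evolveAdm mu lam (lowCut R) (m + 1) t u)) t := by
  obtain ⟨B, hB⟩ := h.exists_norm_low_le (m + 2)
  have hb : ∀ k s, 0 ≤ s → ∀ a b, Bdd (fun ξ => lowCut R ξ * sym mu lam k s a b ξ) :=
    fun k s hs a b => by
      obtain ⟨B, hB⟩ := h.exists_norm_low_le k
      exact ⟨(bdd_lowCut R).measurable.mul (measurable_sym mu lam k s a b), B, hB s hs a b⟩
  refine synthesis.hasFDerivAt.comp_hasDerivAt t ?_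
  exact hasDerivAt_matOp ht (fun t a b ξ => (hasDerivAt_sym mu lam m t a b ξ).const_mul _)
    (fun t a b ξ => (hasDerivAt_sym mu lam (m + 1) t a b ξ).const_mul _)
    (hb m) (hb (m + 1)) hB u

include h in
lemma hasDerivAt_evolveAdm_high (u : Idx → CL2) (m : ℕ) {t : ℝ} (ht : 0 < t) :
    HasDerivAt (fun s => synthesis (evolveAdm mu lam (highCut R) m s u))
      (synthesis (evolveAdm mu lam (highCut R) (m + 1) t u)) t := by
  -- Differentiability at t is local, so the bounds may be taken on times after t/2.
  have ht2 : 0 < t / 2 := by positivity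
  obtain ⟨B, hB⟩ := h.exists_norm_high_le (m + 2) ht2
  have hb : ∀ k s, t / 2 ≤ s → ∀ a b, Bdd (fun ξ => highCut R ξ * sym mu lam k s a b ξ) :=
    fun k s hs a b => by
      obtain ⟨B, hB⟩ := h.exists_norm_high_le k ht2
      exact ⟨(bdd_highCut R).measurable.mul (measurable_sym mu lam k s a b), B, hB s hs a b⟩
  refine synthesis.hasFDerivAt.comp_hasDerivAt t ?_
  exact hasDerivAt_matOp (half_lt_self ht)
    (fun t a b ξ => (hasDerivAt_sym mu lam m t a b ξ).const_mul _)
    (fun t a b ξ => (hasDerivAt_sym mu lam (m + 1) t a b ξ).const_mul _)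
    (hb m) (hb (m + 1)) hB u

include hmu hlam in
lemma lowOp_eq {t : ℝ} (ht : 0 ≤ t) {q : ℝ≥0∞} [Fact (1 ≤ q)] (hq : q ≤ 2) {F : Triple q}
    (hF : Constrained F) : lowOp mu lam R t q F =
      synthesis (evolveAdm mu lam (lowCut R) 0 t (lowAnalysis R q F)) :=
  congrArg synthesis (evolve_eq_evolveAdm hmu hlam (bdd_lowCut R) ht (hF.adm_lowAnalysis hq))

include hmu hlam in
lemma highOp_eq {t : ℝ} (ht : 0 ≤ t) {F : Triple 2} (hF : Constrained F) : highOp mu lam R t F =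
      synthesis (evolveAdm mu lam (highCut R) 0 t (analysis F)) :=
  congrArg synthesis (evolve_eq_evolveAdm hmu hlam (bdd_highCut R) ht
    (hF.adm_analysis.mono fun _ h _ => h))

include hmu hlam h in
lemma contDiffOn_lowOp {q : ℝ≥0∞} [Fact (1 ≤ q)] (hq : q ≤ 2) {F : Triple q}
    (hF : Constrained F) : ContDiffOn ℝ ∞ (fun t => lowOp mu lam R t q F) (Ioi 0) :=
  (contDiffOn_of_hasDerivAt (fun k _ ht => hasDerivAt_evolveAdm_low h (lowAnalysis R q F) k ht)).congr
    fun _ ht => lowOp_eq hmu hlam (le_of_lt ht) hq hF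

include hmu hlam h in
lemma contDiffOn_highOp {F : Triple 2} (hF : Constrained F) :
    ContDiffOn ℝ ∞ (fun t => highOp mu lam R t F) (Ioi 0) :=
  (contDiffOn_of_hasDerivAt (fun k _ ht => hasDerivAt_evolveAdm_high h (analysis F) k ht)).congr
    fun _ ht => highOp_eq hmu hlam (le_of_lt ht) hF

include hmu hlam h in
lemma dtIter_lowOp {q : ℝ≥0∞} [Fact (1 ≤ q)] (hq : q ≤ 2) {F : Triple q} (hF : Constrained F)
    (m : ℕ) {t : ℝ} (ht : 0 < t) : dtIter m (fun s => lowOp mu lam R s q F) t =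
      synthesis (evolveAdm mu lam (lowCut R) m t (lowAnalysis R q F)) := by
  rw [← iteratedDeriv_of_hasDerivAt
    (fun k _ ht => hasDerivAt_evolveAdm_low h (lowAnalysis R q F) k ht) m ht]
  refine Filter.EventuallyEq.iteratedDeriv_eq m ?_
  filter_upwards [Ioi_mem_nhds ht] with s hs using lowOp_eq hmu hlam (le_of_lt hs) hq hF

include hmu hlam h in
lemma dtIter_highOp {F : Triple 2} (hF : Constrained F) (m : ℕ) {t : ℝ} (ht : 0 < t) :
    dtIter m (fun s => highOp mu lam R s F) t =
      synthesis (evolveAdm mu lam (highCut R) m t (analysis F)) := by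
  rw [← iteratedDeriv_of_hasDerivAt
    (fun k _ ht => hasDerivAt_evolveAdm_high h (analysis F) k ht) m ht]
  refine Filter.EventuallyEq.iteratedDeriv_eq m ?_
  filter_upwards [Ioi_mem_nhds ht] with s hs using highOp_eq hmu hlam (le_of_lt hs) hF

end TimeDerivatives

/-! ### The low frequency estimates -/

/-- The square is a Gaussian integral in dimension three, of order t^(-3/2); its root is the source
of every 3/4 in the theorem. -/
lemma exists_eLpNorm_gaussian_le {c : ℝ} (hc : 0 < c) : ∃ K : ℝ, 0 < K ∧ ∀ t, 0 < t →
    eLpNorm (fun ξ => Real.exp (-(c * rad ξ ^ 2 * t))) 2 (volume : Measure R3) ≤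
      ENNReal.ofReal (K * t ^ (-(3 / 4) : ℝ)) := by
  have hpi := Real.pi_pos
  set b := 2 * c * (2 * Real.pi) ^ 2 with hb
  have hb0 : 0 < b := by positivity
  refine ⟨(Real.pi / b) ^ (3 / 4 : ℝ), by positivity, fun t ht => ?_⟩
  have hbt : 0 < b * t := by positivity
  have h1 := GaussianFourier.integral_rexp_neg_mul_sq_norm (V := R3) hbt
  -- Integrability comes from the closed form: the integral of a nonintegrable function would be 0,
  -- but the value is positive.
  have hint : Integrable (fun v : R3 => Real.exp (-(b * t) * ‖v‖ ^ 2)) := by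
    by_contra h
    rw [integral_undef h] at h1
    have : 0 < (Real.pi / (b * t)) ^ ((Module.finrank ℝ R3 : ℝ) / 2) := by positivity
    linarith
  have h2 : ∫⁻ ξ : R3, ‖Real.exp (-(c * rad ξ ^ 2 * t))‖ₑ ^ (2 : ℝ) =
      ENNReal.ofReal ((Real.pi / (b * t)) ^ (3 / 2 : ℝ)) := by
    have e : (Real.pi / (b * t)) ^ (3 / 2 : ℝ) = ∫ v : R3, Real.exp (-(b * t) * ‖v‖ ^ 2) := by
      rw [h1]; simp
    rw [e, ofReal_integral_eq_lintegral_ofReal hint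
      (Eventually.of_forall fun _ => (Real.exp_pos _).le)]
    refine lintegral_congr fun ξ => ?_
    rw [Real.enorm_eq_ofReal (Real.exp_pos _).le, ENNReal.ofReal_rpow_of_nonneg
      (Real.exp_pos _).le zero_le_two, ← Real.exp_mul]
    congr 2
    rw [rad, hb]
    ring
  rw [eLpNorm_eq_lintegral_rpow_enorm_toReal two_ne_zero ENNReal.ofNat_ne_top,
    ENNReal.toReal_ofNat, h2, ENNReal.ofReal_rpow_of_nonneg (by positivity) (by norm_num),
    ← Real.rpow_mul (by positivity)]
  refine ENNReal.ofReal_le_ofReal (le_of_eq ?_)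
  rw [← div_div, Real.div_rpow (by positivity) ht.le, Real.rpow_neg ht.le, div_eq_mul_inv]
  norm_num

/-- The number of derivatives of order `l` of a triple. -/
def derivCount (l : ℕ) : ℕ := 13 * (Finset.piAntidiag (Finset.univ : Finset (Fin 3)) l).card

lemma dxNorm_le_of_forall {p q : ℝ≥0∞} {l : ℕ} {U : Triple q} {D : ℝ≥0∞}
    (h : ∀ a, ∀ α : Fin 3 → ℕ, ∑ i, α i = l → derivNorm α p (comp U a) ≤ D) :
    dxNorm l p U ≤ ENNReal.ofReal (derivCount l) * D := by
  rw [dxNorm, compSum_eq]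
  have : ∀ a, orderNorm l p (comp U a) ≤
      ((Finset.piAntidiag (Finset.univ : Finset (Fin 3)) l).card : ℝ≥0∞) * D := by
    intro a
    rw [← nsmul_eq_mul]
    exact Finset.sum_le_card_nsmul _ _ _ fun α hα => h a α (by
      simpa using (Finset.mem_piAntidiag.1 hα).1)
  refine (Finset.sum_le_card_nsmul _ _ _ fun a _ => this a).trans (le_of_eq ?_)
  rw [derivCount, ENNReal.ofReal_natCast, nsmul_eq_mul]
  simp [mul_assoc]

lemma monomial_mul_evolveAdm_ae_eq {mu lam : ℝ} {κ : R3 → ℂ} {m : ℕ} {t : ℝ} {u : Idx → CL2}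
    (hb : ∀ a b, Bdd (fun ξ => κ ξ * sym mu lam m t a b ξ)) (α : Fin 3 → ℕ) (a : Idx) :
    (fun ξ => monomial α ξ * evolveAdm mu lam κ m t u a ξ) =ᵐ[volume]
      fun ξ => ∑ b, (monomial α ξ * (κ ξ * sym mu lam m t a b ξ)) * u b ξ := by
  filter_upwards [coeFn_matOp hb u a] with ξ hξ
  rw [evolveAdm, hξ, Finset.mul_sum]
  simp only [mul_assoc]

lemma lowCut_mul_sym_bdd {mu lam R c : ℝ} (h : SymbolBounds mu lam R c) (m : ℕ) {t : ℝ}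
    (ht : 0 ≤ t) (a b : Idx) : Bdd (fun ξ => lowCut R ξ * sym mu lam m t a b ξ) := by
  obtain ⟨B, hB⟩ := h.exists_norm_low_le m
  exact ⟨(bdd_lowCut R).measurable.mul (measurable_sym mu lam m t a b), B, hB t ht a b⟩

lemma highCut_mul_sym_bdd {mu lam R c : ℝ} (h : SymbolBounds mu lam R c) (m : ℕ) {t : ℝ}
    (ht : 0 < t) (a b : Idx) : Bdd (fun ξ => highCut R ξ * sym mu lam m t a b ξ) := by
  obtain ⟨B, hB⟩ := h.exists_norm_high_le m ht
  exact ⟨(bdd_highCut R).measurable.mul (measurable_sym mu lam m t a b), B, hB t le_rfl a b⟩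

/-- Each matrix entry, multiplied by the monomial, is a symbol with sup bound A and L² bound B, and
the Hausdorff–Young type estimate applies to it. -/
lemma derivNorm_low_le {mu lam R c : ℝ} (h : SymbolBounds mu lam R c) {m : ℕ} {t : ℝ}
    (ht : 0 ≤ t) {q : ℝ≥0∞} [Fact (1 ≤ q)] (hq : q ≤ 2) (F : Triple q) {A B : ℝ} (hB0 : 0 ≤ B)
    {α : Fin 3 → ℕ}
    (hA : ∀ a b ξ, ‖monomial α ξ * (lowCut R ξ * sym mu lam m t a b ξ)‖ ≤ A)
    (hB : ∀ a b, eLpNorm (fun ξ => monomial α ξ * (lowCut R ξ * sym mu lam m t a b ξ)) 2 volume ≤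
      ENNReal.ofReal B) (a : Idx) :
    derivNorm α 2 (comp (synthesis (evolveAdm mu lam (lowCut R) m t (lowAnalysis R q F))) a) ≤
      ENNReal.ofReal (B ^ (2 / q.toReal - 1) * A ^ (2 - 2 / q.toReal)) * lqNorm q F := by
  rw [comp_synthesis]
  refine (derivNorm_two_realPart_le _ _).trans ?_
  rw [eLpNorm_congr_ae (monomial_mul_evolveAdm_ae_eq
    (fun a b => lowCut_mul_sym_bdd h m ht a b) α a)]
  have hk : ∀ b, Bdd (fun ξ => monomial α ξ * (lowCut R ξ * sym mu lam m t a b ξ)) := fun b =>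
    ⟨(continuous_monomial α).measurable.mul
      ((bdd_lowCut R).measurable.mul (measurable_sym mu lam m t a b)), A, hA a b⟩
  -- The symbol already contains the cutoff, so a second cutoff changes nothing and the given bounds
  -- can be used.
  have hlow : ∀ b, (fun ξ => lowCut R ξ * (monomial α ξ * (lowCut R ξ * sym mu lam m t a b ξ))) =
      fun ξ => monomial α ξ * (lowCut R ξ * sym mu lam m t a b ξ) := fun b => by
    funext ξ
    rw [mul_left_comm, ← mul_assoc (lowCut R ξ), lowCut_mul_self]
  have hterm : ∀ b, eLpNorm (fun ξ => monomial α ξ * (lowCut R ξ * sym mu lam m t a b ξ) *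
      lowAnalysis R q F b ξ) 2 volume ≤
      ENNReal.ofReal (B ^ (2 / q.toReal - 1) * A ^ (2 - 2 / q.toReal)) *
        eLpNorm (comp F b) q volume := by
    intro b
    rw [← eLpNorm_congr_ae (coeFn_mulOp (hk b) (lowAnalysis R q F b)), ← Lp.enorm_def,
      ← Lp.enorm_def, ← ofReal_norm, ← ofReal_norm, ← ENNReal.ofReal_mul' (norm_nonneg _)]
    refine ENNReal.ofReal_le_ofReal ?_
    exact norm_mulOp_lowFourier_le hq (hk b) (by
      intro ξ; rw [congrFun (hlow b) ξ]; exact hA a b ξ) hB0 (by rw [hlow b]; exact hB a b) _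
  have hmeas : ∀ b, AEStronglyMeasurable (fun ξ => monomial α ξ *
      (lowCut R ξ * sym mu lam m t a b ξ) * lowAnalysis R q F b ξ) volume := fun b =>
    (hk b).measurable.aestronglyMeasurable.mul (Lp.aestronglyMeasurable _)
  have e : (fun ξ => ∑ b, (monomial α ξ * (lowCut R ξ * sym mu lam m t a b ξ)) *
      lowAnalysis R q F b ξ) = ∑ b, fun ξ => monomial α ξ *
      (lowCut R ξ * sym mu lam m t a b ξ) * lowAnalysis R q F b ξ := by
    funext ξ; simp
  rw [e, lqNorm, compSum_eq, Finset.mul_sum]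
  exact (eLpNorm_sum_le (fun b _ => hmeas b) one_le_two).trans
    (Finset.sum_le_sum fun b _ => hterm b)

section LowEstimates

variable {mu lam R c : ℝ} (h : SymbolBounds mu lam R c)

include h in
lemma SymbolBounds.exists_norm_monomial_low_le (l m : ℕ) : ∃ C : ℝ, 0 < C ∧
    ∀ α : Fin 3 → ℕ, ∑ i, α i = l → ∀ t, 0 ≤ t → ∀ a b ξ,
      ‖monomial α ξ * (lowCut R ξ * sym mu lam m t a b ξ)‖ ≤
        C * ‖lowCut R ξ‖ * (rad ξ ^ (l + m) * Real.exp (-(c * rad ξ ^ 2 * t))) := by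
  obtain ⟨C, hC, hb⟩ := h.low m
  refine ⟨C, hC, fun α hα t ht a b ξ => ?_⟩
  by_cases hξ : rad ξ < R
  · have h1 := hb a b ξ t hξ.le ht
    have h2 := norm_monomial_le α ξ
    rw [hα] at h2
    have h0 := rad_nonneg ξ
    rw [norm_mul, lowCut, if_pos hξ, one_mul, norm_one, mul_one]
    calc ‖monomial α ξ‖ * ‖sym mu lam m t a b ξ‖
        ≤ rad ξ ^ l * (C * rad ξ ^ m * Real.exp (-(c * rad ξ ^ 2 * t))) := by gcongr
      _ = _ := by ring
  · simp [lowCut, hξ]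

lemma norm_lowCut_le (ξ : R3) : ‖lowCut R ξ‖ ≤ 1 := by unfold lowCut; split_ifs <;> simp

include h in
-- Half of the Gaussian absorbs rad^(l+m) and yields t^(-(l+m)/2); the other half is bounded by 1
-- for the sup norm and contributes t^(-3/4) to the L² norm.
lemma exists_low_decay (l m : ℕ) : ∃ K : ℝ, 0 < K ∧ ∀ α : Fin 3 → ℕ, ∑ i, α i = l →
    ∀ t, 0 < t → ∀ a b,
      (∀ ξ, ‖monomial α ξ * (lowCut R ξ * sym mu lam m t a b ξ)‖ ≤
        K * t ^ (-((l + m : ℕ) : ℝ) / 2)) ∧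
      eLpNorm (fun ξ => monomial α ξ * (lowCut R ξ * sym mu lam m t a b ξ)) 2 volume ≤
        ENNReal.ofReal (K * t ^ (-((l + m : ℕ) : ℝ) / 2 - 3 / 4)) := by
  obtain ⟨C, hC, hb⟩ := h.exists_norm_monomial_low_le l m
  have hc2 : 0 < c / 2 := by have := h.pos; positivity
  obtain ⟨C', hC', hp⟩ := exists_pow_mul_exp_le hc2 (l + m)
  obtain ⟨G, hG, hg⟩ := exists_eLpNorm_gaussian_le hc2
  refine ⟨C * C' * (1 + G), by positivity, fun α hα t ht a b => ?_⟩
  have key : ∀ ξ, ‖monomial α ξ * (lowCut R ξ * sym mu lam m t a b ξ)‖ ≤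
      C * C' * t ^ (-((l + m : ℕ) : ℝ) / 2) * Real.exp (-(c / 2 * rad ξ ^ 2 * t)) := by
    intro ξ
    have h0 := rad_nonneg ξ
    refine (hb α hα t ht.le a b ξ).trans ?_
    calc C * ‖lowCut R ξ‖ * (rad ξ ^ (l + m) * Real.exp (-(c * rad ξ ^ 2 * t)))
        ≤ C * 1 * (rad ξ ^ (l + m) * Real.exp (-(c * rad ξ ^ 2 * t))) := by
          gcongr
          exact norm_lowCut_le ξ
      _ = C * ((rad ξ ^ (l + m) * Real.exp (-(c / 2 * rad ξ ^ 2 * t))) *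
          Real.exp (-(c / 2 * rad ξ ^ 2 * t))) := by
          rw [mul_one, mul_assoc (rad ξ ^ (l + m)), ← Real.exp_add]
          congr 3
          ring_nf
      _ ≤ C * ((C' * t ^ (-((l + m : ℕ) : ℝ) / 2)) * Real.exp (-(c / 2 * rad ξ ^ 2 * t))) := by
          exact mul_le_mul_of_nonneg_left (mul_le_mul_of_nonneg_right (hp _ _ h0 ht)
            (Real.exp_pos _).le) hC.le
      _ = _ := by ring
  constructor
  · intro ξ
    refine (key ξ).trans ?_
    have h1 : Real.exp (-(c / 2 * rad ξ ^ 2 * t)) ≤ 1 := by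
      apply Real.exp_le_one_iff.2
      simp only [Left.neg_nonpos_iff]
      positivity
    calc C * C' * t ^ (-((l + m : ℕ) : ℝ) / 2) * Real.exp (-(c / 2 * rad ξ ^ 2 * t))
        ≤ C * C' * t ^ (-((l + m : ℕ) : ℝ) / 2) * (1 + G) := by
          gcongr
          linarith
      _ = _ := by ring
  · have h2 : eLpNorm (fun ξ => monomial α ξ * (lowCut R ξ * sym mu lam m t a b ξ)) 2 volume ≤
        eLpNorm ((C * C' * t ^ (-((l + m : ℕ) : ℝ) / 2)) •
          fun ξ => Real.exp (-(c / 2 * rad ξ ^ 2 * t))) 2 (volume : Measure R3) := by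
      refine eLpNorm_mono_real fun ξ => (key ξ).trans_eq ?_
      simp
    refine h2.trans ?_
    rw [eLpNorm_const_smul, ← ofReal_norm, Real.norm_of_nonneg (by positivity)]
    refine (mul_le_mul_right (hg t ht) _).trans ?_
    rw [← ENNReal.ofReal_mul (by positivity)]
    refine ENNReal.ofReal_le_ofReal ?_
    rw [sub_eq_add_neg, Real.rpow_add ht]
    have : 0 < t ^ (-((l + m : ℕ) : ℝ) / 2) * t ^ (-(3 / 4) : ℝ) := by positivity
    calc _ = C * C' * G * (t ^ (-((l + m : ℕ) : ℝ) / 2) * t ^ (-(3 / 4) : ℝ)) := by ring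
      _ ≤ _ := by
        gcongr
        linarith

include h in
-- For bounded times the decay is not needed: powers of the frequency are bounded by powers of R,
-- and the cutoff is square integrable.
lemma exists_low_bounded (l m : ℕ) : ∃ K : ℝ, 0 < K ∧ ∀ α : Fin 3 → ℕ, ∑ i, α i = l →
    ∀ t, 0 ≤ t → ∀ a b,
      (∀ ξ, ‖monomial α ξ * (lowCut R ξ * sym mu lam m t a b ξ)‖ ≤ K) ∧
      eLpNorm (fun ξ => monomial α ξ * (lowCut R ξ * sym mu lam m t a b ξ)) 2 volume ≤
        ENNReal.ofReal K := by
  obtain ⟨C, hC, hb⟩ := h.exists_norm_monomial_low_le l m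
  obtain ⟨B, hB0, hB⟩ := exists_eLpNorm_lowCut_le R
  have hR : 0 < R := by linarith [h.one_le]
  refine ⟨C * R ^ (l + m) * (1 + B), by positivity, fun α hα t ht a b => ?_⟩
  have key : ∀ ξ, ‖monomial α ξ * (lowCut R ξ * sym mu lam m t a b ξ)‖ ≤
      C * R ^ (l + m) * ‖lowCut R ξ‖ := by
    intro ξ
    have h0 := rad_nonneg ξ
    refine (hb α hα t ht a b ξ).trans ?_
    by_cases hξ : rad ξ < R
    · have h1 : Real.exp (-(c * rad ξ ^ 2 * t)) ≤ 1 := by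
        apply Real.exp_le_one_iff.2
        have := h.pos
        simp only [Left.neg_nonpos_iff]
        positivity
      calc C * ‖lowCut R ξ‖ * (rad ξ ^ (l + m) * Real.exp (-(c * rad ξ ^ 2 * t)))
          ≤ C * ‖lowCut R ξ‖ * (R ^ (l + m) * 1) := by gcongr
        _ = _ := by ring
    · simp [lowCut, hξ]
  constructor
  · intro ξ
    refine (key ξ).trans ?_
    gcongr
    linarith [norm_lowCut_le (R := R) ξ]
  · refine (eLpNorm_le_mul_eLpNorm_of_ae_le_mul (Eventually.of_forall key) 2).trans ?_
    refine (mul_le_mul_right hB _).trans ?_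
    rw [← ENNReal.ofReal_mul (by positivity)]
    refine ENNReal.ofReal_le_ofReal ?_
    gcongr
    linarith

/-- The decay of the low frequency part. -/
lemma exists_dxNorm_lowOp_decay (hmu : 0 < mu) (hlam : 0 ≤ 2 * mu + 3 * lam)
    (h : SymbolBounds mu lam R c) (l m : ℕ) (q : ℝ≥0∞) [Fact (1 ≤ q)] (hq : q ≤ 2) :
    ∃ C : ℝ, ∀ F : Triple q, Constrained F → ∀ t, 0 < t →
      dxNorm l 2 (dtIter m (fun s => lowOp mu lam R s q F) t) ≤
        ENNReal.ofReal (C * t ^ (-(3 / 2) * (1 / q.toReal - 1 / 2) - ((m : ℝ) + l) / 2)) *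
          lqNorm q F := by
  obtain ⟨K, hK, hb⟩ := exists_low_decay h l m
  refine ⟨derivCount l * K, fun F hF t ht => ?_⟩
  rw [dtIter_lowOp hmu hlam h hq hF m ht]
  refine (dxNorm_le_of_forall fun a α hα => derivNorm_low_le h ht.le hq F (by positivity)
    (fun a b => (hb α hα t ht a b).1) (fun a b => (hb α hα t ht a b).2) a).trans ?_
  rw [← mul_assoc, ← ENNReal.ofReal_mul (by positivity)]
  refine mul_le_mul_left (ENNReal.ofReal_le_ofReal (le_of_eq ?_)) _
  rw [mul_assoc]
  congr 1
  -- The L² bound enters with weight 2/q - 1 and the sup bound with weight 2 - 2/q. The weights add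
  -- up to 1, so only the extra -3/4 is multiplied by 2/q - 1, giving -(3/2)(1/q - 1/2).
  rw [Real.mul_rpow hK.le (by positivity), Real.mul_rpow hK.le (by positivity),
    ← Real.rpow_mul ht.le, ← Real.rpow_mul ht.le, mul_mul_mul_comm, ← Real.rpow_add hK,
    ← Real.rpow_add ht]
  congr 2
  · rw [show 2 / q.toReal - 1 + (2 - 2 / q.toReal) = 1 by ring, Real.rpow_one]
  · push_cast
    ring

lemma exists_dxNorm_lowOp_le (hmu : 0 < mu) (hlam : 0 ≤ 2 * mu + 3 * lam)
    (h : SymbolBounds mu lam R c) (l m : ℕ) (q : ℝ≥0∞) [Fact (1 ≤ q)] (hq : q ≤ 2) :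
    ∃ C : ℝ, ∀ F : Triple q, Constrained F → ∀ t, 0 < t →
      dxNorm l 2 (dtIter m (fun s => lowOp mu lam R s q F) t) ≤ ENNReal.ofReal C * lqNorm q F := by
  obtain ⟨K, hK, hb⟩ := exists_low_bounded h l m
  refine ⟨derivCount l * K, fun F hF t ht => ?_⟩
  rw [dtIter_lowOp hmu hlam h hq hF m ht]
  refine (dxNorm_le_of_forall fun a α hα => derivNorm_low_le h ht.le hq F hK.le
    (fun a b => (hb α hα t ht.le a b).1) (fun a b => (hb α hα t ht.le a b).2) a).trans ?_
  rw [← mul_assoc, ← ENNReal.ofReal_mul (by positivity)]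
  refine mul_le_mul_left (ENNReal.ofReal_le_ofReal (le_of_eq ?_)) _
  congr 1
  rw [← Real.rpow_add hK, show 2 / q.toReal - 1 + (2 - 2 / q.toReal) = 1 by ring, Real.rpow_one]

end LowEstimates

/-! ### The high frequency estimates -/

/-- The weight `rad⁻²` at high frequencies. -/
def highWeight (R : ℝ) (ξ : R3) : ℝ := if rad ξ < R then 0 else (rad ξ ^ 2)⁻¹

lemma measurable_highWeight (R : ℝ) : Measurable (highWeight R) :=
  Measurable.ite (measurableSet_lt continuous_rad.measurable measurable_const)
    measurable_const (continuous_rad.measurable.pow_const 2).inv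

lemma highWeight_nonneg (R : ℝ) (ξ : R3) : 0 ≤ highWeight R ξ := by
  unfold highWeight; split_ifs <;> positivity

lemma highWeight_mul_sq_le (R : ℝ) (ξ : R3) : highWeight R ξ * rad ξ ^ 2 ≤ 1 := by
  unfold highWeight
  split_ifs
  · simp
  · exact inv_mul_le_one

/-- In dimension three the fourth power of 1/rad is integrable at infinity. This is why the L^∞
estimates need two derivatives more than the L² estimates. -/
lemma memLp_highWeight {R : ℝ} (hR : 1 ≤ R) : MemLp (highWeight R) 2 (volume : Measure R3) := by
  rw [memLp_two_iff_integrable_sq (measurable_highWeight R).aestronglyMeasurable]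
  have h1 : Integrable (fun ξ : R3 => 16 * (1 + ‖ξ‖) ^ (-4 : ℝ)) :=
    (integrable_one_add_norm (by simp; norm_num)).const_mul 16
  refine h1.mono' ((measurable_highWeight R).pow_const 2).aestronglyMeasurable
    (Eventually.of_forall fun ξ => ?_)
  rw [Real.norm_of_nonneg (by positivity)]
  unfold highWeight
  split_ifs with h
  · simp only [ne_eq, OfNat.ofNat_ne_zero, not_false_eq_true, zero_pow]
    positivity
  · have h2 : 1 ≤ rad ξ := hR.trans (not_lt.1 h)
    have h3 : 1 + ‖ξ‖ ≤ 2 * rad ξ := by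
      have : ‖ξ‖ ≤ rad ξ := by
        unfold rad
        exact le_mul_of_one_le_left (norm_nonneg _) (by linarith [Real.pi_gt_three])
      linarith
    have h4 : (1 + ‖ξ‖) ^ 4 ≤ 16 * rad ξ ^ 4 := by
      calc (1 + ‖ξ‖) ^ 4 ≤ (2 * rad ξ) ^ 4 := by gcongr
        _ = _ := by ring
    have h0 : 0 < rad ξ := by linarith
    rw [Real.rpow_neg (by positivity), show (4 : ℝ) = ((4 : ℕ) : ℝ) by norm_num,
      Real.rpow_natCast, inv_pow, ← pow_mul, ← div_eq_mul_inv, inv_eq_one_div,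
      div_le_div_iff₀ (by positivity) (by positivity), one_mul]
    exact h4

/-- The Gaussian weight. -/
def gaussWeight (c t : ℝ) (ξ : R3) : ℝ := Real.exp (-(c * rad ξ ^ 2 * t))

lemma measurable_gaussWeight (c t : ℝ) : Measurable (gaussWeight c t) := by
  have := continuous_rad
  unfold gaussWeight
  fun_prop

lemma gaussWeight_nonneg (c t : ℝ) (ξ : R3) : 0 ≤ gaussWeight c t ξ := (Real.exp_pos _).le

lemma gaussWeight_le_one {c t : ℝ} (hc : 0 ≤ c) (ht : 0 ≤ t) (ξ : R3) :
    gaussWeight c t ξ ≤ 1 := by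
  apply Real.exp_le_one_iff.2
  simp only [Left.neg_nonpos_iff]
  positivity

section HighEstimates

variable {mu lam R c : ℝ}

/-- The free exponents K and K' only have to dominate the true powers, because rad ≥ 1 above the
cutoff. C₁ is fixed before n, and only C₂ depends on n, as the first L^∞ estimate requires of its
constant C'. -/
lemma SymbolBounds.exists_norm_monomial_high_le (h : SymbolBounds mu lam R c) (l m : ℕ) :
    ∃ C₁ : ℝ, 0 < C₁ ∧ ∀ n : ℕ, ∃ C₂ : ℝ, 0 < C₂ ∧ ∀ α : Fin 3 → ℕ, ∑ i, α i = l →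
      ∀ (K K' : ℕ) (a b : Idx), l + 2 ≤ K + (vel a + vel b) →
        2 * m + l + (vel a + vel b) ≤ 2 + n + K' → ∀ t, 0 < t → ∀ ξ,
          ‖monomial α ξ * (highCut R ξ * sym mu lam m t a b ξ)‖ ≤
            C₁ * Real.exp (-(c / 3) * t) * (highWeight R ξ * rad ξ ^ K) +
            C₂ * (t ^ (-(n : ℝ) / 2) * Real.exp (-(c / 3) * t)) *
              (gaussWeight (c / 3) t ξ * rad ξ ^ K') := by
  obtain ⟨C, hC, hb⟩ := h.high m
  have hc := h.pos
  have hc3 : 0 < c / 3 := by positivity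
  refine ⟨C, hC, fun n => ?_⟩
  obtain ⟨C', hC', hp⟩ := exists_pow_mul_exp_le hc3 n
  refine ⟨C * C', by positivity, fun α hα K K' a b hK hK' t ht ξ => ?_⟩
  have h0 := rad_nonneg ξ
  have hw := highWeight_nonneg R ξ
  have hgw := gaussWeight_nonneg (c / 3) t ξ
  by_cases hξ : rad ξ < R
  · rw [highCut, if_pos hξ, zero_mul, mul_zero, norm_zero]
    positivity
  have hξ' := not_lt.1 hξ
  have h1 : 1 ≤ rad ξ := h.one_le.trans hξ'
  have hr0 : 0 < rad ξ := by linarith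
  have hg : vel a + vel b ≤ 2 := by have := vel_le_one a; have := vel_le_one b; omega
  have e1 := hb a b ξ t hξ' ht.le
  have e2 := norm_monomial_le α ξ
  rw [hα] at e2
  have e3 : rad ξ ^ l * rad ξ ^ (2 - (vel a + vel b)) ≤ rad ξ ^ K := by
    rw [← pow_add]
    exact pow_le_pow_right₀ h1 (by omega)
  have e4 : rad ξ ^ l * rad ξ ^ (2 * m + (vel a + vel b)) ≤
      rad ξ ^ 2 * (rad ξ ^ n * rad ξ ^ K') := by
    rw [← pow_add, ← pow_add, ← pow_add]
    exact pow_le_pow_right₀ h1 (by omega)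
  have e5 : Real.exp (-(c * t)) ≤ Real.exp (-(c / 3) * t) :=
    Real.exp_le_exp.2 (by nlinarith)
  -- Three equal factors: one absorbs rad^n into t^(-n/2), one gives the exponential decay since rad
  -- ≥ 1, and one stays as the weight for the L^∞ estimate. This makes c/3 the final rate.
  have e6 : Real.exp (-(c * rad ξ ^ 2 * t)) = Real.exp (-(c / 3 * rad ξ ^ 2 * t)) *
      (Real.exp (-(c / 3 * rad ξ ^ 2 * t)) * gaussWeight (c / 3) t ξ) := by
    rw [gaussWeight, ← Real.exp_add, ← Real.exp_add]
    congr 1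
    ring
  have e7 : Real.exp (-(c / 3 * rad ξ ^ 2 * t)) ≤ Real.exp (-(c / 3) * t) := by
    have : 1 ≤ rad ξ ^ 2 := one_le_pow₀ h1
    have h2 : 0 ≤ c / 3 * t := by positivity
    exact Real.exp_le_exp.2 (by nlinarith)
  have e8 := hp n t (Nat.cast_nonneg n) ht
  have e9 := hp (rad ξ) t h0 ht
  have hwe : highWeight R ξ = (rad ξ ^ 2)⁻¹ := if_neg hξ
  rw [highCut, if_neg hξ, one_mul, norm_mul]
  have hs : ‖sym mu lam m t a b ξ‖ = highWeight R ξ * (rad ξ ^ 2 * ‖sym mu lam m t a b ξ‖) := by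
    rw [hwe]; field_simp
  rw [hs]
  calc ‖monomial α ξ‖ * (highWeight R ξ * (rad ξ ^ 2 * ‖sym mu lam m t a b ξ‖))
      ≤ rad ξ ^ l * (highWeight R ξ * (C * (rad ξ ^ (2 - (vel a + vel b)) * Real.exp (-(c * t)) +
          rad ξ ^ (2 * m + (vel a + vel b)) * Real.exp (-(c * rad ξ ^ 2 * t))))) := by
        gcongr
    _ = C * Real.exp (-(c * t)) * (highWeight R ξ *
          (rad ξ ^ l * rad ξ ^ (2 - (vel a + vel b)))) +
        C * (highWeight R ξ * ((rad ξ ^ l * rad ξ ^ (2 * m + (vel a + vel b))) *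
          Real.exp (-(c * rad ξ ^ 2 * t)))) := by ring
    _ ≤ C * Real.exp (-(c / 3) * t) * (highWeight R ξ * rad ξ ^ K) +
        C * (highWeight R ξ * ((rad ξ ^ 2 * (rad ξ ^ n * rad ξ ^ K')) *
          Real.exp (-(c * rad ξ ^ 2 * t)))) := by gcongr
    _ = C * Real.exp (-(c / 3) * t) * (highWeight R ξ * rad ξ ^ K) +
        C * ((rad ξ ^ n * Real.exp (-(c / 3 * rad ξ ^ 2 * t))) *
          (Real.exp (-(c / 3 * rad ξ ^ 2 * t)) * (gaussWeight (c / 3) t ξ * rad ξ ^ K'))) := by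
        rw [hwe, e6]
        field_simp
    _ ≤ C * Real.exp (-(c / 3) * t) * (highWeight R ξ * rad ξ ^ K) +
        C * ((C' * t ^ (-(n : ℝ) / 2)) *
          (Real.exp (-(c / 3) * t) * (gaussWeight (c / 3) t ξ * rad ξ ^ K'))) := by
        gcongr
    _ = _ := by ring

/-- The high frequency estimate for one component, for norms in which the weights are bounded. -/
lemma eLpNorm_monomial_mul_high_le (h : SymbolBounds mu lam R c) {m : ℕ} {t : ℝ} (ht : 0 < t)
    {α : Fin 3 → ℕ} {a : Idx} {K K' J : ℕ → ℕ} {C₁ C₂ : ℝ} (hC₁ : 0 ≤ C₁) (hC₂ : 0 ≤ C₂)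
    (hb : ∀ b ξ, ‖monomial α ξ * (highCut R ξ * sym mu lam m t a b ξ)‖ ≤
      C₁ * (highWeight R ξ * rad ξ ^ K (vel b)) +
        C₂ * (gaussWeight (c / 3) t ξ * rad ξ ^ K' (vel b)))
    {p : ℝ≥0∞} (hp : 1 ≤ p) {A B : ℝ}
    (hX : ∀ (f : ScalarLp 2) (b : Idx), eLpNorm (fun ξ => highWeight R ξ *
      (rad ξ ^ K (vel b) * ‖(𝓕 (cplx 2 f) : CL2) ξ‖)) p volume ≤
        ENNReal.ofReal A * sobolevNorm (J (vel b)) 2 f)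
    (hY : ∀ (f : ScalarLp 2) (b : Idx), eLpNorm (fun ξ => gaussWeight (c / 3) t ξ *
      (rad ξ ^ K' (vel b) * ‖(𝓕 (cplx 2 f) : CL2) ξ‖)) p volume ≤
        ENNReal.ofReal B * sobolevNorm (K' (vel b)) 2 f) (F : Triple 2) :
    eLpNorm (fun ξ => monomial α ξ * evolveAdm mu lam (highCut R) m t (analysis F) a ξ) p volume ≤
      ENNReal.ofReal (C₁ * A) * ∑ b, sobolevNorm (J (vel b)) 2 (comp F b) +
      ENNReal.ofReal (C₂ * B) * ∑ b, sobolevNorm (K' (vel b)) 2 (comp F b) := by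
  rw [eLpNorm_congr_ae (monomial_mul_evolveAdm_ae_eq
    (fun a b => highCut_mul_sym_bdd h m ht a b) α a)]
  have hmeas : ∀ b, AEStronglyMeasurable (fun ξ => monomial α ξ *
      (highCut R ξ * sym mu lam m t a b ξ) * analysis F b ξ) volume := fun b =>
    ((continuous_monomial α).measurable.mul ((bdd_highCut R).measurable.mul
      (measurable_sym mu lam m t a b))).aestronglyMeasurable.mul (Lp.aestronglyMeasurable _)
  have e : (fun ξ => ∑ b, (monomial α ξ * (highCut R ξ * sym mu lam m t a b ξ)) *
      analysis F b ξ) = ∑ b, fun ξ => monomial α ξ *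
      (highCut R ξ * sym mu lam m t a b ξ) * analysis F b ξ := by
    funext ξ; simp
  rw [e, Finset.mul_sum, Finset.mul_sum, ← Finset.sum_add_distrib]
  refine (eLpNorm_sum_le (fun b _ => hmeas b) hp).trans (Finset.sum_le_sum fun b _ => ?_)
  have hr := continuous_rad.measurable
  have hn : AEStronglyMeasurable (fun ξ => ‖analysis F b ξ‖) volume :=
    (Lp.aestronglyMeasurable _).norm
  have m1 : AEStronglyMeasurable (fun ξ => highWeight R ξ *
      (rad ξ ^ K (vel b) * ‖analysis F b ξ‖)) volume :=
    (measurable_highWeight R).aestronglyMeasurable.mul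
      ((hr.pow_const _).aestronglyMeasurable.mul hn)
  have m2 : AEStronglyMeasurable (fun ξ => gaussWeight (c / 3) t ξ *
      (rad ξ ^ K' (vel b) * ‖analysis F b ξ‖)) volume :=
    (measurable_gaussWeight _ t).aestronglyMeasurable.mul
      ((hr.pow_const _).aestronglyMeasurable.mul hn)
  have h1 : eLpNorm (fun ξ => monomial α ξ * (highCut R ξ * sym mu lam m t a b ξ) *
      analysis F b ξ) p volume ≤ eLpNorm
        ((C₁ • fun ξ => highWeight R ξ * (rad ξ ^ K (vel b) * ‖analysis F b ξ‖)) +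
          C₂ • fun ξ => gaussWeight (c / 3) t ξ * (rad ξ ^ K' (vel b) * ‖analysis F b ξ‖))
        p volume := by
    refine eLpNorm_mono_real fun ξ => ?_
    rw [norm_mul]
    refine (mul_le_mul_of_nonneg_right (hb b ξ) (norm_nonneg _)).trans_eq ?_
    simp only [Pi.add_apply, Pi.smul_apply, smul_eq_mul]
    ring
  refine h1.trans ((eLpNorm_add_le (m1.const_smul _) (m2.const_smul _) hp).trans ?_)
  rw [eLpNorm_const_smul, eLpNorm_const_smul, Real.enorm_of_nonneg hC₁, Real.enorm_of_nonneg hC₂,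
    ENNReal.ofReal_mul hC₁, ENNReal.ofReal_mul hC₂, mul_assoc, mul_assoc]
  exact add_le_add (mul_le_mul_right (hX _ b) _) (mul_le_mul_right (hY _ b) _)

/-- Makes the constants independent of the component: the velocity index is 0 or 1. -/
lemma ofReal_three_pow_le {J : ℕ → ℕ} (b : Idx) :
    ENNReal.ofReal (3 ^ (J (vel b) + 1)) ≤ ENNReal.ofReal (3 ^ (J 0 + J 1 + 1)) := by
  refine ENNReal.ofReal_le_ofReal (pow_le_pow_right₀ (by norm_num) ?_)
  have := vel_le_one b
  interval_cases vel b <;> omega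

lemma eLpNorm_weight_mul_le_two {X : R3 → ℝ} {K J : ℕ → ℕ} (b : Idx)
    (hX0 : ∀ ξ, 0 ≤ X ξ) (hX : ∀ ξ, X ξ * rad ξ ^ K (vel b) ≤ rad ξ ^ J (vel b))
    (f : ScalarLp 2) : eLpNorm (fun ξ => X ξ *
      (rad ξ ^ K (vel b) * ‖(𝓕 (cplx 2 f) : CL2) ξ‖)) 2 volume ≤
        ENNReal.ofReal (3 ^ (J 0 + J 1 + 1)) * sobolevNorm (J (vel b)) 2 f := by
  have h1 : eLpNorm (fun ξ => X ξ * (rad ξ ^ K (vel b) * ‖(𝓕 (cplx 2 f) : CL2) ξ‖)) 2 volume ≤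
      eLpNorm (fun ξ => rad ξ ^ J (vel b) * ‖(𝓕 (cplx 2 f) : CL2) ξ‖) 2 volume := by
    refine eLpNorm_mono_real fun ξ => ?_
    have := rad_nonneg ξ
    have := hX0 ξ
    rw [Real.norm_of_nonneg (by positivity), ← mul_assoc]
    exact mul_le_mul_of_nonneg_right (hX ξ) (norm_nonneg _)
  exact h1.trans ((eLpNorm_rad_pow_fourier_le _ f).trans
    (mul_le_mul_left (ofReal_three_pow_le b) _))

/-- Cauchy–Schwarz with the weight as one factor: the weight is used up for integrability and
compensates no powers of the frequency. -/
lemma eLpNorm_weight_mul_le_one {X : R3 → ℝ} {K : ℕ → ℕ} (b : Idx) (hXm : Measurable X) {N : ℝ}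
    (hN : 0 ≤ N) (hX : eLpNorm X 2 volume ≤ ENNReal.ofReal N)
    (f : ScalarLp 2) : eLpNorm (fun ξ => X ξ *
      (rad ξ ^ K (vel b) * ‖(𝓕 (cplx 2 f) : CL2) ξ‖)) 1 volume ≤
        ENNReal.ofReal (N * 3 ^ (K 0 + K 1 + 1)) * sobolevNorm (K (vel b)) 2 f := by
  have hm : AEStronglyMeasurable (fun ξ => rad ξ ^ K (vel b) * ‖(𝓕 (cplx 2 f) : CL2) ξ‖)
      volume := (continuous_rad.measurable.pow_const _).aestronglyMeasurable.mul
        (Lp.aestronglyMeasurable _).norm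
  have h1 := eLpNorm_smul_le_mul_eLpNorm (p := 2) (q := 2) (r := 1) hm
    hXm.aestronglyMeasurable (μ := volume)
  refine h1.trans ?_
  rw [ENNReal.ofReal_mul hN, mul_assoc]
  exact mul_le_mul' hX ((eLpNorm_rad_pow_fourier_le _ f).trans
    (mul_le_mul_left (ofReal_three_pow_le b) _))

/-- The estimate in `L²` of one component. -/
lemma exists_derivNorm_high_two_le (h : SymbolBounds mu lam R c) (l m v : ℕ) (J : ℕ → ℕ)
    (hJ : ∀ w ≤ 1, l ≤ J w + (v + w)) : ∃ C₁ : ℝ, 0 < C₁ ∧ ∀ (n : ℕ) (K' : ℕ → ℕ),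
      (∀ w ≤ 1, 2 * m + l + (v + w) ≤ 2 + n + K' w) → ∃ C₂ : ℝ, 0 < C₂ ∧
      ∀ (F : Triple 2) (t : ℝ), 0 < t → ∀ a, vel a = v → ∀ α : Fin 3 → ℕ, ∑ i, α i = l →
      eLpNorm (fun ξ => monomial α ξ * evolveAdm mu lam (highCut R) m t (analysis F) a ξ) 2
        volume ≤
        ENNReal.ofReal (C₁ * Real.exp (-(c / 3) * t)) *
          ∑ b, sobolevNorm (J (vel b)) 2 (comp F b) +
        ENNReal.ofReal (C₂ * (t ^ (-(n : ℝ) / 2) * Real.exp (-(c / 3) * t))) *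
          ∑ b, sobolevNorm (K' (vel b)) 2 (comp F b) := by
  obtain ⟨C₁, hC₁, h₁⟩ := h.exists_norm_monomial_high_le l m
  refine ⟨C₁ * 3 ^ (J 0 + J 1 + 1), by positivity, fun n K' hK' => ?_⟩
  obtain ⟨C₂, hC₂, h₂⟩ := h₁ n
  refine ⟨C₂ * 3 ^ (K' 0 + K' 1 + 1), by positivity, fun F t ht a ha α hα => ?_⟩
  have hc := h.pos
  -- In L² the weight 1/rad² cancels two powers, so K may exceed the Sobolev order J by 2.
  have := eLpNorm_monomial_mul_high_le h ht (K := fun w => J w + 2) (K' := K') (J := J)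
    (C₁ := C₁ * Real.exp (-(c / 3) * t))
    (C₂ := C₂ * (t ^ (-(n : ℝ) / 2) * Real.exp (-(c / 3) * t))) (by positivity) (by positivity)
    (fun b ξ => h₂ α hα (J (vel b) + 2) (K' (vel b)) a b
      (by have := hJ _ (vel_le_one b); omega) (by have := hK' _ (vel_le_one b); omega) t ht ξ)
    one_le_two (A := 3 ^ (J 0 + J 1 + 1)) (B := 3 ^ (K' 0 + K' 1 + 1))
    (fun f b => eLpNorm_weight_mul_le_two b (K := fun w => J w + 2) (highWeight_nonneg R)
      (fun ξ => by
        rw [add_comm, pow_add, ← mul_assoc]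
        exact mul_le_of_le_one_left (pow_nonneg (rad_nonneg ξ) _) (highWeight_mul_sq_le R ξ)) f)
    (fun f b => eLpNorm_weight_mul_le_two b (gaussWeight_nonneg _ t)
      (fun ξ => mul_le_of_le_one_left (pow_nonneg (rad_nonneg ξ) _)
        (gaussWeight_le_one (by positivity) ht.le ξ)) f) F
  convert this using 4 <;> ring

/-- The estimate in `L^∞` of one component. -/
lemma exists_derivNorm_high_top_le (h : SymbolBounds mu lam R c) (l m v : ℕ) (J : ℕ → ℕ)
    (hJ : ∀ w ≤ 1, l + 2 ≤ J w + (v + w)) : ∃ C₁ : ℝ, 0 < C₁ ∧ ∀ (n : ℕ) (K' : ℕ → ℕ),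
      (∀ w ≤ 1, 2 * m + l + (v + w) ≤ 2 + n + K' w) → ∃ C₂ : ℝ, 0 < C₂ ∧
      ∀ (F : Triple 2) (t : ℝ), 0 < t → ∀ a, vel a = v → ∀ α : Fin 3 → ℕ, ∑ i, α i = l →
      derivNorm α ∞ (comp (synthesis (evolveAdm mu lam (highCut R) m t (analysis F))) a) ≤
        ENNReal.ofReal (C₁ * Real.exp (-(c / 3) * t)) *
          ∑ b, sobolevNorm (J (vel b)) 2 (comp F b) +
        ENNReal.ofReal (C₂ * (t ^ (-((n : ℝ) / 2 + 3 / 4)) * Real.exp (-(c / 3) * t))) *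
          ∑ b, sobolevNorm (K' (vel b)) 2 (comp F b) := by
  have hc := h.pos
  have hc3 : 0 < c / 3 := by positivity
  obtain ⟨C₁, hC₁, h₁⟩ := h.exists_norm_monomial_high_le l m
  obtain ⟨G, hG, hg⟩ := exists_eLpNorm_gaussian_le hc3
  set W := (eLpNorm (highWeight R) 2 (volume : Measure R3)).toReal with hW
  have hW0 : 0 ≤ W := ENNReal.toReal_nonneg
  have hWle : eLpNorm (highWeight R) 2 (volume : Measure R3) ≤ ENNReal.ofReal (W + 1) := by
    rw [← ENNReal.ofReal_toReal (memLp_highWeight h.one_le).2.ne, ← hW]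
    exact ENNReal.ofReal_le_ofReal (by linarith)
  refine ⟨C₁ * ((W + 1) * 3 ^ (J 0 + J 1 + 1)), by positivity, fun n K' hK' => ?_⟩
  obtain ⟨C₂, hC₂, h₂⟩ := h₁ n
  -- The bound by the L¹ norm on the frequency side is available only for square integrable
  -- functions. The L² estimate provides this when the right-hand side is finite, and otherwise
  -- there is nothing to prove.
  obtain ⟨D₁, hD₁, hD⟩ := exists_derivNorm_high_two_le h l m v J
    (fun w hw => by have := hJ w hw; omega)
  obtain ⟨D₂, hD₂, hD⟩ := hD n K' hK'
  refine ⟨C₂ * (G * 3 ^ (K' 0 + K' 1 + 1)), by positivity, fun F t ht a ha α hα => ?_⟩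
  by_cases hS : ∑ b, sobolevNorm (J (vel b)) 2 (comp F b) = (⊤ : ℝ≥0∞)
  · rw [hS, ENNReal.mul_top (ENNReal.ofReal_pos.2 (by positivity)).ne', top_add]
    exact le_top
  by_cases hS' : ∑ b, sobolevNorm (K' (vel b)) 2 (comp F b) = (⊤ : ℝ≥0∞)
  · rw [hS', ENNReal.mul_top (ENNReal.ofReal_pos.2 (by positivity)).ne', add_top]
    exact le_top
  have hmem : MemLp (fun ξ => monomial α ξ *
      evolveAdm mu lam (highCut R) m t (analysis F) a ξ) 2 volume :=
    ⟨aestronglyMeasurable_monomial_mul _ _, lt_of_le_of_lt (hD F t ht a ha α hα)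
      (ENNReal.add_lt_top.2 ⟨ENNReal.mul_lt_top ENNReal.ofReal_lt_top (lt_top_iff_ne_top.2 hS),
        ENNReal.mul_lt_top ENNReal.ofReal_lt_top (lt_top_iff_ne_top.2 hS')⟩)⟩
  rw [comp_synthesis]
  refine (derivNorm_top_realPart_le α _ hmem).trans ?_
  -- Here the weight is spent on square integrability, so K equals J and the condition on J is
  -- stricter by two than in L².
  have := eLpNorm_monomial_mul_high_le h ht (K := J) (K' := K') (J := J)
    (C₁ := C₁ * Real.exp (-(c / 3) * t))
    (C₂ := C₂ * (t ^ (-(n : ℝ) / 2) * Real.exp (-(c / 3) * t))) (by positivity) (by positivity)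
    (fun b ξ => h₂ α hα (J (vel b)) (K' (vel b)) a b
      (by have := hJ _ (vel_le_one b); omega) (by have := hK' _ (vel_le_one b); omega) t ht ξ)
    le_rfl (A := (W + 1) * 3 ^ (J 0 + J 1 + 1))
    (B := G * t ^ (-(3 / 4) : ℝ) * 3 ^ (K' 0 + K' 1 + 1))
    (fun f b => eLpNorm_weight_mul_le_one b (measurable_highWeight R) (by positivity) hWle f)
    (fun f b => eLpNorm_weight_mul_le_one b (measurable_gaussWeight _ t) (by positivity)
      (hg t ht) f) F
  have et : t ^ (-((n : ℝ) / 2 + 3 / 4)) = t ^ (-(n : ℝ) / 2) * t ^ (-(3 / 4) : ℝ) := by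
    rw [← Real.rpow_add ht]
    congr 1
    ring
  rw [et]
  refine this.trans_eq ?_
  congr 2 <;> exact congrArg ENNReal.ofReal (by ring)

lemma derivNorm_zero (α : Fin 3 → ℕ) (p : ℝ≥0∞) : derivNorm α p (0 : ScalarLp 2) = 0 := by
  refine le_antisymm ?_ zero_le
  have h0 : ((0 : ScalarLp 2) : R3 → ℝ) =ᵐ[volume] 0 := Lp.coeFn_zero _ _ _
  have hw : HasWeakDeriv α (0 : ScalarLp 2) (0 : ScalarLp 2) :=
    ⟨locallyIntegrable_Lp _, locallyIntegrable_Lp _, fun φ _ => by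
      rw [pair_congr h0, pair_congr h0]; simp [pair]⟩
  refine (iInf₂_le _ hw).trans ?_
  rw [eLpNorm_congr_ae h0, eLpNorm_zero]

lemma dxNorm_projIP_le {p : ℝ≥0∞} {l : ℕ} {U : Triple 2} {D : ℝ≥0∞}
    (h : ∀ a, vel a = 0 → ∀ α : Fin 3 → ℕ, ∑ i, α i = l → derivNorm α p (comp U a) ≤ D) :
    dxNorm l p (projIP U) ≤ ENNReal.ofReal (derivCount l) * D := by
  refine dxNorm_le_of_forall fun a α hα => ?_
  rcases a with _ | i | ⟨i, j⟩
  · exact h (.inl ()) rfl α hα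
  · exact (derivNorm_zero α p).le.trans zero_le
  · exact h (.inr (.inr (i, j))) rfl α hα

lemma dxNorm_projP_le {p : ℝ≥0∞} {l : ℕ} {U : Triple 2} {D : ℝ≥0∞}
    (h : ∀ a, vel a = 1 → ∀ α : Fin 3 → ℕ, ∑ i, α i = l → derivNorm α p (comp U a) ≤ D) :
    dxNorm l p (projP U) ≤ ENNReal.ofReal (derivCount l) * D := by
  refine dxNorm_le_of_forall fun a α hα => ?_
  rcases a with _ | i | ⟨i, j⟩
  · exact (derivNorm_zero α p).le.trans zero_le
  · exact h (.inr (.inl i)) rfl α hα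
  · exact (derivNorm_zero α p).le.trans zero_le

lemma sum_sobolevNorm_le_wNorm (J : ℕ → ℕ) (F : Triple 2) :
    ∑ b, sobolevNorm (J (vel b)) 2 (comp F b) ≤ wNorm (J 0) (J 1) F := by
  rw [wNorm, hNorm, hNorm, compSum_eq, compSum_eq, ← Finset.sum_add_distrib]
  refine Finset.sum_le_sum fun b _ => ?_
  rcases b with _ | i | ⟨i, j⟩
  exacts [le_self_add, le_add_self, le_self_add]

/-- Only the velocity part of the mixed norm is used; its first index 0 is a placeholder that can be
raised at will. -/
lemma sum_sobolevNorm_le_hNorm_projIP (J : ℕ → ℕ) (F : Triple 2) :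
    ∑ b, sobolevNorm (J (vel b)) 2 (comp F b) ≤
      wNorm 0 (J 1) F + hNorm (J 0) (projIP F) := by
  refine (sum_sobolevNorm_le_wNorm J F).trans ?_
  rw [wNorm, wNorm, add_comm]
  gcongr
  exact le_add_self

lemma sobolevNorm_mono {k k' : ℕ} (h : k ≤ k') (p : ℝ≥0∞) (f : R3 → ℝ) :
    sobolevNorm k p f ≤ sobolevNorm k' p f :=
  Finset.sum_le_sum_of_subset (Finset.range_mono (by omega))

lemma wNorm_mono {k k' j : ℕ} (h : k ≤ k') (F : Triple 2) : wNorm k j F ≤ wNorm k' j F := by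
  unfold wNorm hNorm
  rw [compSum_eq, compSum_eq, compSum_eq]
  gcongr
  exact sobolevNorm_mono h _ _

lemma ofReal_mul_add {N x y : ℝ} (hN : 0 ≤ N) (S T : ℝ≥0∞) :
    ENNReal.ofReal N * (ENNReal.ofReal x * S + ENNReal.ofReal y * T) =
      ENNReal.ofReal (N * y) * T + ENNReal.ofReal (N * x) * S := by
  rw [ENNReal.ofReal_mul hN, ENNReal.ofReal_mul hN]
  ring

lemma ofReal_combine {N C₁ C₂ τ e : ℝ} (hN : 0 ≤ N) (hC₁ : 0 ≤ C₁) (hC₂ : 0 ≤ C₂)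
    (he : 0 ≤ e) (S T : ℝ≥0∞) :
    ENNReal.ofReal N * (ENNReal.ofReal (C₁ * e) * S + ENNReal.ofReal (C₂ * (τ * e)) * T) ≤
      ENNReal.ofReal (N * (C₁ + C₂) * e) * (ENNReal.ofReal τ * T + S) := by
  have e1 : ENNReal.ofReal (N * (C₂ * (τ * e))) =
      ENNReal.ofReal (N * C₂ * e) * ENNReal.ofReal τ := by
    rw [← ENNReal.ofReal_mul (by positivity)]; congr 1; ring
  rw [ofReal_mul_add hN, e1, mul_add, mul_assoc]
  gcongr ?_ * _ + ?_ * _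
  · exact ENNReal.ofReal_le_ofReal (by gcongr; linarith)
  · refine ENNReal.ofReal_le_ofReal ?_
    rw [← mul_assoc]
    gcongr
    linarith

variable (hmu : 0 < mu) (hlam : 0 ≤ 2 * mu + 3 * lam) (h : SymbolBounds mu lam R c)

include hmu hlam h

/-- In a row other than a velocity row, the slow mode needs order l from n and E and one less from
v. For the parabolic mode the order 2m + l - n - 1 is dictated by the velocity data; the other
components would need less. -/
lemma exists_dxNorm_two_projIP_le (l m n : ℕ) : ∃ C : ℝ, ∀ F : Triple 2, Constrained F →
    ∀ t, 0 < t → dxNorm l 2 (projIP (dtIter m (fun s => highOp mu lam R s F) t)) ≤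
      ENNReal.ofReal (C * Real.exp (-(c / 3) * t)) *
        (ENNReal.ofReal (t ^ (-(n : ℝ) / 2)) * hNorm (2 * m + l - n - 1) F
          + wNorm l (l - 1) F) := by
  obtain ⟨C₁, hC₁, hb⟩ := exists_derivNorm_high_two_le h l m 0
    (fun w => if w = 0 then l else l - 1) (fun w hw => by split_ifs <;> omega)
  obtain ⟨C₂, hC₂, hb⟩ := hb n (fun _ => 2 * m + l - n - 1) (fun w hw => by omega)
  refine ⟨derivCount l * (C₁ + C₂), fun F hF t ht => ?_⟩
  rw [dtIter_highOp hmu hlam h hF m ht]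
  refine (dxNorm_projIP_le fun a ha α hα => ?_).trans
    (ofReal_combine (by positivity) hC₁.le hC₂.le (Real.exp_pos _).le _ _)
  rw [comp_synthesis]
  refine (derivNorm_two_realPart_le _ _).trans ((hb F t ht a ha α hα).trans ?_)
  gcongr
  · exact sum_sobolevNorm_le_wNorm (fun w => if w = 0 then l else l - 1) F
  · rw [hNorm, compSum_eq]

/-- A velocity row lowers the orders of the slow mode by one and raises those of the parabolic mode
by one. -/
lemma exists_dxNorm_two_projP_le (l m n : ℕ) : ∃ C : ℝ, ∀ F : Triple 2, Constrained F →
    ∀ t, 0 < t → dxNorm l 2 (projP (dtIter m (fun s => highOp mu lam R s F) t)) ≤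
      ENNReal.ofReal (C * Real.exp (-(c / 3) * t)) *
        (ENNReal.ofReal (t ^ (-(n : ℝ) / 2)) * wNorm (2 * m + l - n - 1) (2 * m + l - n) F
          + wNorm (l - 1) (l - 2) F) := by
  obtain ⟨C₁, hC₁, hb⟩ := exists_derivNorm_high_two_le h l m 1
    (fun w => if w = 0 then l - 1 else l - 2) (fun w hw => by split_ifs <;> omega)
  obtain ⟨C₂, hC₂, hb⟩ := hb n (fun w => if w = 0 then 2 * m + l - n - 1 else 2 * m + l - n)
    (fun w hw => by split_ifs <;> omega)
  refine ⟨derivCount l * (C₁ + C₂), fun F hF t ht => ?_⟩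
  rw [dtIter_highOp hmu hlam h hF m ht]
  refine (dxNorm_projP_le fun a ha α hα => ?_).trans
    (ofReal_combine (by positivity) hC₁.le hC₂.le (Real.exp_pos _).le _ _)
  rw [comp_synthesis]
  refine (derivNorm_two_realPart_le _ _).trans ((hb F t ht a ha α hα).trans ?_)
  gcongr
  · exact sum_sobolevNorm_le_wNorm (fun w => if w = 0 then l - 1 else l - 2) F
  · exact sum_sobolevNorm_le_wNorm
      (fun w => if w = 0 then 2 * m + l - n - 1 else 2 * m + l - n) F

/-- The slow mode needs order l + 2 from n and E and l + 1 from v, two more than in L². Its constant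
is chosen before n. -/
lemma exists_dxNorm_top_projIP_le (l m : ℕ) : ∃ C' : ℝ, ∀ n : ℕ, ∃ C : ℝ, ∀ F : Triple 2,
    Constrained F → ∀ t, 0 < t →
      dxNorm l ∞ (projIP (dtIter m (fun s => highOp mu lam R s F) t)) ≤
        ENNReal.ofReal (C * t ^ (-((n : ℝ) / 2 + 3 / 4)) * Real.exp (-(c / 3) * t)) *
            hNorm (2 * m + l - n - 1) F
          + ENNReal.ofReal (C' * Real.exp (-(c / 3) * t)) *
            (wNorm l (l + 1) F + hNorm (l + 2) (projIP F)) := by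
  obtain ⟨C₁, hC₁, hb⟩ := exists_derivNorm_high_top_le h l m 0
    (fun w => if w = 0 then l + 2 else l + 1) (fun w hw => by split_ifs <;> omega)
  refine ⟨derivCount l * C₁, fun n => ?_⟩
  obtain ⟨C₂, hC₂, hb⟩ := hb n (fun _ => 2 * m + l - n - 1) (fun w hw => by omega)
  refine ⟨derivCount l * C₂, fun F hF t ht => ?_⟩
  rw [dtIter_highOp hmu hlam h hF m ht]
  refine (dxNorm_projIP_le fun a ha α hα => hb F t ht a ha α hα).trans ?_
  rw [ofReal_mul_add (by positivity), ← mul_assoc, ← mul_assoc, ← mul_assoc]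
  gcongr
  · rw [hNorm, compSum_eq]
  · refine (sum_sobolevNorm_le_hNorm_projIP (fun w => if w = 0 then l + 2 else l + 1) F).trans ?_
    gcongr
    · exact wNorm_mono (Nat.zero_le l) F
    · exact le_rfl

/-- The velocity row spares one of the two additional derivatives: l + 1 from n and E, and l from v.
-/
lemma exists_dxNorm_top_projP_le (l m n : ℕ) : ∃ C : ℝ, ∀ F : Triple 2, Constrained F →
    ∀ t, 0 < t → dxNorm l ∞ (projP (dtIter m (fun s => highOp mu lam R s F) t)) ≤
      ENNReal.ofReal (C * Real.exp (-(c / 3) * t)) *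
        (ENNReal.ofReal (t ^ (-((n : ℝ) / 2 + 3 / 4))) *
            wNorm (2 * m + l - n - 1) (2 * m + l - n) F
          + wNorm (l + 1) l F) := by
  obtain ⟨C₁, hC₁, hb⟩ := exists_derivNorm_high_top_le h l m 1
    (fun w => if w = 0 then l + 1 else l) (fun w hw => by split_ifs <;> omega)
  obtain ⟨C₂, hC₂, hb⟩ := hb n (fun w => if w = 0 then 2 * m + l - n - 1 else 2 * m + l - n)
    (fun w hw => by split_ifs <;> omega)
  refine ⟨derivCount l * (C₁ + C₂), fun F hF t ht => ?_⟩
  rw [dtIter_highOp hmu hlam h hF m ht]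
  refine (dxNorm_projP_le fun a ha α hα => ?_).trans
    (ofReal_combine (by positivity) hC₁.le hC₂.le (Real.exp_pos _).le _ _)
  refine (hb F t ht a ha α hα).trans ?_
  gcongr
  · exact sum_sobolevNorm_le_wNorm (fun w => if w = 0 then l + 1 else l) F
  · exact sum_sobolevNorm_le_wNorm
      (fun w => if w = 0 then 2 * m + l - n - 1 else 2 * m + l - n) F

end HighEstimates

/-! ### The system in uniform notation -/

/-- The terms of the right-hand sides of the equations of the system. -/
abbrev Term : Type := Fin 3 ⊕ Fin 3 ⊕ Unit ⊕ Fin 3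

/-- The coefficients of the terms. -/
def termCoef (mu lam : ℝ) : Idx → Term → ℝ
  | .inl _, .inl _ => 1
  | .inr (.inl _), .inl _ => mu
  | .inr (.inl _), .inr (.inl _) => lam + mu
  | .inr (.inl _), .inr (.inr (.inl _)) => 1
  | .inr (.inl _), .inr (.inr (.inr _)) => -1
  | .inr (.inr _), .inr (.inr (.inl _)) => -1
  | _, _ => 0

/-- The component that enters a term. -/
def termIdx : Idx → Term → Idx
  | .inl _, .inl j => .inr (.inl j)
  | .inr (.inl i), .inl _ => .inr (.inl i)
  | .inr (.inl _), .inr (.inl j) => .inr (.inl j)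
  | .inr (.inl i), .inr (.inr (.inr k)) => .inr (.inr (i, k))
  | .inr (.inr (i, _)), .inr (.inr (.inl _)) => .inr (.inl i)
  | _, _ => .inl ()

/-- The differential operator of a term. -/
def termOp : Idx → Term → (R3 → ℝ) → R3 → ℝ
  | .inl _, .inl j => pderiv j
  | .inr (.inl _), .inl j => fun φ => pderiv j (pderiv j φ)
  | .inr (.inl i), .inr (.inl j) => fun φ => pderiv j (pderiv i φ)
  | .inr (.inl i), .inr (.inr (.inl _)) => pderiv i
  | .inr (.inl _), .inr (.inr (.inr k)) => pderiv k
  | .inr (.inr (_, j)), .inr (.inr (.inl _)) => pderiv j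
  | _, _ => fun φ => φ

/-- The symbol of a term. -/
def termSym : Idx → Term → R3 → ℂ
  | .inl _, .inl j => fun ξ => Complex.I * freq j ξ
  | .inr (.inl _), .inl j => fun ξ => Complex.I * freq j ξ * (Complex.I * freq j ξ)
  | .inr (.inl i), .inr (.inl j) => fun ξ => Complex.I * freq j ξ * (Complex.I * freq i ξ)
  | .inr (.inl i), .inr (.inr (.inl _)) => fun ξ => Complex.I * freq i ξ
  | .inr (.inl _), .inr (.inr (.inr k)) => fun ξ => Complex.I * freq k ξ
  | .inr (.inr (_, j)), .inr (.inr (.inl _)) => fun ξ => Complex.I * freq j ξ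
  | _, _ => fun _ => 1

lemma isSymbol_termOp (a : Idx) (c : Term) : IsSymbol (termOp a c) (termSym a c) := by
  rcases a with _ | i | ⟨i, j⟩ <;> rcases c with j | j | _ | k
  exacts [isSymbol_pderiv _, .id, .id, .id,
    (isSymbol_pderiv _).comp (isSymbol_pderiv _), (isSymbol_pderiv _).comp (isSymbol_pderiv _),
    isSymbol_pderiv _, isSymbol_pderiv _, .id, .id, isSymbol_pderiv _, .id]

/-- The right-hand side of the equation for one component, tested with `φ`. -/
def sysRhs (mu lam : ℝ) (U : Triple 2) (a : Idx) (φ : R3 → ℝ) : ℝ :=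
  ∑ c, termCoef mu lam a c * pair (comp U (termIdx a c)) (termOp a c φ)

lemma sysRhs_density (mu lam : ℝ) (U : Triple 2) (φ : R3 → ℝ) :
    sysRhs mu lam U (.inl ()) φ = ∑ i, pair (U.2.1 i) (pderiv i φ) := by
  simp [sysRhs, Fintype.sum_sum_type, termCoef, termIdx, termOp, comp]

lemma sysRhs_velocity (mu lam : ℝ) (U : Triple 2) (i : Fin 3) (φ : R3 → ℝ) :
    sysRhs mu lam U (.inr (.inl i)) φ = mu * ∑ j, pair (U.2.1 i) (pderiv j (pderiv j φ))
        + (lam + mu) * ∑ j, pair (U.2.1 j) (pderiv j (pderiv i φ))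
        + pair U.1 (pderiv i φ) - ∑ k, pair (U.2.2 i k) (pderiv k φ) := by
  simp only [sysRhs, Fintype.sum_sum_type, termCoef, termIdx, termOp, comp, ← Finset.mul_sum,
    Finset.univ_unique, Finset.sum_singleton]
  ring

lemma sysRhs_deformation (mu lam : ℝ) (U : Triple 2) (i j : Fin 3) (φ : R3 → ℝ) :
    sysRhs mu lam U (.inr (.inr (i, j))) φ = -pair (U.2.1 i) (pderiv j φ) := by
  simp [sysRhs, Fintype.sum_sum_type, termCoef, termIdx, termOp, comp]

lemma isSolution_iff {mu lam : ℝ} {F : Triple 2} {U : ℝ → Triple 2} :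
    IsSolution mu lam F U ↔ ContinuousOn U (Ici 0) ∧ U 0 = F ∧ ∀ φ, IsTest φ → ∀ a t, 0 ≤ t →
      HasDerivWithinAt (fun s => pair (comp (U s) a) φ) (sysRhs mu lam (U t) a φ) (Ici 0) t := by
  constructor
  · rintro ⟨h1, h2, h3, h4, h5⟩
    refine ⟨h1, h2, fun φ hφ a t ht => ?_⟩
    rcases a with _ | i | ⟨i, j⟩
    · rw [sysRhs_density]; exact h3 φ hφ t ht
    · rw [sysRhs_velocity]; exact h4 φ hφ i t ht
    · rw [sysRhs_deformation]; exact h5 φ hφ i j t ht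
  · rintro ⟨h1, h2, h⟩
    refine ⟨h1, h2, fun φ hφ t ht => ?_, fun φ hφ i t ht => ?_, fun φ hφ i j t ht => ?_⟩
    · rw [← sysRhs_density mu lam]; exact h φ hφ (.inl ()) t ht
    · rw [← sysRhs_velocity]; exact h φ hφ (.inr (.inl i)) t ht
    · rw [← sysRhs_deformation mu lam]; exact h φ hφ (.inr (.inr (i, j))) t ht

lemma IsSolution.congr {mu lam : ℝ} {F : Triple 2} {U V : ℝ → Triple 2}
    (h : IsSolution mu lam F U) (hUV : EqOn V U (Ici 0)) : IsSolution mu lam F V := by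
  rw [isSolution_iff] at h ⊢
  obtain ⟨h1, h2, h3⟩ := h
  refine ⟨h1.congr hUV, (hUV self_mem_Ici).trans h2, fun φ hφ a t ht => ?_⟩
  rw [hUV ht]
  exact (h3 φ hφ a t ht).congr (fun s hs => by rw [hUV hs]) (by rw [hUV ht])

/-! ### Existence -/

/-- The admissible part y satisfies the equations by construction of the symbol. The rest x - y has
no velocity, and by `static_relation` its pressure gradient cancels its elastic force, so it can be
added on the right. The conjugates of the symbols appear because the operators act on the test
functions. -/
lemma sum_sym_one_eq {mu lam t : ℝ} {ξ : R3} (hξ : ξ ≠ 0) (x y : Idx → ℂ)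
    (hy : y = fun a => ∑ b, coefP a b ξ * x b) (a : Idx) :
    ∑ d, sym mu lam 1 t a d ξ * y d = ∑ c, termCoef mu lam a c * (starRingEnd ℂ) (termSym a c ξ) *
      (∑ d, sym mu lam 0 t (termIdx a c) d ξ * y d + (x (termIdx a c) - y (termIdx a c))) := by
  have hadm : Adm ξ y := by rw [hy]; exact adm_coefP hξ x
  have hv : ∀ i, x (.inr (.inl i)) - y (.inr (.inl i)) = 0 := fun i => by
    rw [hy]; simp only [sum_coefP_velocity, sub_self]
  have hs := fun i => static_relation hξ x i
  rw [show (∑ b, coefP (.inl ()) b ξ * x b) = y (.inl ()) by rw [hy]] at hs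
  simp only [show ∀ i k, (∑ b, coefP (.inr (.inr (i, k))) b ξ * x b) = y (.inr (.inr (i, k))) by
    intro i k; rw [hy]] at hs
  have hrad : ((∑ i, (freq i ξ : ℂ) ^ 2)) = (rad ξ : ℂ) ^ 2 := by exact_mod_cast sum_freq_sq ξ
  have hI := Complex.I_sq
  -- With the evolved components hidden behind one name, the remaining identities are polynomial in
  -- them.
  obtain ⟨Z, hZ⟩ : ∃ Z : Idx → ℂ, ∀ a, ∑ d, sym mu lam 0 t a d ξ * y d = Z a := ⟨_, fun _ => rfl⟩
  rcases a with _ | i | ⟨i, j⟩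
  · rw [sym_density_ode hξ hadm]
    simp only [hZ]
    simp only [Fintype.sum_sum_type, termCoef, termIdx, termSym, hv, map_mul, Complex.conj_I,
      Complex.conj_ofReal, add_zero, Complex.ofReal_one, Complex.ofReal_zero, zero_mul,
      Finset.sum_const_zero, one_mul, Finset.mul_sum, ← Finset.sum_neg_distrib]
    exact Finset.sum_congr rfl fun _ _ => by ring
  · rw [sym_velocity_ode hξ hadm]
    have hs := hs i
    simp only [hZ]
    simp only [Fintype.sum_sum_type, termCoef, termIdx, termSym, hv, map_mul, Complex.conj_I,
      Complex.conj_ofReal, add_zero, Complex.ofReal_one, Complex.ofReal_neg, Complex.ofReal_add, one_mul, Finset.univ_unique, Finset.sum_singleton]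
    simp only [Fin.sum_univ_three] at hs hrad ⊢
    linear_combination (mu * Z (.inr (.inl i))) * hrad + Complex.I * hs -
      (mu * Z (.inr (.inl i)) * (freq 0 ξ ^ 2 + freq 1 ξ ^ 2 + freq 2 ξ ^ 2) +
        (lam + mu) * freq i ξ * (freq 0 ξ * Z (.inr (.inl 0)) + freq 1 ξ * Z (.inr (.inl 1)) +
          freq 2 ξ * Z (.inr (.inl 2)))) * hI
  · rw [sym_deformation_ode hξ hadm]
    simp only [hZ]
    simp only [Fintype.sum_sum_type, termCoef, termIdx, termSym, hv, map_mul, Complex.conj_I,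
      Complex.conj_ofReal, add_zero, Complex.ofReal_one, Complex.ofReal_zero, Complex.ofReal_neg,
      zero_mul, Finset.sum_const_zero, zero_add, Finset.univ_unique, Finset.sum_singleton]
    ring

lemma norm_sq_eq_integral (f : CL2) : ‖f‖ ^ 2 = ∫ ξ, ‖f ξ‖ ^ 2 := by
  have h := inner_self_eq_norm_sq_to_K (𝕜 := ℂ) f
  rw [inner_CL2] at h
  have e : ∫ ξ, (starRingEnd ℂ) (f ξ) * f ξ = ((∫ ξ, ‖f ξ‖ ^ 2 : ℝ) : ℂ) := by
    rw [← integral_complex_ofReal]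
    refine integral_congr_ae (Eventually.of_forall fun ξ => ?_)
    simp only [Complex.conj_mul', Complex.ofReal_pow]
  rw [e] at h
  refine Complex.ofReal_injective ?_
  rw [h]
  simp

lemma integrable_norm_sq (f : CL2) : Integrable (fun ξ => ‖f ξ‖ ^ 2) :=
  (memLp_two_iff_integrable_sq_norm (Lp.aestronglyMeasurable f)).1 (Lp.memLp f)

/-- Strong convergence by dominated convergence. It also covers time 0, where the time derivative of
the symbol is unbounded in the frequency and the argument in operator norm is not available. -/
lemma tendsto_mulOp_apply {m : ℝ → R3 → ℂ} {m₀ : R3 → ℂ} {l : Filter ℝ} [l.IsCountablyGenerated]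
    {B : ℝ} (hm : ∀ᶠ s in l, Measurable (m s) ∧ ∀ ξ, ‖m s ξ‖ ≤ B) (hm₀ : Measurable m₀)
    (hB : ∀ ξ, ‖m₀ ξ‖ ≤ B) (h : ∀ ξ, Tendsto (fun s => m s ξ) l (𝓝 (m₀ ξ))) (f : CL2) :
    Tendsto (fun s => mulOp (m s) f) l (𝓝 (mulOp m₀ f)) := by
  rw [tendsto_iff_norm_sub_tendsto_zero]
  suffices h2 : Tendsto (fun s => ‖mulOp (m s) f - mulOp m₀ f‖ ^ 2) l (𝓝 0) by
    have := h2.sqrt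
    simpa [Real.sqrt_sq (norm_nonneg _)] using this
  have e : ∀ᶠ s in l, ∫ ξ, ‖(m s ξ - m₀ ξ) * f ξ‖ ^ 2 = ‖mulOp (m s) f - mulOp m₀ f‖ ^ 2 := by
    filter_upwards [hm] with s hs
    rw [norm_sq_eq_integral]
    refine integral_congr_ae ?_
    filter_upwards [Lp.coeFn_sub (mulOp (m s) f) (mulOp m₀ f), coeFn_mulOp ⟨hs.1, B, hs.2⟩ f,
      coeFn_mulOp ⟨hm₀, B, hB⟩ f] with ξ h1 h2 h3
    rw [h1, Pi.sub_apply, h2, h3, sub_mul]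
  refine Tendsto.congr' e ?_
  have h0 : ∫ _ξ : R3, (0 : ℝ) = 0 := integral_zero _ _
  rw [← h0]
  refine tendsto_integral_filter_of_dominated_convergence
    (fun ξ => (2 * B) ^ 2 * ‖f ξ‖ ^ 2) ?_ ?_ ((integrable_norm_sq f).const_mul _) ?_
  · filter_upwards [hm] with s hs
    exact (((hs.1.sub hm₀).aestronglyMeasurable.mul (Lp.aestronglyMeasurable f)).norm.pow 2)
  · filter_upwards [hm] with s hs
    refine Eventually.of_forall fun ξ => ?_
    rw [Real.norm_of_nonneg (by positivity), norm_mul, mul_pow]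
    have : ‖m s ξ - m₀ ξ‖ ≤ 2 * B := (norm_sub_le _ _).trans (by linarith [hs.2 ξ, hB ξ])
    gcongr
  · refine Eventually.of_forall fun ξ => ?_
    have := (((h ξ).sub_const (m₀ ξ)).mul_const (f ξ)).norm.pow 2
    simpa using this

/-- One-sided differentiation under the integral sign. -/
lemma hasDerivWithinAt_integral_Ici {G G' : ℝ → R3 → ℂ} {bound : R3 → ℝ}
    (hG : ∀ t ξ, HasDerivAt (fun t => G t ξ) (G' t ξ) t)
    (hint : ∀ t, 0 ≤ t → Integrable (G t)) (hb : ∀ t, 0 ≤ t → ∀ ξ, ‖G' t ξ‖ ≤ bound ξ)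
    (hbound : Integrable bound) {t : ℝ} (ht : 0 ≤ t) :
    HasDerivWithinAt (fun s => ∫ ξ, G s ξ) (∫ ξ, G' t ξ) (Ici 0) t := by
  rw [hasDerivWithinAt_iff_tendsto_slope]
  have hmem : ∀ᶠ s in 𝓝[Ici 0 \ {t}] t, 0 ≤ s :=
    eventually_mem_nhdsWithin.mono fun s hs => hs.1
  have e : ∀ᶠ s in 𝓝[Ici 0 \ {t}] t, ∫ ξ, slope (fun t => G t ξ) t s =
      slope (fun s => ∫ ξ, G s ξ) t s := by
    filter_upwards [hmem] with s hs
    simp only [slope, vsub_eq_sub]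
    rw [integral_smul, integral_sub (hint s hs) (hint t ht)]
  refine Tendsto.congr' e ?_
  refine tendsto_integral_filter_of_dominated_convergence bound ?_ ?_ hbound ?_
  · filter_upwards [hmem] with s hs
    simp only [slope, vsub_eq_sub]
    exact ((hint s hs).sub (hint t ht)).aestronglyMeasurable.const_smul _
  · filter_upwards [hmem] with s hs
    refine Eventually.of_forall fun ξ => ?_
    have h1 := (convex_Ici (0 : ℝ)).norm_image_sub_le_of_norm_hasDerivWithin_le
      (f := fun t => G t ξ) (f' := fun t => G' t ξ) (C := bound ξ)
      (fun x _ => (hG x ξ).hasDerivWithinAt) (fun x hx => hb x hx ξ) ht hs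
    have hb0 : 0 ≤ bound ξ := (norm_nonneg _).trans (hb t ht ξ)
    simp only [slope, vsub_eq_sub]
    rw [norm_smul, norm_inv]
    rcases eq_or_ne s t with rfl | hst
    · simpa using hb0
    · have : 0 < ‖s - t‖ := norm_pos_iff.2 (sub_ne_zero.2 hst)
      rw [inv_mul_le_iff₀ this, mul_comm]
      exact h1
  · refine Eventually.of_forall fun ξ => ?_
    exact (hasDerivWithinAt_iff_tendsto_slope.1 (hG t ξ).hasDerivWithinAt)

section Existence

variable {mu lam : ℝ}

lemma comp_solOp (t : ℝ) (F : Triple 2) (a : Idx) : comp (solOp mu lam t F) a =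
    realPart (𝓕⁻ (evolve mu lam (fun _ => 1) t (analysis F) a) : CL2) := by
  rw [solOp, ContinuousLinearMap.comp_apply, comp_synthesis]
  rfl

lemma bdd_coefP (a b : Idx) : Bdd (coefP a b) := ⟨measurable_coefP a b, 2, norm_coefP_le a b⟩

variable (hmu : 0 < mu) (hlam : 0 ≤ 2 * mu + 3 * lam)

include hmu hlam

lemma evolve_one_ae_eq {t : ℝ} (ht : 0 ≤ t) (u : Idx → CL2) (a : Idx) :
    evolve mu lam (fun _ => 1) t u a =ᵐ[volume] fun ξ =>
      ∑ c, sym mu lam 0 t a c ξ * matOp coefP u c ξ + (u a ξ - matOp coefP u a ξ) := by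
  filter_upwards [coeFn_evolve hmu hlam bdd_one ht u a,
    ae_all_iff.2 fun c => coeFn_matOp bdd_coefP u c] with ξ h1 h2
  rw [h1, one_mul, sum_propag]
  simp only [h2]

lemma continuousOn_solOp (F : Triple 2) : ContinuousOn (fun t => solOp mu lam t F) (Ici 0) := by
  have h1 : ContinuousOn (fun t => evolve mu lam (fun _ => 1) t (analysis F)) (Ici 0) := by
    rw [continuousOn_pi]
    intro a t ht
    simp only [evolve, matOp_apply, one_mul]
    refine tendsto_finsetSum _ fun b _ => ?_
    refine tendsto_mulOp_apply (B := 107) ?_ (measurable_propag mu lam t a b)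
      (norm_propag_le hmu hlam ht a b) (fun ξ => ?_) (analysis F b)
    · filter_upwards [self_mem_nhdsWithin] with s hs
      exact ⟨measurable_propag mu lam s a b, norm_propag_le hmu hlam hs a b⟩
    · unfold propag
      refine Tendsto.add_const _ (tendsto_finsetSum _ fun c _ => Tendsto.mul_const _ ?_)
      exact (hasDerivAt_sym mu lam 0 t a c ξ).continuousAt.continuousWithinAt
  exact synthesis.continuous.comp_continuousOn h1

lemma solOp_zero (F : Triple 2) : solOp mu lam 0 F = F := by
  refine comp_injective fun a => ?_
  rw [comp_solOp]
  have : evolve mu lam (fun _ => 1) 0 (analysis F) a = analysis F a := by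
    ext1
    filter_upwards [evolve_one_ae_eq hmu hlam le_rfl (analysis F) a,
      ae_all_iff.2 fun c => coeFn_matOp bdd_coefP (analysis F) c, ae_ne_zero] with ξ h1 h2 h0
    rw [h1]
    simp only [h2]
    rw [sym_zero_time h0 (adm_coefP h0 fun b => analysis F b ξ)]
    ring
  rw [this, analysis_apply, fourierInv_fourier_eq, realPart_cplx]

/-- On the frequency side the pairing with a test function is an integral whose integrand solves the
system pointwise. Differentiation under the integral is justified by the rapid decay of the
transformed test function, which beats the factor 1 + rad². -/
lemma isSolution_solOp (F : Triple 2) : IsSolution mu lam F (fun t => solOp mu lam t F) := by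
  refine isSolution_iff.2 ⟨continuousOn_solOp hmu hlam F, solOp_zero hmu hlam F,
    fun φ hφ a t ht => ?_⟩
  set u := analysis F with hu
  set y := matOp coefP u with hy
  set η := (𝓕 hφ.toSchwartz : 𝓢(R3, ℂ)) with hη
  obtain ⟨C, hC, hsym⟩ := exists_norm_sym_one_le hmu hlam
  let G : ℝ → R3 → ℂ := fun s ξ => (starRingEnd ℂ) (η ξ) *
    (∑ c, sym mu lam 0 s a c ξ * y c ξ + (u a ξ - y a ξ))
  let G' : ℝ → R3 → ℂ := fun s ξ => (starRingEnd ℂ) (η ξ) * ∑ c, sym mu lam 1 s a c ξ * y c ξ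
  have hG : ∀ s ξ, HasDerivAt (fun s => G s ξ) (G' s ξ) s := fun s ξ =>
    ((HasDerivAt.fun_sum fun c _ => (hasDerivAt_sym mu lam 0 s a c ξ).mul_const _).add_const
      _).const_mul _
  have hGe : ∀ s, 0 ≤ s → (fun ξ => (starRingEnd ℂ) (1 * η ξ) *
      evolve mu lam (fun _ => 1) s u a ξ) =ᵐ[volume] G s := fun s hs => by
    filter_upwards [evolve_one_ae_eq hmu hlam hs u a] with ξ h1
    rw [h1, one_mul]
  have hint : ∀ s, 0 ≤ s → Integrable (G s) := fun s hs =>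
    (IsSymbol.id.integrable η _).congr (hGe s hs)
  have hpair : ∀ s, 0 ≤ s → pair (comp (solOp mu lam s F) a) φ = (∫ ξ, G s ξ).re := by
    intro s hs
    rw [comp_solOp, IsSymbol.id.pair_realPart_fourierInv hφ]
    exact congrArg Complex.re (integral_congr_ae (hGe s hs))
  -- This is C (1 + rad²) ‖η‖ ‖y‖ summed over the components, with rad² written as the sum of
  -- squared frequencies so that each term is a differential symbol applied to a Schwartz function.
  let bound : R3 → ℝ := fun ξ => ∑ c, (C * ‖(starRingEnd ℂ) (1 * η ξ) * y c ξ‖ +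
    ∑ i, C * ‖(starRingEnd ℂ) (Complex.I * freq i ξ * (Complex.I * freq i ξ) * η ξ) * y c ξ‖)
  have hbound : Integrable bound := by
    refine integrable_finsetSum _ fun c _ => ?_
    refine ((IsSymbol.id.integrable η _).norm.const_mul C).add ?_
    refine integrable_finsetSum _ fun i _ => ?_
    exact ((((isSymbol_pderiv i).comp (isSymbol_pderiv i)).integrable η _).norm.const_mul C)
  have hb : ∀ s, 0 ≤ s → ∀ ξ, ‖G' s ξ‖ ≤ bound ξ := by
    intro s hs ξ
    rw [norm_mul, RCLike.norm_conj]
    refine (mul_le_mul_of_nonneg_left (norm_sum_le _ _) (norm_nonneg _)).trans ?_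
    rw [Finset.mul_sum]
    refine Finset.sum_le_sum fun c _ => ?_
    have e : C * ‖(starRingEnd ℂ) (1 * η ξ) * y c ξ‖ + ∑ i, C * ‖(starRingEnd ℂ)
        (Complex.I * freq i ξ * (Complex.I * freq i ξ) * η ξ) * y c ξ‖ =
        ‖η ξ‖ * ((C * (1 + rad ξ ^ 2)) * ‖y c ξ‖) := by
      simp only [norm_mul, RCLike.norm_conj, Complex.norm_I, one_mul, Complex.norm_real,
        Real.norm_eq_abs, abs_mul_abs_self]
      rw [← sum_freq_sq, ← Finset.mul_sum, ← Finset.sum_mul, ← Finset.sum_mul]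
      simp only [sq]
      ring
    rw [e, norm_mul]
    gcongr
    exact hsym s hs a c ξ
  have key := hasDerivWithinAt_integral_Ici hG hint hb hbound ht
  have key2 : HasDerivWithinAt (fun s => (∫ ξ, G s ξ).re) (∫ ξ, G' t ξ).re (Ici 0) t :=
    Complex.reCLM.hasFDerivAt.comp_hasDerivWithinAt t key
  have hrhs : sysRhs mu lam (solOp mu lam t F) a φ = (∫ ξ, G' t ξ).re := by
    have h1 : ∀ c, termCoef mu lam a c * pair (comp (solOp mu lam t F) (termIdx a c))
        (termOp a c φ) = (∫ ξ, (termCoef mu lam a c : ℂ) *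
          ((starRingEnd ℂ) (termSym a c ξ * η ξ) *
            evolve mu lam (fun _ => 1) t u (termIdx a c) ξ)).re := by
      intro c
      rw [comp_solOp, (isSymbol_termOp a c).pair_realPart_fourierInv hφ, integral_const_mul,
        Complex.re_ofReal_mul]
    rw [sysRhs, Finset.sum_congr rfl fun c _ => h1 c, ← Complex.re_sum, ← integral_finsetSum _
      fun c _ => ((isSymbol_termOp a c).integrable η _).const_mul _]
    refine congrArg Complex.re (integral_congr_ae ?_)
    filter_upwards [ae_all_iff.2 fun e => evolve_one_ae_eq hmu hlam ht u e,
      ae_all_iff.2 fun c => coeFn_matOp bdd_coefP u c, ae_ne_zero] with ξ h1 h2 h0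
    simp only [h1, G']
    rw [sum_sym_one_eq h0 (fun b => u b ξ) (fun b => y b ξ) (funext h2), Finset.mul_sum]
    refine Finset.sum_congr rfl fun c _ => ?_
    rw [map_mul]
    ring
  rw [hrhs]
  exact key2.congr (fun s hs => hpair s hs) (hpair t ht)

end Existence

/-! ### Uniqueness -/

lemma IsTest.memLp {φ : R3 → ℝ} (h : IsTest φ) : MemLp φ 2 (volume : Measure R3) :=
  h.1.continuous.memLp_of_hasCompactSupport h.2

lemma IsSymbol.isTest {D : (R3 → ℝ) → R3 → ℝ} {p : R3 → ℂ} (hD : IsSymbol D p) {φ : R3 → ℝ}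
    (h : IsTest φ) : IsTest (D φ) := by
  obtain ⟨T, hT, -⟩ := hD.exists_clm
  exact (hT φ h).1

/-- The pairing with a test function as a bounded functional. -/
def pairCLM {φ : R3 → ℝ} (h : IsTest φ) : ScalarLp 2 →L[ℝ] ℝ := innerSL ℝ (h.memLp.toLp φ)

lemma pairCLM_apply {φ : R3 → ℝ} (h : IsTest φ) (f : ScalarLp 2) : pairCLM h f = pair f φ := by
  rw [pairCLM, innerSL_apply_apply, L2.inner_def, pair]
  refine integral_congr_ae ?_
  filter_upwards [h.memLp.coeFn_toLp] with x hx
  simp [hx, mul_comm]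

/-- The right-hand side of the system, tested with a test function, as a bounded functional. -/
def sysCLM (mu lam : ℝ) (a : Idx) {φ : R3 → ℝ} (h : IsTest φ) : Triple 2 →L[ℝ] ℝ :=
  ∑ c, termCoef mu lam a c • (pairCLM ((isSymbol_termOp a c).isTest h)).comp
    (compCLM 2 (termIdx a c))

lemma sysCLM_apply (mu lam : ℝ) (a : Idx) {φ : R3 → ℝ} (h : IsTest φ) (U : Triple 2) :
    sysCLM mu lam a h U = sysRhs mu lam U a φ := by
  simp only [sysCLM, _root_.sum_apply, _root_.smul_apply,
    ContinuousLinearMap.comp_apply, pairCLM_apply, smul_eq_mul]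
  rfl

lemma bdd_lowCut_mul (R : ℝ) {p : R3 → ℂ} (hp : Continuous p) :
    Bdd (fun ξ => lowCut R ξ * p ξ) := by
  obtain ⟨B, hB⟩ := (isCompact_closedBall (0 : R3) R).exists_bound_of_continuousOn hp.continuousOn
  refine ⟨(bdd_lowCut R).measurable.mul hp.measurable, |B|, fun ξ => ?_⟩
  unfold lowCut
  split_ifs with h
  · rw [one_mul]
    refine (hB ξ ?_).trans (le_abs_self B)
    rw [mem_closedBall_zero_iff]
    refine le_trans ?_ h.le
    unfold rad
    exact le_mul_of_one_le_left (norm_nonneg _) (by linarith [Real.pi_gt_three])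
  · simp

lemma eq_zero_of_forall_mulOp_lowCut {f : CL2} (h : ∀ R : ℝ, mulOp (lowCut R) f = 0) : f = 0 := by
  ext1
  have h1 : ∀ᵐ ξ, ∀ n : ℕ, lowCut n ξ * f ξ = 0 := ae_all_iff.2 fun n => by
    have h2 := coeFn_mulOp (bdd_lowCut n) f
    rw [h n] at h2
    filter_upwards [h2, Lp.coeFn_zero ℂ 2 (volume : Measure R3)] with ξ h3 h4
    rw [← h3, h4, Pi.zero_apply]
  filter_upwards [h1, Lp.coeFn_zero ℂ 2 (volume : Measure R3)] with ξ h2 h3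
  obtain ⟨n, hn⟩ := exists_nat_gt (rad ξ)
  rw [h3]
  simpa [lowCut, hn] using h2 n

/-- Moving everything to one side gives a single linear differential relation between the components
of w and of W, which `Represents.sum_symbol_eq_zero` makes pointwise. -/
lemma analysis_eq_of_forall_pair {mu lam : ℝ} {w W : Triple 2}
    (h : ∀ φ, IsTest φ → ∀ a, pair (comp w a) φ = sysRhs mu lam W a φ) (a : Idx) :
    ∀ᵐ ξ, analysis w a ξ = ∑ c, termCoef mu lam a c * (starRingEnd ℂ) (termSym a c ξ) *
      analysis W (termIdx a c) ξ := by
  have := Represents.sum_symbol_eq_zero isOpen_univ (ι := Option Term)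
    (f := fun c => c.elim (comp w a) fun c => comp W (termIdx a c))
    (a := fun c => c.elim (analysis w a) fun c => analysis W (termIdx a c))
    (fun c => by cases c <;> exact represents_fourier _)
    (D := fun c => c.elim (fun φ => φ) fun c => termOp a c)
    (p := fun c => c.elim (fun _ => 1) fun c => termSym a c)
    (fun c => by cases c; exacts [IsSymbol.id, isSymbol_termOp a _])
    (fun c => c.elim 1 fun c => -termCoef mu lam a c)
    (fun φ hφ => by
      simp only [Fintype.sum_option, Option.elim_none, Option.elim_some, one_mul, neg_mul,
        Finset.sum_neg_distrib]
      rw [h φ hφ a, sysRhs, add_neg_cancel])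
  filter_upwards [this] with ξ h1
  have h1 := h1 (mem_univ ξ)
  simp only [Fintype.sum_option, Option.elim_none, Option.elim_some, one_mul, Complex.ofReal_one,
    Complex.ofReal_neg, neg_mul, Finset.sum_neg_distrib] at h1
  rw [← sub_eq_add_neg, sub_eq_zero] at h1
  have h2 := congrArg (starRingEnd ℂ) h1
  simpa [mul_assoc] using h2

/-- A continuous curve that solves the system with vanishing initial value vanishes. -/
lemma eq_zero_of_isSolution_zero {mu lam : ℝ} {w : ℝ → Triple 2} (h : IsSolution mu lam 0 w)
    {t : ℝ} (ht : 0 ≤ t) : w t = 0 := by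
  obtain ⟨hc, h0, hd⟩ := isSolution_iff.1 h
  -- The curve is frozen at its initial value for negative times, so that its primitive is
  -- differentiable on the whole line.
  let v : ℝ → Triple 2 := fun s => w (max s 0)
  have hv : Continuous v := hc.comp_continuous (by fun_prop) fun s => le_max_right s 0
  have hvw : ∀ s, 0 ≤ s → v s = w s := fun s hs => by simp only [v, max_eq_left hs]
  -- The curve w is only weakly differentiable. Passing to the primitive replaces the evolution
  -- equation by the static relation w = A W, which can be transformed at a fixed time.
  let W : ℝ → Triple 2 := fun s => ∫ τ in (0 : ℝ)..s, v τ
  have hW : ∀ s, HasDerivAt W (v s) s := fun s => by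
    exact intervalIntegral.integral_hasDerivAt_right (hv.intervalIntegrable _ _)
      (hv.stronglyMeasurableAtFilter _ _) hv.continuousAt
  have hW0 : W 0 = 0 := intervalIntegral.integral_same
  have hpair : ∀ s, 0 ≤ s → ∀ φ, IsTest φ → ∀ a, pair (comp (w s) a) φ =
      sysRhs mu lam (W s) a φ := by
    intro s hs φ hφ a
    -- Both terms have the same derivative on the half line and vanish at time 0.
    let g : ℝ → ℝ := fun s => pair (comp (w s) a) φ - sysCLM mu lam a hφ (W s)
    have hg : ∀ x ∈ Ici (0 : ℝ), HasDerivWithinAt g 0 (Ici 0) x := by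
      intro x hx
      have h1 := ((sysCLM mu lam a hφ).hasFDerivAt.comp_hasDerivAt x (hW x)).hasDerivWithinAt
        (s := Ici 0)
      have h2 := (hd φ hφ a x hx).sub h1
      rw [hvw x hx, sysCLM_apply, sub_self] at h2
      exact h2
    have h3 := (convex_Ici (0 : ℝ)).norm_image_sub_le_of_norm_hasDerivWithin_le (C := 0) hg
      (fun x _ => by simp) self_mem_Ici hs
    have h4 : g s = g 0 := by
      rw [zero_mul] at h3
      exact sub_eq_zero.1 (norm_le_zero_iff.1 h3)
    have h5 : g 0 = 0 := by
      simp only [g, hW0, map_zero, sub_zero, h0]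
      rw [← pairCLM_apply hφ]
      exact ((pairCLM hφ).comp (compCLM 2 a)).map_zero
    rw [← sysCLM_apply mu lam a hφ]
    exact sub_eq_zero.1 (h4.trans h5)
  have hfreq := fun s hs => analysis_eq_of_forall_pair (hpair s hs)
  have hlow : ∀ R s, 0 ≤ s → ∀ a, mulOp (lowCut R) (analysis (W s) a) = 0 := by
    intro R
    let Φ : Triple 2 →L[ℝ] (Idx → CL2) := ContinuousLinearMap.pi fun a =>
      ((mulOp (lowCut R)).restrictScalars ℝ).comp ((ContinuousLinearMap.proj a).comp analysis)
    have hΦ : ∀ U a, Φ U a = mulOp (lowCut R) (analysis U a) := fun U a => rfl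
    -- Below the cutoff the polynomial symbols are bounded, so the truncated transform Y of W
    -- satisfies ‖Y'‖ ≤ K ‖Y‖ with Y(0) = 0.
    let k : Idx → Term → R3 → ℂ := fun a c ξ =>
      lowCut R ξ * (termCoef mu lam a c * (starRingEnd ℂ) (termSym a c ξ))
    have hk : ∀ a c, Bdd (k a c) := fun a c => bdd_lowCut_mul R (continuous_const.mul
      (Complex.continuous_conj.comp (isSymbol_termOp a c).growth.1.continuous))
    have hΦw : ∀ s, 0 ≤ s → ∀ a, Φ (w s) a = ∑ c, mulOp (k a c) (Φ (W s) (termIdx a c)) := by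
      intro s hs a
      rw [hΦ]
      ext1
      have h1 : ∀ᵐ ξ, ∀ c, mulOp (k a c) (Φ (W s) (termIdx a c)) ξ =
          k a c ξ * Φ (W s) (termIdx a c) ξ := ae_all_iff.2 fun c => coeFn_mulOp (hk a c) _
      have h2 : ∀ᵐ ξ, ∀ c, Φ (W s) c ξ = lowCut R ξ * analysis (W s) c ξ :=
        ae_all_iff.2 fun c => coeFn_mulOp (bdd_lowCut R) _
      filter_upwards [coeFn_mulOp (bdd_lowCut R) (analysis (w s) a), hfreq s hs a, h1, h2,
        Lp.coeFn_finsetSum (Finset.univ : Finset Term) fun c =>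
          mulOp (k a c) (Φ (W s) (termIdx a c))] with ξ e1 e2 e3 e4 e5
      rw [e1, e2, e5, Finset.sum_apply, Finset.mul_sum]
      refine Finset.sum_congr rfl fun c _ => ?_
      rw [e3, e4]
      calc lowCut R ξ * (termCoef mu lam a c * (starRingEnd ℂ) (termSym a c ξ) *
          analysis (W s) (termIdx a c) ξ)
          = (lowCut R ξ * lowCut R ξ) * (termCoef mu lam a c * (starRingEnd ℂ) (termSym a c ξ) *
          analysis (W s) (termIdx a c) ξ) := by rw [lowCut_mul_self]
        _ = _ := by simp only [k]; ring
    let K : ℝ := ∑ a, ∑ c, ‖mulOp (k a c)‖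
    have hK0 : 0 ≤ K := by positivity
    have hbound : ∀ s, 0 ≤ s → ‖Φ (w s)‖ ≤ K * ‖Φ (W s)‖ := by
      intro s hs
      refine (pi_norm_le_iff_of_nonneg (by positivity)).2 fun a => ?_
      rw [hΦw s hs a]
      calc ‖∑ c, mulOp (k a c) (Φ (W s) (termIdx a c))‖
          ≤ ∑ c, ‖mulOp (k a c)‖ * ‖Φ (W s)‖ := norm_sum_le_of_le _ fun c _ =>
            ((mulOp (k a c)).le_opNorm _).trans
              (mul_le_mul_of_nonneg_left (norm_le_pi_norm _ _) (norm_nonneg _))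
        _ = (∑ c, ‖mulOp (k a c)‖) * ‖Φ (W s)‖ := by rw [Finset.sum_mul]
        _ ≤ K * ‖Φ (W s)‖ := by
            gcongr
            exact Finset.single_le_sum (f := fun a => ∑ c, ‖mulOp (k a c)‖)
              (fun _ _ => by positivity) (Finset.mem_univ a)
    have hY : ∀ s, HasDerivAt (fun s => Φ (W s)) (Φ (v s)) s := fun s =>
      Φ.hasFDerivAt.comp_hasDerivAt s (hW s)
    intro s hs a
    have hgr := norm_le_gronwallBound_of_norm_deriv_right_le (f := fun s => Φ (W s))
      (f' := fun s => Φ (v s)) (δ := 0) (K := K) (ε := 0) (a := 0) (b := s)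
      (fun x _ => (hY x).continuousAt.continuousWithinAt)
      (fun x _ => (hY x).hasDerivWithinAt) (by simp [hW0])
      (fun x hx => by rw [hvw x hx.1, add_zero]; exact hbound x hx.1) s ⟨hs, le_rfl⟩
    rw [gronwallBound_ε0_δ0] at hgr
    rw [← hΦ, norm_le_zero_iff.1 hgr]
    rfl
  have hWz : ∀ a, analysis (W t) a = 0 := fun a =>
    eq_zero_of_forall_mulOp_lowCut fun R => hlow R t ht a
  refine comp_injective fun a => ?_
  -- Once W vanishes at time t, so does w = A W there; no differentiation of W is needed.
  have hz : analysis (w t) a = 0 := by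
    ext1
    filter_upwards [hfreq t ht a, Lp.coeFn_zero ℂ 2 (volume : Measure R3)] with ξ h1 h2
    rw [h1, h2, Pi.zero_apply]
    refine Finset.sum_eq_zero fun c _ => ?_
    rw [hWz, h2, Pi.zero_apply, mul_zero]
  rw [analysis_apply] at hz
  have hz2 : cplx 2 (comp (w t) a) = 0 := by
    rw [← fourierInv_fourier_eq (F := CL2) (cplx 2 (comp (w t) a)), hz]
    exact fourierInvReal.map_zero
  rw [← realPart_cplx (comp (w t) a), hz2, map_zero]
  rcases a with _ | i | ⟨i, j⟩ <;> rfl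

lemma IsSolution.sub {mu lam : ℝ} {F G : Triple 2} {U V : ℝ → Triple 2}
    (hU : IsSolution mu lam F U) (hV : IsSolution mu lam G V) :
    IsSolution mu lam (F - G) (fun t => U t - V t) := by
  rw [isSolution_iff] at *
  obtain ⟨h1, h2, h3⟩ := hU
  obtain ⟨k1, k2, k3⟩ := hV
  refine ⟨h1.sub k1, by simp only [h2, k2], fun φ hφ a t ht => ?_⟩
  have e : ∀ s, pair (comp (U s - V s) a) φ = pair (comp (U s) a) φ - pair (comp (V s) a) φ :=
    fun s => by
      rw [← pairCLM_apply hφ, ← pairCLM_apply hφ, ← pairCLM_apply hφ]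
      exact ((pairCLM hφ).comp (compCLM 2 a)).map_sub _ _
  have e2 : sysRhs mu lam (U t - V t) a φ =
      sysRhs mu lam (U t) a φ - sysRhs mu lam (V t) a φ := by
    rw [← sysCLM_apply mu lam a hφ, ← sysCLM_apply mu lam a hφ, ← sysCLM_apply mu lam a hφ,
      map_sub]
  rw [e2]
  simp only [e]
  exact (h3 φ hφ a t ht).sub (k3 φ hφ a t ht)

/-- The difference of two solutions with the same data solves the system with zero data, so
uniqueness reduces to `eq_zero_of_isSolution_zero`. -/
lemma isSolutionOperator_solOp {mu lam : ℝ} (hmu : 0 < mu) (hlam : 0 ≤ 2 * mu + 3 * lam) :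
    IsSolutionOperator mu lam (solOp mu lam) := by
  refine fun F U => ⟨fun h t ht => ?_, fun h => (isSolution_solOp hmu hlam F).congr h⟩
  have h1 := h.sub (isSolution_solOp hmu hlam F)
  rw [sub_self] at h1
  exact sub_eq_zero.1 (eq_zero_of_isSolution_zero h1 ht)

end Viscoelastic

end

/-! ### Assembly of the decomposition and its estimates -/

theorem theorem4p1 (mu lam : ℝ) (hmu : 0 < mu) (hlam : 0 ≤ 2 * mu + 3 * lam) :
    ∃ (E : ℝ → Triple 2 →L[ℝ] Triple 2)
      (E₀ : ℝ → (q : ℝ≥0∞) → [Fact (1 ≤ q)] → Triple q →L[ℝ] Triple 2)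
      (Einf : ℝ → Triple 2 →L[ℝ] Triple 2),
      -- `E` is the solution operator, and it splits
      IsSolutionOperator mu lam E ∧
      (∀ t, 0 ≤ t → ∀ F : Triple 2, E t F = E₀ t 2 F + Einf t F) ∧
      -- `E₀ t` is one operator, defined consistently on all the spaces `L^q`, `1 ≤ q ≤ 2`
      (∀ t, 0 ≤ t → ∀ (q r : ℝ≥0∞) [Fact (1 ≤ q)] [Fact (1 ≤ r)], q ≤ 2 → r ≤ 2 →
        ∀ (F : Triple q) (G : Triple r), SameTriple F G → E₀ t q F = E₀ t r G) ∧
      -- all the time derivatives below exist, in `L²`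
      (∀ (q : ℝ≥0∞) [Fact (1 ≤ q)], q ≤ 2 → ∀ F : Triple q, Constrained F →
        ContDiffOn ℝ ∞ (fun t => E₀ t q F) (Ioi 0)) ∧
      (∀ F : Triple 2, Constrained F → ContDiffOn ℝ ∞ (fun t => Einf t F) (Ioi 0)) ∧
      -- (1) the low-frequency part
      (∀ (l m : ℕ) (q : ℝ≥0∞) [Fact (1 ≤ q)], q ≤ 2 →
        (∃ C : ℝ, ∀ F : Triple q, Constrained F → ∀ t, 1 ≤ t →
          dxNorm l 2 (dtIter m (fun s => E₀ s q F) t) ≤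
            ENNReal.ofReal
              (C * t ^ (-(3 / 2) * (1 / q.toReal - 1 / 2) - ((m : ℝ) + l) / 2)) * lqNorm q F) ∧
        (∃ C : ℝ, ∀ F : Triple q, Constrained F → ∀ t, 0 < t → t ≤ 2 →
          dxNorm l 2 (dtIter m (fun s => E₀ s q F) t) ≤ ENNReal.ofReal C * lqNorm q F)) ∧
      -- the high-frequency part; subtraction of natural numbers is truncated at `0`
      (∃ c : ℝ, 0 < c ∧
        -- (2) the estimates in `L²`
        (∀ l m n : ℕ, ∃ C : ℝ, ∀ F : Triple 2, Constrained F → ∀ t, 0 < t →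
          dxNorm l 2 (projIP (dtIter m (fun s => Einf s F) t)) ≤
            ENNReal.ofReal (C * Real.exp (-c * t)) *
              (ENNReal.ofReal (t ^ (-(n : ℝ) / 2)) * hNorm (2 * m + l - n - 1) F
                + wNorm l (l - 1) F)) ∧
        (∀ l m n : ℕ, ∃ C : ℝ, ∀ F : Triple 2, Constrained F → ∀ t, 0 < t →
          dxNorm l 2 (projP (dtIter m (fun s => Einf s F) t)) ≤
            ENNReal.ofReal (C * Real.exp (-c * t)) *
              (ENNReal.ofReal (t ^ (-(n : ℝ) / 2)) *
                  wNorm (2 * m + l - n - 1) (2 * m + l - n) F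
                + wNorm (l - 1) (l - 2) F)) ∧
        -- (3) the estimates in `L^∞`
        (∀ l m : ℕ, ∃ C' : ℝ, ∀ n : ℕ, ∃ C : ℝ, ∀ F : Triple 2, Constrained F → ∀ t, 0 < t →
          dxNorm l ∞ (projIP (dtIter m (fun s => Einf s F) t)) ≤
            ENNReal.ofReal (C * t ^ (-((n : ℝ) / 2 + 3 / 4)) * Real.exp (-c * t)) *
                hNorm (2 * m + l - n - 1) F
              + ENNReal.ofReal (C' * Real.exp (-c * t)) *
                (wNorm l (l + 1) F + hNorm (l + 2) (projIP F))) ∧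
        (∀ l m n : ℕ, ∃ C : ℝ, ∀ F : Triple 2, Constrained F → ∀ t, 0 < t →
          dxNorm l ∞ (projP (dtIter m (fun s => Einf s F) t)) ≤
            ENNReal.ofReal (C * Real.exp (-c * t)) *
              (ENNReal.ofReal (t ^ (-((n : ℝ) / 2 + 3 / 4))) *
                  wNorm (2 * m + l - n - 1) (2 * m + l - n) F
                + wNorm (l + 1) l F))) := by
  obtain ⟨R, c, h⟩ := exists_symbolBounds hmu hlam
  have hc := h.pos
  refine ⟨solOp mu lam, fun t q _ => lowOp mu lam R t q, highOp mu lam R,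
    isSolutionOperator_solOp hmu hlam, fun t ht F => solOp_eq_add hmu hlam R ht F,
    fun t _ q r _ _ hq hr F G hFG => lowOp_congr hq hr hFG,
    fun q _ hq F hF => contDiffOn_lowOp hmu hlam h hq hF,
    fun F hF => contDiffOn_highOp hmu hlam h hF, fun l m q _ hq => ⟨?_, ?_⟩, c / 3, by positivity,
    exists_dxNorm_two_projIP_le hmu hlam h, exists_dxNorm_two_projP_le hmu hlam h,
    exists_dxNorm_top_projIP_le hmu hlam h, exists_dxNorm_top_projP_le hmu hlam h⟩
  · obtain ⟨C, hC⟩ := exists_dxNorm_lowOp_decay hmu hlam h l m q hq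
    exact ⟨C, fun F hF t ht => hC F hF t (one_pos.trans_le ht)⟩
  · obtain ⟨C, hC⟩ := exists_dxNorm_lowOp_le hmu hlam h l m q hq
    exact ⟨C, fun F hF t ht _ => hC F hF t ht⟩
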